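/- Let $n\ge 1$, let $H$ be a compact connected Hausdorff smooth manifold without boundary of dimension $n-1$, and let $U=(-1,1)\times H$, with coordinate $r$ on $(-1,1)$. Let $\Lambda$ be a smooth $n$-vector field on $U$ that is generic (its graph is transverse to the zero section of $\wedge^nTU$) and vanishes on $H=\{0\}\times H$, and let $X^H_\Lambda\in\mathfrak X^{n-1}(H)$ be its modular $(n-1)$-vector field along $H$, i.e. $i_{X^H_\Lambda}\Omega=d\Lambda^H\otimes\Omega$ for every volume form $\Omega$, where $d\Lambda^H$ is the intrinsic derivative of $\Lambda$ along $H$; equivalently, $d\Lambda^H(v)=X^H_\Lambda\wedge v$ for all vectors $v\in T_HU$. Suppose that $\Lambda$ is linear in the collar: $\Lambda=(-1)^{n-1}\,r\,\frac{\partial}{\partial r}\wedge X^H_\Lambda$ on $U$. Put $H^2_\Lambda(U)=\mathfrak X^n(U)/\{\mathcal L_V\Lambda: V\in\mathfrak X(U)\}$. Then $H^2_\Lambda(U)\cong\mathbb R$ as a real vector space, and it is generated by the class of the linearization $(-1)^{n-1}r\frac{\partial}{\partial r}\wedge X^H_\Lambda$. Moreover, let $\Omega^H_\Lambda$ be the $(n-1)$-form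 on $H$ with $\Omega^H_\Lambda(X^H_\Lambda)=1$, write a vector field on $U$ as $V=A\frac{\partial}{\partial r}+V_H$ with $V_H$ tangent to the levels $\{r\}\times H$, and for $c\in\mathbb R$ consider the equation $$E_c:\quad A-r\frac{\partial A}{\partial r}-r\,\mathrm{div}^{\Omega^H_\Lambda}(V_H)=c\,r .$$ Then: (a) $E_1$ has no smooth solution $V$; (b) $\mathcal L_V\Lambda=0$ if and only if $V$ solves $E_0$; (c) the map $V\mapsto V_H$ sends the space $Z^1_\Lambda(U)$ of vector fields with $\mathcal L_V\Lambda=0$ onto the space of smooth fields $V_H$ tangent to the levels with $\mathrm{div}^{\Omega^H_\Lambda}(V_H|_{r=0})=0$, and its kernel is $\{k\,r\frac{\partial}{\partial r}: k\in C^\infty(H)\}$. -/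

import Mathlib

open scoped Manifold ContDiff

noncomputable section

namespace NambuCollar

section General

variable {E : Type*} [NormedAddCommGroup E] [NormedSpace ℝ E]
  {B : Type*} [TopologicalSpace B] (I : ModelWithCorners ℝ E B)
  (M : Type*) [TopologicalSpace M] [ChartedSpace B M]

/-- The differential `d_p f`, as a covector at `p`. -/
abbrev differential {M : Type*} [TopologicalSpace M] [ChartedSpace B M] (f : M → ℝ) (p : M) :
    TangentSpace I p →L[ℝ] ℝ :=
  mfderiv I 𝓘(ℝ, ℝ) f p

/-- The `k`-vectors at `p` (elements of `⋀ᵏ T_p M`, for finite dimensional `M`), as alternating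
`k`-linear functions of covectors at `p`. -/
abbrev MultivectorAt {M : Type*} [TopologicalSpace M] [ChartedSpace B M] (k : ℕ) (p : M) :=
  (TangentSpace I p →L[ℝ] ℝ) [⋀^Fin k]→ₗ[ℝ] ℝ

/-- Exterior multiplication `v ∧ X` of a `k`-vector `X` by a tangent vector `v` on the left:
`(v ∧ X)(α₀, …, αₖ) = ∑ i, (-1)ⁱ αᵢ(v) X(α₀, …, α̂ᵢ, …, αₖ)`. -/
def wedge {V : Type*} [TopologicalSpace V] [AddCommGroup V] [Module ℝ V]
    {k : ℕ} (v : V) (X : (V →L[ℝ] ℝ) [⋀^Fin k]→ₗ[ℝ] ℝ) :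
    (V →L[ℝ] ℝ) [⋀^Fin (k + 1)]→ₗ[ℝ] ℝ :=
  AlternatingMap.alternatizeUncurryFin
    ((ContinuousLinearMap.coeLM ℝ |>.flip v).smulRight X)

/-- Smooth `k`-vector fields: families of `k`-vectors `Λ_p` such that the function
`p ↦ Λ_p(d f₁, …, d f_k)` is smooth for all smooth functions `f₁, …, f_k` on `M`. -/
def MultivectorField (k : ℕ) : Submodule ℝ (Π p : M, MultivectorAt I k p) where
  carrier := {Λ | ∀ f : Fin k → C^∞⟮I, M; ℝ⟯,
    ContMDiff I 𝓘(ℝ, ℝ) ∞ fun p => Λ p fun i => differential I (f i) p}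
  add_mem' hΛ hΘ f := (hΛ f).add (hΘ f)
  zero_mem' _ := contMDiff_const
  smul_mem' c _ hΛ f := by
    have h := ContMDiff.smul (contMDiff_const (I' := 𝓘(ℝ, ℝ)) (c := c)) (hΛ f)
    exact h

instance instAddCommGroupMultivectorField (k : ℕ) : AddCommGroup (MultivectorField I M k) :=
  Submodule.addCommGroup _

/-- Smooth vector fields. -/
abbrev VField [IsManifold I ∞ M] := ContMDiffSection I E ∞ (TangentSpace I : M → Type _)

variable {I M}

/-- The bracket `{f₁, …, f_k} = Λ(d f₁, …, d f_k)` of a `k`-vector field. -/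
def bracket {k : ℕ} (Λ : MultivectorField I M k) (f : Fin k → C^∞⟮I, M; ℝ⟯) : C^∞⟮I, M; ℝ⟯ :=
  ⟨fun p => Λ.1 p fun i => differential I (f i) p, Λ.2 f⟩

/-- The derivative `X f` of a smooth function along a vector field. -/
def act [IsManifold I ∞ M] (X : VField I M) (f : C^∞⟮I, M; ℝ⟯) : C^∞⟮I, M; ℝ⟯ :=
  ⟨fun p => differential I f p (X p), by
    have h1 : ContMDiff I 𝓘(ℝ, ℝ).tangent ∞
        (fun p => tangentMap I 𝓘(ℝ, ℝ) f (⟨p, X p⟩ : TangentBundle I M)) :=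
      (f.contMDiff.contMDiff_tangentMap (m := ∞) (by simp)).comp X.contMDiff
    exact (contMDiff_snd_tangentBundle_modelSpace ℝ 𝓘(ℝ, ℝ)).comp h1⟩

/-- A `k`-vector field is determined by its bracket; this is the linear map that sends the
field to the bracket. -/
def bracketMap (k : ℕ) :
    MultivectorField I M k →ₗ[ℝ] ((Fin k → C^∞⟮I, M; ℝ⟯) → C^∞⟮I, M; ℝ⟯) where
  toFun := bracket
  map_add' _ _ := rfl
  map_smul' _ _ := rfl

lemma differential_update {k : ℕ} (f : Fin k → C^∞⟮I, M; ℝ⟯) (i : Fin k)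
    (g : C^∞⟮I, M; ℝ⟯) (p : M) :
    (fun j => differential I (Function.update f i g j) p) =
      Function.update (fun j => differential I (f j) p) i (differential I g p) := by
  funext j
  rcases eq_or_ne j i with rfl | h <;> simp [*]

lemma act_add [IsManifold I ∞ M] (X Y : VField I M) (f : C^∞⟮I, M; ℝ⟯) :
    act (X + Y) f = act X f + act Y f := by
  ext p
  exact map_add (differential I f p) (X p) (Y p)

lemma act_smul [IsManifold I ∞ M] (c : ℝ) (X : VField I M) (f : C^∞⟮I, M; ℝ⟯) :
    act (c • X) f = c • act X f := by
  ext p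
  exact map_smul (differential I f p) c (X p)

lemma bracket_update_add {k : ℕ} (Λ : MultivectorField I M k) (f : Fin k → C^∞⟮I, M; ℝ⟯)
    (i : Fin k) (g h : C^∞⟮I, M; ℝ⟯) :
    bracket Λ (Function.update f i (g + h)) =
      bracket Λ (Function.update f i g) + bracket Λ (Function.update f i h) := by
  ext p
  have hd : differential I (g + h : C^∞⟮I, M; ℝ⟯) p = differential I g p + differential I h p :=
    mfderiv_add ((g.contMDiff p).mdifferentiableAt (by simp))
      ((h.contMDiff p).mdifferentiableAt (by simp))
  change Λ.1 p _ = Λ.1 p _ + Λ.1 p _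
  rw [differential_update, differential_update, differential_update, hd]
  exact (Λ.1 p).map_update_add _ i _ _

lemma bracket_update_smul {k : ℕ} (Λ : MultivectorField I M k) (f : Fin k → C^∞⟮I, M; ℝ⟯)
    (i : Fin k) (c : ℝ) (g : C^∞⟮I, M; ℝ⟯) :
    bracket Λ (Function.update f i (c • g)) = c • bracket Λ (Function.update f i g) := by
  ext p
  have hd : differential I (c • g : C^∞⟮I, M; ℝ⟯) p = c • differential I g p :=
    const_smul_mfderiv ((g.contMDiff p).mdifferentiableAt (by simp)) c
  change Λ.1 p _ = c • Λ.1 p _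
  rw [differential_update, differential_update, hd]
  exact (Λ.1 p).map_update_smul _ i _ _

/-- The Lie derivative of `Λ`, written through its bracket:
`(L_X Λ)(d f₁, …, d f_k) = X{f₁, …, f_k} - ∑ i, {f₁, …, X fᵢ, …, f_k}`, linearly in `X`. -/
def lieDerivBracket [IsManifold I ∞ M] {k : ℕ} (Λ : MultivectorField I M k) :
    VField I M →ₗ[ℝ] ((Fin k → C^∞⟮I, M; ℝ⟯) → C^∞⟮I, M; ℝ⟯) where
  toFun X f := act X (bracket Λ f) - ∑ i, bracket Λ (Function.update f i (act X (f i)))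
  map_add' X Y := by
    funext f
    simp only [act_add, bracket_update_add, Finset.sum_add_distrib, Pi.add_apply]
    abel
  map_smul' c X := by
    funext f
    simp only [act_smul, bracket_update_smul, Finset.smul_sum, Pi.smul_apply, smul_sub,
      RingHom.id_apply]

/-- `Z¹`: the vector fields `X` with `L_X Λ = 0` (infinitesimal automorphisms of `Λ`). -/
def cocycles1 [IsManifold I ∞ M] {k : ℕ} (Λ : MultivectorField I M k) :
    Submodule ℝ (VField I M) :=
  LinearMap.ker (lieDerivBracket Λ)

/-- `B²`: the `k`-vector fields `Θ` of the form `Θ = L_X Λ` for some vector field `X`. -/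
def coboundaries2 [IsManifold I ∞ M] {k : ℕ} (Λ : MultivectorField I M k) :
    Submodule ℝ (MultivectorField I M k) :=
  (LinearMap.range (lieDerivBracket Λ)).comap (bracketMap k)

/-- `H²_Λ`, for `Λ` of top degree `k = n`: the cohomology at the last place of
`0 → ⋀ⁿ⁻¹ C^∞(M) → 𝔛(M) → 𝔛ⁿ(M) → 0`, whose second map is `X ↦ L_X Λ`. -/
abbrev NambuH2 [IsManifold I ∞ M] {k : ℕ} (Λ : MultivectorField I M k) :=
  (MultivectorField I M k) ⧸ coboundaries2 Λ

/-- The class in `H²_Λ` of a `k`-vector field. -/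
abbrev NambuH2.mk [IsManifold I ∞ M] {k : ℕ} (Λ Θ : MultivectorField I M k) : NambuH2 Λ :=
  (coboundaries2 Λ).mkQ Θ

/-- For `Λ` of top degree: the graph of `Λ` is transverse to the zero section of the line bundle
`⋀ⁿ TM`. At a zero `p` of `Λ` this means that the intrinsic derivative `v ↦ dΛ_p(v)`, with
`dΛ_p(v)(d f₁, …, d f_n) = v{f₁, …, f_n}`, maps onto the line `⋀ⁿ T_p M`, i.e. is nonzero. -/
def IsGeneric {k : ℕ} (Λ : MultivectorField I M k) : Prop :=
  ∀ p, Λ.1 p = 0 → ∃ (f : Fin k → C^∞⟮I, M; ℝ⟯) (v : TangentSpace I p),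
    differential I (bracket Λ f) p v ≠ 0

/-- `Ω` is the form of degree `m = dim M` dual to the `m`-vector field `X`, i.e. `Ω(X) = 1`.
For `X = c e₁ ∧ ⋯ ∧ e_m` one has `X(α) = c det (αᵢ(eⱼ))` and `Ω(X) = c Ω(e₁, …, e_m)`, so that
`Ω(X) = 1` amounts to `Ω(v) X(α) = det (αᵢ(vⱼ))` for all vectors `v` and covectors `α`. -/
def IsDualForm {m : ℕ} (X : MultivectorField I M m)
    (Ω : Π p : M, TangentSpace I p [⋀^Fin m]→ₗ[ℝ] ℝ) : Prop :=
  ∀ (p : M) (v : Fin m → TangentSpace I p) (α : Fin m → (TangentSpace I p →L[ℝ] ℝ)),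
    Ω p v * X.1 p α = Matrix.det (Matrix.of fun i j => α i (v j))

/-- `ψ` is the divergence of the vector field `Y` with respect to the volume form `Ω`:
`L_Y Ω = ψ Ω`, where
`(L_Y Ω)(Z₁, …, Z_m) = Y(Ω(Z₁, …, Z_m)) - ∑ i, Ω(Z₁, …, [Y, Zᵢ], …, Z_m)`. -/
def IsDivergence [IsManifold I ∞ M] {m : ℕ} (Ω : Π p : M, TangentSpace I p [⋀^Fin m]→ₗ[ℝ] ℝ)
    (Y : Π p : M, TangentSpace I p) (ψ : M → ℝ) : Prop :=
  ∀ (Z : Fin m → VField I M) (p : M),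
    differential I (fun q => Ω q fun i => Z i q) p (Y p)
        - ∑ i, Ω p (Function.update (fun j => Z j p) i (VectorField.mlieBracket I Y (Z i) p))
      = ψ p * Ω p fun i => Z i p

end General

section Collar

/-- The Euclidean space of dimension `m`, on which the hypersurface is modelled. -/
abbrev Euc (m : ℕ) := EuclideanSpace ℝ (Fin m)

/-- The open interval `(-1, 1)`, an open submanifold of `ℝ`. -/
abbrev Interval : TopologicalSpace.Opens ℝ := ⟨Set.Ioo (-1) 1, isOpen_Ioo⟩

/-- The point `0` of `(-1, 1)`. -/
def zeroPt : Interval := ⟨0, by norm_num, by norm_num⟩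

/-- The collar `U = (-1, 1) × H`. -/
abbrev Collar (H : Type*) := Interval × H

/-- The model with corners of the hypersurface. -/
abbrev IH (m : ℕ) := 𝓘(ℝ, Euc m)

/-- The model with corners of the collar. -/
abbrev IU (m : ℕ) := (𝓘(ℝ, ℝ)).prod (𝓘(ℝ, Euc m))

variable {m : ℕ} {H : Type*} [TopologicalSpace H] [ChartedSpace (Euc m) H]
  [IsManifold (IH m) ∞ H]

/-- The coordinate vector field `∂/∂r` of the collar. -/
def partialR (p : Collar H) : TangentSpace (IU m) p := ((1 : ℝ), (0 : Euc m))

/-- The coefficient `A` of a vector field `X = A ∂/∂r + X_H` on the collar. -/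
def radial (X : VField (IU m) (Collar H)) (p : Collar H) : ℝ :=
  (show ℝ × Euc m from X p).1

/-- The part `X_H` of a vector field `X = A ∂/∂r + X_H` on the collar, at level `r`: a vector
field on `H`. -/
def horizontal (X : VField (IU m) (Collar H)) (r : Interval) (x : H) : TangentSpace (IH m) x :=
  (show ℝ × Euc m from X (r, x)).2

/-- The derivative at `x` of the inclusion `x ↦ (r, x)` of `H` as a level of the collar. -/
def levelIncl (r : Interval) (x : H) :
    TangentSpace (IH m) x →L[ℝ] TangentSpace (IU m) ((r, x) : Collar H) :=
  ContinuousLinearMap.inr ℝ ℝ (Euc m)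

/-- A multivector at `x ∈ H` as a multivector of the collar at `(r, x)`, tangent to
`{r} × H`. -/
def toCollar {k : ℕ} (r : Interval) (x : H) (X : MultivectorAt (IH m) k x) :
    MultivectorAt (IU m) k ((r, x) : Collar H) :=
  X.compLinearMap
    { toFun := fun α => α.comp (levelIncl r x)
      map_add' := fun _ _ => rfl
      map_smul' := fun _ _ => rfl }

/-- `X` is the modular `(n-1)`-vector field of `Λ` along `H = {0} × H` (with `n = m + 1`):
`Λ` vanishes along `H` and its intrinsic derivative is
`dΛ(v) = X ∧ v = (-1)ⁿ⁻¹ v ∧ X` for every vector `v` at a point of `H`.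
For a volume form `Ω` (any nonzero functional on the line of `n`-vectors at the point), pairing
both sides with `Ω` gives the equality of covectors `i_X Ω = dΛ ⊗ Ω`. -/
def IsModularField (Λ : MultivectorField (IU m) (Collar H) (m + 1))
    (X : MultivectorField (IH m) H m) : Prop :=
  ∀ x : H, Λ.1 (zeroPt, x) = 0 ∧
    ∀ (f : Fin (m + 1) → C^∞⟮IU m, Collar H; ℝ⟯)
      (v : TangentSpace (IU m) ((zeroPt, x) : Collar H)),
      differential (IU m) (bracket Λ f) (zeroPt, x) v =
        (-1) ^ m * wedge v (toCollar zeroPt x (X.1 x))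
          (fun i => differential (IU m) (f i) (zeroPt, x))

/-- The linearization `(-1)ⁿ⁻¹ r ∂/∂r ∧ X` (with `n = m + 1`) on the collar. -/
def linearization (X : MultivectorField (IH m) H m) (p : Collar H) :
    MultivectorAt (IU m) (m + 1) p :=
  ((-1) ^ m * (p.1 : ℝ)) • wedge (partialR p) (toCollar p.1 p.2 (X.1 p.2))

/-- The vector field `X = A ∂/∂r + X_H` solves the equation `E_c`:
`A - r ∂A/∂r - r div(X_H) = c r`, the divergence being taken in `H`, at each level `r`,
with respect to `Ω`. -/
def SolvesE (Ω : Π x : H, TangentSpace (IH m) x [⋀^Fin m]→ₗ[ℝ] ℝ) (c : ℝ)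
    (X : VField (IU m) (Collar H)) : Prop :=
  ∃ ψ : Interval → H → ℝ, (∀ r, IsDivergence Ω (horizontal X r) (ψ r)) ∧
    ∀ (r : Interval) (x : H),
      radial X (r, x) - r * differential (IU m) (radial X) (r, x) (partialR (r, x)) - r * ψ r x
        = c * r

end Collar

end NambuCollar

end

noncomputable section

namespace NambuCollar

/-! ### Derivations and determinants. -/

section LinearAlgebra

/-! Write V = A ∂/∂r + V_H. Since Λ is (-1)^m r ∂/∂r ∧ X, a direct computation gives L_V Λ = (-1)^m
(A - r ∂A/∂r - r div V_H) ∂/∂r ∧ X (`lieDerivBracket_eq_modularCoeff`). Genericity makes X nowhere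
zero (`modularField_ne_zero`), so every n-vector field is (-1)^m g ∂/∂r ∧ X for a unique smooth g.
All the claims thus concern the functions g of the form A - r ∂A/∂r - r div V_H.

Differentiating this expression in r at r = 0 eliminates A and leaves -div(V_H|₀). Conversely, if
∂g/∂r|₀ is a divergence on H, then V_H can be chosen so that g + r div V_H has no term of first
order in r. It is then a + r² L with a a function on H, and A = a - r ∫₀^r L solves the equation.
Hence the only obstruction is the class of ∂g/∂r|₀ in C^∞(H) modulo divergences
(`exists_modularCoeff_eq_iff`).

That quotient is the top de Rham cohomology of H, oriented by X. On a compact connected H the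
integral identifies it with ℝ (`exists_integral_eq_zero_iff`). The integral is glued from chart
integrals by a partition of unity. It kills divergences by integration by parts, and a Poincaré
lemma with supports in a cube shows locally that nothing else is killed. A clopen argument makes
this global.

The field Λ itself has g = r, so ∂g/∂r = 1, whose integral is not zero: its class generates, and E_1
has no solution. The cocycles are the solutions of g = 0. When V_H = 0 the equation becomes A = r
∂A/∂r, which forces A = r k with k a function on H.

Multivectors are handled through their values on differentials of functions. Since n-vectors at a
point form a line, they are compared with each other through the determinants det(Z_j f_i)
(`top_degree_proportional`, `frameDet`). -/

lemma Derivation_prod {A : Type*} [CommRing A] [Algebra ℝ A] (D : Derivation ℝ A A)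
    {ι : Type*} [DecidableEq ι] (s : Finset ι) (f : ι → A) :
    D (∏ i ∈ s, f i) = ∑ i ∈ s, D (f i) * ∏ j ∈ s.erase i, f j := by
  induction s using Finset.induction_on with
  | empty => simp
  | insert a s ha ih =>
    rw [Finset.prod_insert ha, Derivation.leibniz, ih, Finset.sum_insert ha,
      Finset.erase_insert ha, smul_eq_mul, smul_eq_mul, Finset.mul_sum, add_comm,
      mul_comm (D (f a))]
    congr 1
    refine Finset.sum_congr rfl fun i hi => ?_
    have hia : a ≠ i := fun h => ha (h ▸ hi)
    rw [Finset.erase_insert_of_ne hia, Finset.prod_insert (by simp [ha])]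
    ring

/-- For the matrix Z_j f_i a column belongs to one field Z_j. Differentiating by columns is what
brings out the brackets [V, Z_j] in `act_frameDet`. -/
lemma Derivation_det {A : Type*} [CommRing A] [Algebra ℝ A] (D : Derivation ℝ A A)
    {n : ℕ} (M : Matrix (Fin n) (Fin n) A) :
    D M.det = ∑ j, (M.updateCol j fun i => D (M i j)).det := by
  simp only [Matrix.det_apply, map_sum]
  rw [Finset.sum_comm]
  refine Finset.sum_congr rfl fun σ _ => ?_
  have h : ∀ a : A, D (Equiv.Perm.sign σ • a) = Equiv.Perm.sign σ • D a := by
    intro a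
    rcases Int.units_eq_one_or (Equiv.Perm.sign σ) with h | h <;> simp [h]
  rw [h, Derivation_prod, Finset.smul_sum]
  refine Finset.sum_congr rfl fun j _ => ?_
  congr 1
  rw [← Finset.mul_prod_erase _ _ (Finset.mem_univ j)]
  congr 1
  · simp
  · refine Finset.prod_congr rfl fun k hk => ?_
    rw [Matrix.updateCol_ne (Finset.ne_of_mem_erase hk)]

/-- Both sums equal the trace of adj(M) N, expanded by Cramer's rule along columns or along rows.
This trades updates of the fields for updates of the functions. -/
lemma sum_det_updateCol_eq_sum_det_updateRow {A : Type*} [CommRing A] {n : ℕ}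
    (M N : Matrix (Fin n) (Fin n) A) :
    ∑ j, (M.updateCol j fun i => N i j).det = ∑ i, (M.updateRow i (N i)).det := by
  have h1 : ∀ j, (M.updateCol j fun i => N i j).det = ∑ i, M.adjugate j i * N i j := by
    intro j
    rw [← Matrix.cramer_apply, Matrix.cramer_eq_adjugate_mulVec]
    rfl
  have h2 : ∀ i, (M.updateRow i (N i)).det = ∑ j, M.adjugate j i * N i j := by
    intro i
    rw [← Matrix.det_transpose, ← Matrix.updateCol_transpose, ← Matrix.cramer_apply,
      Matrix.cramer_eq_adjugate_mulVec, ← Matrix.adjugate_transpose]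
    rfl
  simp only [h1, h2]
  exact Finset.sum_comm

variable {E : Type*} [AddCommGroup E] [Module ℝ E] [TopologicalSpace E]

/-- The `n`-vector `z₁ ∧ ⋯ ∧ z_n`. -/
def decomposable {n : ℕ} (z : Fin n → E) : (E →L[ℝ] ℝ) [⋀^Fin n]→ₗ[ℝ] ℝ :=
  Matrix.detRowAlternating.compLinearMap
    { toFun := fun α j => α (z j)
      map_add' := fun _ _ => rfl
      map_smul' := fun _ _ => rfl }

lemma decomposable_apply {n : ℕ} (z : Fin n → E) (α : Fin n → (E →L[ℝ] ℝ)) :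
    decomposable z α = Matrix.det (Matrix.of fun i j => α i (z j)) := rfl

end LinearAlgebra

/-! ### Vector fields as derivations, and the Lie derivative in top degree. -/

section General

variable {E : Type*} [NormedAddCommGroup E] [NormedSpace ℝ E]
  {B : Type*} [TopologicalSpace B] {I : ModelWithCorners ℝ E B}
  {M : Type*} [TopologicalSpace M] [ChartedSpace B M] [IsManifold I ∞ M]

lemma act_apply (X : VField I M) (f : C^∞⟮I, M; ℝ⟯) (p : M) :
    act X f p = differential I f p (X p) := rfl

omit [IsManifold I ∞ M] in
lemma bracket_apply {k : ℕ} (Λ : MultivectorField I M k) (f : Fin k → C^∞⟮I, M; ℝ⟯) (p : M) :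
    bracket Λ f p = Λ.1 p fun i => differential I (f i) p := rfl

omit [IsManifold I ∞ M] in
lemma mdifferentiableAt_smooth (f : C^∞⟮I, M; ℝ⟯) (p : M) : MDifferentiableAt I 𝓘(ℝ, ℝ) f p :=
  (f.contMDiff p).mdifferentiableAt (by simp)

omit [IsManifold I ∞ M] in
lemma differential_mul (f g : C^∞⟮I, M; ℝ⟯) (p : M) :
    differential I (f * g : C^∞⟮I, M; ℝ⟯) p =
      f p • differential I g p + g p • differential I f p := by
  have := (mdifferentiableAt_smooth f p).hasMFDerivAt.mul
    (mdifferentiableAt_smooth g p).hasMFDerivAt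
  exact this.mfderiv

omit [IsManifold I ∞ M] in
-- The n-vectors on an n-dimensional space form a line: W and D are both multiples of the
-- determinant in a basis of the dual.
lemma top_degree_proportional [FiniteDimensional ℝ E] {n : ℕ} (hn : Module.finrank ℝ E = n)
    {p : M} (W D : MultivectorAt I n p) (α β : Fin n → (TangentSpace I p →L[ℝ] ℝ)) :
    W α * D β = W β * D α := by
  have hdual : Module.finrank ℝ (E →L[ℝ] ℝ) = n := by
    rw [← (LinearMap.toContinuousLinearMap (𝕜 := ℝ) (E := E) (F' := ℝ)).finrank_eq]
    exact Subspace.dual_finrank_eq.trans hn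
  have e : Module.Basis (Fin n) ℝ (TangentSpace I p →L[ℝ] ℝ) :=
    (Module.finBasisOfFinrankEq ℝ (E →L[ℝ] ℝ) hdual :)
  rw [AlternatingMap.eq_smul_basis_det e W, AlternatingMap.eq_smul_basis_det e D]
  simp only [AlternatingMap.smul_apply, smul_eq_mul]
  ring

/-- A vector field as a derivation of the algebra of smooth functions. -/
def actDerivation (X : VField I M) : Derivation ℝ C^∞⟮I, M; ℝ⟯ C^∞⟮I, M; ℝ⟯ where
  toFun := act X
  map_add' f g := by
    ext p
    have h : differential I (f + g : C^∞⟮I, M; ℝ⟯) p = differential I f p + differential I g p :=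
      mfderiv_add (mdifferentiableAt_smooth f p) (mdifferentiableAt_smooth g p)
    change differential I (f + g : C^∞⟮I, M; ℝ⟯) p (X p) = _
    rw [h]; rfl
  map_smul' c f := by
    ext p
    have h : differential I (c • f : C^∞⟮I, M; ℝ⟯) p = c • differential I f p :=
      const_smul_mfderiv (mdifferentiableAt_smooth f p) c
    change differential I (c • f : C^∞⟮I, M; ℝ⟯) p (X p) = _
    rw [h]; rfl
  map_one_eq_zero' := by
    ext p
    have h : differential I (1 : C^∞⟮I, M; ℝ⟯) p = 0 := mfderiv_const (c := (1 : ℝ))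
    change differential I (1 : C^∞⟮I, M; ℝ⟯) p (X p) = 0
    rw [h]; rfl
  leibniz' f g := by
    ext p
    change differential I (f * g : C^∞⟮I, M; ℝ⟯) p (X p) = _
    rw [differential_mul]; rfl

lemma actDerivation_apply (X : VField I M) (f : C^∞⟮I, M; ℝ⟯) : actDerivation X f = act X f := rfl

lemma contDiffOn_comp_extChartAt_symm (f : C^∞⟮I, M; ℝ⟯) (p : M) :
    ContDiffOn ℝ ∞ (f ∘ (extChartAt I p).symm) (extChartAt I p).target :=
  (f.contMDiff.comp_contMDiffOn (contMDiffOn_extChartAt_symm p)).contDiffOn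

lemma fderiv_comp_extChartAt_symm [I.Boundaryless] (f : C^∞⟮I, M; ℝ⟯) {p : M} {y : E}
    (hy : y ∈ (extChartAt I p).target) :
    fderiv ℝ (f ∘ (extChartAt I p).symm) y =
      (differential I f ((extChartAt I p).symm y)).comp
        (mfderiv 𝓘(ℝ, E) I (extChartAt I p).symm y) := by
  have : IsManifold I 1 M := IsManifold.of_le (n := ∞) (by simp)
  rw [← mfderiv_eq_fderiv]
  have h := mdifferentiableWithinAt_extChartAt_symm (I := I) hy
  rw [I.range_eq_univ, mdifferentiableWithinAt_univ] at h
  exact mfderiv_comp y (mdifferentiableAt_smooth f _) h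

/-- The derivative of the inverse chart is invertible, so pulling W back and pushing it forward
returns W. Iterated derivatives V(W f) can thus be computed in the chart. -/
lemma fderiv_comp_extChartAt_symm_mpullback [I.Boundaryless] (f : C^∞⟮I, M; ℝ⟯) (W : VField I M)
    {p : M} {y : E} (hy : y ∈ (extChartAt I p).target) :
    fderiv ℝ (f ∘ (extChartAt I p).symm) y
        (VectorField.mpullbackWithin 𝓘(ℝ, E) I (extChartAt I p).symm W (Set.range I) y) =
      act W f ((extChartAt I p).symm y) := by
  have : IsManifold I 1 M := IsManifold.of_le (n := ∞) (by simp)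
  have h := isInvertible_mfderivWithin_extChartAt_symm (I := I) hy
  rw [fderiv_comp_extChartAt_symm f hy, VectorField.mpullbackWithin_apply]
  rw [I.range_eq_univ, mfderivWithin_univ] at *
  obtain ⟨e, he⟩ := h
  rw [← he, ContinuousLinearMap.inverse_equiv]
  change differential I f _ (e (e.symm _)) = _
  rw [e.apply_symm_apply]
  rfl

/-- The differential of a function along a Lie bracket is a commutator. -/
lemma differential_mlieBracket [I.Boundaryless] [CompleteSpace E]
    (V W : VField I M) (f : C^∞⟮I, M; ℝ⟯) (p : M) :
    differential I f p (VectorField.mlieBracket I V W p) =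
      act V (act W f) p - act W (act V f) p := by
  have : IsManifold I 1 M := IsManifold.of_le (n := ∞) (by simp)
  have hle : (2 : WithTop ℕ∞) ≤ ∞ := WithTop.coe_le_coe.2 (le_top : (2 : ℕ∞) ≤ ⊤)
  have : IsManifold I 2 M := IsManifold.of_le (n := ∞) hle
  set φ := extChartAt I p with hφ
  set V' : E → E := VectorField.mpullbackWithin 𝓘(ℝ, E) I φ.symm V (Set.range I) with hV'
  set W' : E → E := VectorField.mpullbackWithin 𝓘(ℝ, E) I φ.symm W (Set.range I) with hW'
  have hpt : φ p ∈ φ.target := mem_extChartAt_target p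
  have hinv : φ.symm (φ p) = p := extChartAt_to_inv p
  have htgt : φ.target ∈ nhds (φ p) := extChartAt_target_mem_nhds p
  have hdiff : ∀ Z : VField I M, DifferentiableAt ℝ
      (VectorField.mpullbackWithin 𝓘(ℝ, E) I φ.symm Z (Set.range I) : E → E) (φ p) := by
    intro Z
    have h := MDifferentiableWithinAt.differentiableWithinAt_mpullbackWithin_vectorField
      (I := I) (V := Z) (s := Set.univ) (x := p)
      ((Z.contMDiff p).mdifferentiableAt (by simp)).mdifferentiableWithinAt
    rw [I.range_eq_univ, Set.preimage_univ, Set.inter_univ] at h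
    rw [I.range_eq_univ]
    exact differentiableWithinAt_univ.1 h
  -- The bracket on the manifold is the bracket in the chart, transported by the inverse of the
  -- derivative of the chart at its own base point, which is the identity.
  have hbr : VectorField.mlieBracket I V W p =
      (VectorField.lieBracket ℝ V' W' (φ p) : E) := by
    have e1 : (mfderiv I 𝓘(ℝ, E) φ p : E →L[ℝ] E) = ContinuousLinearMap.id ℝ E :=
      mfderiv_extChartAt_self
    have key : ∀ (A : E →L[ℝ] E) (v : E), A = ContinuousLinearMap.id ℝ E → A.inverse v = v := by
      rintro _ v rfl
      rw [ContinuousLinearMap.inverse_id]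
      rfl
    refine (key (mfderiv I 𝓘(ℝ, E) φ p : E →L[ℝ] E) (VectorField.lieBracketWithin ℝ (E := E) V' W'
      (φ.symm ⁻¹' Set.univ ∩ Set.range I) (φ p)) e1).trans ?_
    rw [Set.preimage_univ, Set.univ_inter, I.range_eq_univ, VectorField.lieBracketWithin_univ]
  have hf : ContDiffAt ℝ ∞ (f ∘ φ.symm) (φ p) :=
    (contDiffOn_comp_extChartAt_symm f p).contDiffAt htgt
  have h0 : differential I f p (VectorField.mlieBracket I V W p) =
      fderiv ℝ (f ∘ φ.symm) (φ p) (VectorField.lieBracket ℝ V' W' (φ p)) := by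
    have e : (differential I f p : E →L[ℝ] ℝ) = fderiv ℝ (f ∘ φ.symm) (φ p) := by
      rw [← fderivWithin_univ, ← I.range_eq_univ]
      exact (mdifferentiableAt_smooth f p).mfderiv
    rw [← e, ← hbr]
    rfl
  have h1 : ∀ Z : VField I M, (fun y => fderiv ℝ (f ∘ φ.symm) y
      (VectorField.mpullbackWithin 𝓘(ℝ, E) I φ.symm Z (Set.range I) y)) =ᶠ[nhds (φ p)]
      (act Z f ∘ φ.symm) := by
    intro Z
    filter_upwards [htgt] with y hy
    exact fderiv_comp_extChartAt_symm_mpullback f Z hy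
  rw [h0, VectorField.fderiv_apply_lieBracket hf (by simpa using hle) (hdiff W) (hdiff V),
    (h1 W).fderiv_eq, (h1 V).fderiv_eq, fderiv_comp_extChartAt_symm_mpullback _ _ hpt,
    fderiv_comp_extChartAt_symm_mpullback _ _ hpt, hinv]

/-- The determinant of the matrix `Zⱼ fᵢ`. -/
def frameDet {n : ℕ} (Z : Fin n → VField I M) (f : Fin n → C^∞⟮I, M; ℝ⟯) : C^∞⟮I, M; ℝ⟯ :=
  (Matrix.of fun i j => act (Z j) (f i)).det

omit [IsManifold I ∞ M] in
lemma coe_det {n : ℕ} (A : Matrix (Fin n) (Fin n) C^∞⟮I, M; ℝ⟯) (p : M) :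
    A.det p = (Matrix.of fun i j => A i j p).det :=
  (ContMDiffMap.evalRingHom p : C^∞⟮I, M; ℝ⟯ →+* ℝ).map_det A

lemma frameDet_apply {n : ℕ} (Z : Fin n → VField I M) (f : Fin n → C^∞⟮I, M; ℝ⟯) (p : M) :
    frameDet Z f p = decomposable (fun j => Z j p) fun i => differential I (f i) p :=
  coe_det _ p

/-- The Lie derivative of the determinant `det (Zⱼ fᵢ)`. -/
lemma act_frameDet [I.Boundaryless] [CompleteSpace E] {n : ℕ} (V : VField I M)
    (Z : Fin n → VField I M) (f : Fin n → C^∞⟮I, M; ℝ⟯) (p : M) :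
    act V (frameDet Z f) p = ∑ i, frameDet Z (Function.update f i (act V (f i))) p +
      ∑ j, decomposable (Function.update (fun j => (Z j p : TangentSpace I p)) j
        (VectorField.mlieBracket I V (Z j) p)) fun i => differential I (f i) p := by
  have h1 : act V (frameDet Z f) p = ∑ j, (Matrix.updateCol
      (Matrix.of fun i j => act (Z j) (f i) p) j fun i => act V (act (Z j) (f i)) p).det := by
    have h := congrArg (ContMDiffMap.evalRingHom p : C^∞⟮I, M; ℝ⟯ →+* ℝ)
      (Derivation_det (actDerivation V) (Matrix.of fun i j => act (Z j) (f i)))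
    rw [map_sum] at h
    refine h.trans (Finset.sum_congr rfl fun j _ => ?_)
    refine (coe_det _ p).trans (congrArg Matrix.det ?_)
    ext i k
    by_cases hk : k = j
    · subst hk; simp [actDerivation_apply]
    · simp [hk]
  -- Commuting V past Z_j leaves the column of the numbers df_i([V, Z_j]).
  have h2 : ∀ j, (Matrix.updateCol (Matrix.of fun i j => act (Z j) (f i) p) j
      fun i => act V (act (Z j) (f i)) p).det =
      (Matrix.updateCol (Matrix.of fun i j => act (Z j) (f i) p) j
        fun i => act (Z j) (act V (f i)) p).det +
      decomposable (Function.update (fun j => (Z j p : TangentSpace I p)) j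
        (VectorField.mlieBracket I V (Z j) p)) fun i => differential I (f i) p := by
    intro j
    have : (fun i => act V (act (Z j) (f i)) p) = (fun i => act (Z j) (act V (f i)) p) +
        fun i => differential I (f i) p (VectorField.mlieBracket I V (Z j) p) := by
      funext i
      simp [differential_mlieBracket]
    rw [this, Matrix.det_updateCol_add, decomposable_apply]
    congr 2
    ext i k
    by_cases hk : k = j
    · subst hk; simp
    · simp [hk, act_apply]
  rw [h1, Finset.sum_congr rfl fun j _ => h2 j, Finset.sum_add_distrib]
  congr 1
  -- The columns Z_j(V f_i) are traded for rows, in which f_i is replaced by V f_i.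
  refine (sum_det_updateCol_eq_sum_det_updateRow (Matrix.of fun i j => act (Z j) (f i) p)
      (Matrix.of fun i j => act (Z j) (act V (f i)) p)).trans ?_
  refine Finset.sum_congr rfl fun i _ => ?_
  rw [frameDet, coe_det]
  congr 1
  ext l k
  by_cases hl : l = i
  · subst hl; simp
  · simp [hl]

lemma bracket_mul_frameDet [FiniteDimensional ℝ E] {n : ℕ} (hn : Module.finrank ℝ E = n)
    (W : MultivectorField I M n) (Z : Fin n → VField I M) (f g : Fin n → C^∞⟮I, M; ℝ⟯) :
    bracket W f * frameDet Z g = bracket W g * frameDet Z f := by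
  ext p
  change bracket W f p * frameDet Z g p = bracket W g p * frameDet Z f p
  rw [frameDet_apply, frameDet_apply]
  exact top_degree_proportional hn (W.1 p) _ _ _

/-- The Lie derivative of a multivector field of top degree is again a multivector of top degree
at each point: its values on different families of functions are proportional. -/
lemma lieDerivBracket_mul_frameDet [I.Boundaryless] [FiniteDimensional ℝ E] {n : ℕ}
    (hn : Module.finrank ℝ E = n) (W : MultivectorField I M n) (V : VField I M)
    (Z : Fin n → VField I M) (f g : Fin n → C^∞⟮I, M; ℝ⟯) (p : M) :
    lieDerivBracket W V f p * frameDet Z g p = lieDerivBracket W V g p * frameDet Z f p := by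
  have : CompleteSpace E := FiniteDimensional.complete ℝ E
  have hval : ∀ f : Fin n → C^∞⟮I, M; ℝ⟯, lieDerivBracket W V f p =
      act V (bracket W f) p - ∑ i, bracket W (Function.update f i (act V (f i))) p := by
    intro f
    change (act V (bracket W f) - ∑ i, bracket W (Function.update f i (act V (f i)))) p = _
    rw [ContMDiffMap.coe_sub, Pi.sub_apply]
    congr 1
    exact map_sum (ContMDiffMap.evalRingHom p : C^∞⟮I, M; ℝ⟯ →+* ℝ) _ _
  have hmul : ∀ f g : Fin n → C^∞⟮I, M; ℝ⟯,
      bracket W f p * frameDet Z g p = bracket W g p * frameDet Z f p := fun f g =>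
    DFunLike.congr_fun (bracket_mul_frameDet hn W Z f g) p
  -- Apply V to the proportionality of W with the determinant. The terms with [V, Z_j] on the two
  -- sides are proportional again and cancel; those with V f_i regroup into the two Lie derivatives.
  have hd := DFunLike.congr_fun (congrArg (actDerivation V) (bracket_mul_frameDet hn W Z f g)) p
  rw [Derivation.leibniz, Derivation.leibniz] at hd
  change bracket W f p * act V (frameDet Z g) p + frameDet Z g p * act V (bracket W f) p =
    bracket W g p * act V (frameDet Z f) p + frameDet Z f p * act V (bracket W g) p at hd
  rw [act_frameDet, act_frameDet, mul_add, mul_add, Finset.mul_sum, Finset.mul_sum,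
    Finset.mul_sum, Finset.mul_sum] at hd
  have h1 : ∀ f g : Fin n → C^∞⟮I, M; ℝ⟯,
      ∑ i, bracket W f p * frameDet Z (Function.update g i (act V (g i))) p =
      (∑ i, bracket W (Function.update g i (act V (g i))) p) * frameDet Z f p := by
    intro f g
    rw [Finset.sum_mul]
    exact Finset.sum_congr rfl fun i _ => hmul _ _
  have h2 : ∑ j, bracket W f p * decomposable (Function.update
        (fun j => (Z j p : TangentSpace I p)) j (VectorField.mlieBracket I V (Z j) p))
        (fun i => differential I (g i) p) =
      ∑ j, bracket W g p * decomposable (Function.update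
        (fun j => (Z j p : TangentSpace I p)) j (VectorField.mlieBracket I V (Z j) p))
        (fun i => differential I (f i) p) :=
    Finset.sum_congr rfl fun j _ =>
      top_degree_proportional hn (W.1 p) _ _ _
  rw [h1, h1, h2] at hd
  rw [hval, hval]
  linarith

end General

/-! ### Computations in a frame dual to the differentials of functions. -/

lemma eq_sum_smul_of_biorthogonal {E : Type*} [NormedAddCommGroup E] [NormedSpace ℝ E]
    [FiniteDimensional ℝ E] {n : ℕ} (hn : Module.finrank ℝ E = n) {v : Fin n → E}
    {α : Fin n → (E →L[ℝ] ℝ)} (h : ∀ i j, α i (v j) = if i = j then 1 else 0) (w : E) :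
    w = ∑ j, α j w • v j := by
  have hval : ∀ (g : Fin n → ℝ) i, α i (∑ j, g j • v j) = g i := fun g i => by simp [h]
  have hli : LinearIndependent ℝ v := by
    rw [Fintype.linearIndependent_iff]
    intro g hg i
    rw [← hval g i, hg, map_zero]
  have hsp := (hli.span_eq_top_of_card_eq_finrank' (by simp [hn])).ge
  obtain ⟨g, rfl⟩ := (Submodule.mem_span_range_iff_exists_fun ℝ).1
    (hsp (Submodule.mem_top (x := w)))
  simp only [hval]

section General

variable {E : Type*} [NormedAddCommGroup E] [NormedSpace ℝ E]
  {B : Type*} [TopologicalSpace B] {I : ModelWithCorners ℝ E B}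
  {M : Type*} [TopologicalSpace M] [ChartedSpace B M] [IsManifold I ∞ M]

omit [IsManifold I ∞ M] in
lemma sum_apply {ι : Type*} (s : Finset ι) (f : ι → C^∞⟮I, M; ℝ⟯) (p : M) :
    (∑ i ∈ s, f i) p = ∑ i ∈ s, f i p :=
  map_sum (ContMDiffMap.evalRingHom p : C^∞⟮I, M; ℝ⟯ →+* ℝ) f s

/-- The product of a vector field with a smooth function. -/
def smulField (f : C^∞⟮I, M; ℝ⟯) (Y : VField I M) : VField I M :=
  ⟨fun p => f p • Y p, f.contMDiff.smul_section Y.contMDiff⟩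

lemma act_smulField (f g : C^∞⟮I, M; ℝ⟯) (Y : VField I M) :
    act (smulField f Y) g = f * act Y g := by
  ext p
  exact map_smul (differential I g p) (f p) (Y p)

lemma lieDerivBracket_apply {k : ℕ} (W : MultivectorField I M k) (V : VField I M)
    (f : Fin k → C^∞⟮I, M; ℝ⟯) (p : M) :
    lieDerivBracket W V f p =
      act V (bracket W f) p - ∑ i, bracket W (Function.update f i (act V (f i))) p := by
  change (act V (bracket W f) - ∑ i, bracket W (Function.update f i (act V (f i)))) p = _
  rw [ContMDiffMap.coe_sub, Pi.sub_apply]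
  rw [sum_apply]

/-- The matrix is the identity with row i replaced, so Cramer's rule reads off the diagonal entry.
-/
lemma frameDet_update {n : ℕ} {Z : Fin n → VField I M} {h : Fin n → C^∞⟮I, M; ℝ⟯} {p : M}
    (hZ : ∀ i j, act (Z j) (h i) p = if i = j then 1 else 0) (i : Fin n) (g : C^∞⟮I, M; ℝ⟯) :
    frameDet Z (Function.update h i g) p = act (Z i) g p := by
  rw [frameDet, coe_det]
  have : (Matrix.of fun a j => Matrix.of (fun a j => act (Z j) (Function.update h i g a)) a j p) =
      (1 : Matrix (Fin n) (Fin n) ℝ).updateRow i (fun j => act (Z j) g p) := by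
    ext a j
    by_cases ha : a = i
    · subst ha; simp
    · simp [ha, hZ, Matrix.one_apply]
  rw [this, ← Matrix.det_transpose, ← Matrix.updateCol_transpose, ← Matrix.cramer_apply,
    Matrix.transpose_one, Matrix.cramer_one]
  rfl

lemma frameDet_eq_one {n : ℕ} {Z : Fin n → VField I M} {h : Fin n → C^∞⟮I, M; ℝ⟯} {p : M}
    (hZ : ∀ i j, act (Z j) (h i) p = if i = j then 1 else 0) : frameDet Z h p = 1 := by
  rw [frameDet, coe_det]
  rw [← Matrix.det_one (n := Fin n)]
  congr 1
  ext a j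
  simp [hZ, Matrix.one_apply]

/-- The Lie derivative of a multivector field of top degree, in terms of a frame. -/
lemma lieDerivBracket_frame [FiniteDimensional ℝ E] {n : ℕ} (hn : Module.finrank ℝ E = n)
    (W : MultivectorField I M n) (V : VField I M)
    {Z : Fin n → VField I M} {h : Fin n → C^∞⟮I, M; ℝ⟯} {p : M}
    (hZ : ∀ i j, act (Z j) (h i) p = if i = j then 1 else 0) :
    lieDerivBracket W V h p =
      act V (bracket W h) p - (∑ i, act (Z i) (act V (h i)) p) * bracket W h p := by
  rw [lieDerivBracket_apply, Finset.sum_mul]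
  congr 1
  refine Finset.sum_congr rfl fun i _ => ?_
  have h1 : bracket W (Function.update h i (act V (h i))) p * frameDet Z h p =
      bracket W h p * frameDet Z (Function.update h i (act V (h i))) p :=
    DFunLike.congr_fun (bracket_mul_frameDet hn W Z (Function.update h i (act V (h i))) h) p
  rw [frameDet_eq_one hZ, frameDet_update hZ] at h1
  linarith

end General

/-! ### Coordinate frames on H, cut off to global objects. -/

section Frames

variable {m : ℕ} {H : Type*} [TopologicalSpace H] [ChartedSpace (Euc m) H]
  [IsManifold (IH m) ∞ H]

/-- Coordinates near a point of `H`, cut off to globally defined functions and vector fields, such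
that the coefficient of `X` in these coordinates has a constant sign. -/
structure ChartFrame (X : MultivectorField (IH m) H m) where
  /-- The centre of the chart. -/
  center : H
  /-- The radius of the coordinate ball. -/
  radius : ℝ
  radius_pos : 0 < radius
  closedBall_subset : Metric.closedBall (extChartAt (IH m) center center) radius ⊆
    (extChartAt (IH m) center).target
  /-- The coordinate functions. -/
  coord : Fin m → C^∞⟮IH m, H; ℝ⟯
  /-- The coordinate vector fields. -/
  field : Fin m → VField (IH m) H
  /-- The sign of the coefficient of `X`. -/
  sgn : ℝ
  sgn_eq : sgn = 1 ∨ sgn = -1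
  coord_symm : ∀ y ∈ Metric.ball (extChartAt (IH m) center center) radius, ∀ i,
    coord i ((extChartAt (IH m) center).symm y) = y i
  act_field_symm : ∀ y ∈ Metric.ball (extChartAt (IH m) center center) radius, ∀ i f,
    act (field i) f ((extChartAt (IH m) center).symm y) =
      fderiv ℝ (f ∘ (extChartAt (IH m) center).symm) y (EuclideanSpace.single i 1)
  sgn_mul_pos : ∀ y ∈ Metric.ball (extChartAt (IH m) center center) radius,
    0 < sgn * bracket X coord ((extChartAt (IH m) center).symm y)

lemma act_field_coord_of_symm {c : H} {S : Set (Euc m)} (hS : IsOpen S)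
    {h : Fin m → C^∞⟮IH m, H; ℝ⟯} {Z : Fin m → VField (IH m) H}
    (hh : ∀ y ∈ S, ∀ i, h i ((extChartAt (IH m) c).symm y) = y i)
    (hZ : ∀ y ∈ S, ∀ i f, act (Z i) f ((extChartAt (IH m) c).symm y) =
      fderiv ℝ (f ∘ (extChartAt (IH m) c).symm) y (EuclideanSpace.single i 1))
    {y : Euc m} (hy : y ∈ S) (i j : Fin m) :
    act (Z j) (h i) ((extChartAt (IH m) c).symm y) = if i = j then 1 else 0 := by
  rw [hZ y hy]
  have h1 : (h i ∘ (extChartAt (IH m) c).symm) =ᶠ[nhds y] (EuclideanSpace.proj i : Euc m →L[ℝ] ℝ) := by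
    filter_upwards [hS.mem_nhds hy] with z hz
    exact hh z hz i
  rw [h1.fderiv_eq, ContinuousLinearMap.fderiv]
  simp

lemma bracket_ne_zero_of_frame {X : MultivectorField (IH m) H m} {x : H} (hX : X.1 x ≠ 0)
    {Z : Fin m → VField (IH m) H} {h : Fin m → C^∞⟮IH m, H; ℝ⟯}
    (hZ : ∀ i j, act (Z j) (h i) x = if i = j then 1 else 0) : bracket X h x ≠ 0 := by
  intro h0
  refine hX (AlternatingMap.ext fun α => ?_)
  have h1 := top_degree_proportional (I := IH m) finrank_euclideanSpace_fin (X.1 x)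
    (decomposable fun j => Z j x) α fun i => differential (IH m) (h i) x
  rw [← frameDet_apply, frameDet_eq_one hZ, mul_one, ← bracket_apply, h0, zero_mul] at h1
  exact h1

/-- Every point of `H` is the centre of an arbitrarily small coordinate ball. -/
lemma exists_chartFrame [T2Space H] {X : MultivectorField (IH m) H m} (hX : ∀ x, X.1 x ≠ 0) (c : H)
    {N : Set H} (hN : N ∈ nhds c) : ∃ F : ChartFrame X, F.center = c ∧
      ∀ y ∈ Metric.ball (extChartAt (IH m) c c) F.radius, (extChartAt (IH m) c).symm y ∈ N := by
  have : IsManifold (IH m) 1 H := IsManifold.of_le (n := ∞) (by simp)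
  -- Multiplication by ρ makes the chart coordinates and fields global and smooth; near c, where ρ =
  -- 1, they are still the true ones.
  obtain ⟨ρ⟩ : Nonempty (SmoothBumpFunction (IH m) c) := inferInstance
  set φ := extChartAt (IH m) c with hφ
  let h : Fin m → C^∞⟮IH m, H; ℝ⟯ := fun i => ⟨fun x => ρ x • (φ x i), by
    refine ρ.contMDiff_smul ?_
    exact ((EuclideanSpace.proj i : Euc m →L[ℝ] ℝ).contMDiff).comp_contMDiffOn
      contMDiffOn_extChartAt⟩
  let b := (EuclideanSpace.basisFun (Fin m) ℝ).toBasis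
  let e := trivializationAt (Euc m) (TangentSpace (IH m) : H → Type _) c
  let Z : Fin m → VField (IH m) H := fun i => ⟨fun x => ρ x • e.localFrame b i x, by
    refine ContMDiffOn.smul_section_of_tsupport ρ.contMDiff.contMDiffOn e.open_baseSet ?_
      (e.contMDiffOn_localFrame_baseSet ∞ b i)
    exact ρ.tsupport_subset_chartAt_source⟩
  have hcont : Filter.Tendsto φ.symm (nhds (φ c)) (nhds c) := by
    have := continuousAt_extChartAt_symm (I := IH m) c
    rw [ContinuousAt, extChartAt_to_inv] at this
    exact this
  have hone : ∀ᶠ y in nhds (φ c), y ∈ φ.target ∧ ρ (φ.symm y) = 1 ∧ φ.symm y ∈ N :=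
    Filter.Eventually.and (extChartAt_target_mem_nhds (I := IH m) c)
      ((hcont.eventually ρ.eventuallyEq_one).and (hcont.eventually hN))
  obtain ⟨ε, hε, hball⟩ := Metric.eventually_nhds_iff_ball.1 hone
  have hh : ∀ y ∈ Metric.ball (φ c) ε, ∀ i, h i (φ.symm y) = y i := by
    intro y hy i
    obtain ⟨h1, h2, -⟩ := hball y hy
    change ρ (φ.symm y) • (φ (φ.symm y) i) = y i
    rw [h2, φ.right_inv h1, one_smul]
  have hZ : ∀ y ∈ Metric.ball (φ c) ε, ∀ i f, act (Z i) f (φ.symm y) =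
      fderiv ℝ (f ∘ φ.symm) y (EuclideanSpace.single i 1) := by
    intro y hy i f
    obtain ⟨h1, h2, -⟩ := hball y hy
    have hsrc : φ.symm y ∈ (chartAt (Euc m) c).source := by
      rw [← extChartAt_source (IH m)]
      exact φ.map_target h1
    rw [fderiv_comp_extChartAt_symm f h1]
    change differential (IH m) f (φ.symm y) (ρ (φ.symm y) • e.localFrame b i (φ.symm y)) =
      differential (IH m) f (φ.symm y) (mfderiv 𝓘(ℝ, Euc m) (IH m) φ.symm y _)
    rw [h2, one_smul]
    congr 1
    have hb : φ.symm y ∈ e.baseSet := hsrc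
    rw [e.localFrame_apply_of_mem_baseSet b hb]
    have h3 := TangentBundle.symmL_trivializationAt (I := IH m) hsrc
    have h4 : e.symmL ℝ (φ.symm y) (b i) =
      mfderivWithin 𝓘(ℝ, Euc m) (IH m) φ.symm (Set.range (IH m)) (φ (φ.symm y)) (b i) :=
      DFunLike.congr_fun h3 (b i)
    have h5 : e.basisAt b hb i = e.symmL ℝ (φ.symm y) (b i) := by
      rw [e.symmL_apply hb, Bundle.Trivialization.basisAt, Module.Basis.map_apply]
      exact e.linearEquivAt_symm_apply _ hb (b i)
    have h6 : ∀ z, z = y → mfderivWithin 𝓘(ℝ, Euc m) (IH m) φ.symm (Set.range (IH m)) z (b i) =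
        (mfderiv 𝓘(ℝ, Euc m) (IH m) φ.symm y (EuclideanSpace.single i 1) : Euc m) := by
      rintro z rfl
      rw [(IH m).range_eq_univ, mfderivWithin_univ]
      simp [b]
    rw [h5, h4]
    exact h6 _ (φ.right_inv h1)
  have hZh := fun {y} (hy : y ∈ Metric.ball (φ c) ε) =>
    act_field_coord_of_symm Metric.isOpen_ball hh hZ hy
  have hcc : bracket X h c ≠ 0 := by
    refine bracket_ne_zero_of_frame (hX c) (Z := Z) fun i j => ?_
    have := hZh (Metric.mem_ball_self hε) i j
    rwa [extChartAt_to_inv] at this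
  obtain ⟨s, hs, hsp⟩ : ∃ s : ℝ, (s = 1 ∨ s = -1) ∧ 0 < s * bracket X h c := by
    rcases hcc.lt_or_gt with h0 | h0
    · exact ⟨-1, Or.inr rfl, by linarith⟩
    · exact ⟨1, Or.inl rfl, by linarith⟩
  have hev : ∀ᶠ y in nhds (φ c), 0 < s * bracket X h (φ.symm y) :=
    hcont.eventually ((continuousAt_const.mul (bracket X h).contMDiff.continuous.continuousAt).eventually
      (lt_mem_nhds hsp))
  obtain ⟨δ, hδ, hball'⟩ := Metric.eventually_nhds_iff_ball.1 hev
  -- Half of the smaller radius keeps even the closed ball inside the open ball on which all the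
  -- conditions hold.
  have hsub : Metric.ball (φ c) (min ε δ / 2) ⊆ Metric.ball (φ c) ε :=
    Metric.ball_subset_ball (by have := min_le_left ε δ; have := lt_min hε hδ; linarith)
  refine ⟨⟨c, min ε δ / 2, half_pos (lt_min hε hδ), fun y hy => (hball y ?_).1, h, Z, s, hs,
    fun y hy => hh y (hsub hy), fun y hy => hZ y (hsub hy), fun y hy => hball' y ?_⟩, rfl,
    fun y hy => (hball y (hsub hy)).2.2⟩
  · refine Metric.closedBall_subset_ball ?_ hy
    have := min_le_left ε δ; have := lt_min hε hδ; linarith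
  · refine Metric.ball_subset_ball ?_ hy
    have := min_le_right ε δ; have := lt_min hε hδ; linarith

namespace ChartFrame

variable {X : MultivectorField (IH m) H m} (F : ChartFrame X)

/-- The coordinate ball in the model space. -/
def ball : Set (Euc m) := Metric.ball (extChartAt (IH m) F.center F.center) F.radius

/-- The coordinate ball in `H`. -/
def domain : Set H := (extChartAt (IH m) F.center).source ∩ extChartAt (IH m) F.center ⁻¹' F.ball

lemma ball_subset_target : F.ball ⊆ (extChartAt (IH m) F.center).target :=
  Metric.ball_subset_closedBall.trans F.closedBall_subset

lemma isOpen_domain : IsOpen F.domain :=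
  isOpen_extChartAt_preimage' F.center Metric.isOpen_ball

lemma center_mem_domain : F.center ∈ F.domain :=
  ⟨mem_extChartAt_source _, Metric.mem_ball_self F.radius_pos⟩

lemma domain_mem_nhds : F.domain ∈ nhds F.center :=
  F.isOpen_domain.mem_nhds F.center_mem_domain

lemma symm_mem_domain {y : Euc m} (hy : y ∈ F.ball) :
    (extChartAt (IH m) F.center).symm y ∈ F.domain := by
  refine ⟨(extChartAt (IH m) F.center).map_target (F.ball_subset_target hy), ?_⟩
  rw [Set.mem_preimage, (extChartAt (IH m) F.center).right_inv (F.ball_subset_target hy)]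
  exact hy

lemma exists_symm_eq {x : H} (hx : x ∈ F.domain) :
    ∃ y ∈ F.ball, (extChartAt (IH m) F.center).symm y = x :=
  ⟨_, hx.2, (extChartAt (IH m) F.center).left_inv hx.1⟩

lemma act_field_coord {x : H} (hx : x ∈ F.domain) (i j : Fin m) :
    act (F.field j) (F.coord i) x = if i = j then 1 else 0 := by
  obtain ⟨y, hy, rfl⟩ := F.exists_symm_eq hx
  exact act_field_coord_of_symm Metric.isOpen_ball F.coord_symm F.act_field_symm hy i j

lemma sgn_mul_bracket_pos {x : H} (hx : x ∈ F.domain) : 0 < F.sgn * bracket X F.coord x := by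
  obtain ⟨y, hy, rfl⟩ := F.exists_symm_eq hx
  exact F.sgn_mul_pos y hy

lemma bracket_ne_zero {x : H} (hx : x ∈ F.domain) : bracket X F.coord x ≠ 0 :=
  fun h => by simpa [h] using F.sgn_mul_bracket_pos hx

lemma vector_expand {x : H} (hx : x ∈ F.domain) (v : TangentSpace (IH m) x) :
    v = ∑ j, differential (IH m) (F.coord j) x v • F.field j x :=
  eq_sum_smul_of_biorthogonal (E := Euc m) finrank_euclideanSpace_fin
    (v := fun j => F.field j x) (α := fun j => differential (IH m) (F.coord j) x)
    (F.act_field_coord hx) v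

end ChartFrame

/-- The divergence of a vector field with respect to the volume form dual to `X`. -/
def divergence (X : MultivectorField (IH m) H m) (Y : VField (IH m) H) (x : H) : ℝ :=
  open Classical in
  -- Every admissible choice of f gives the same quotient (`lieDerivBracket_eq_divergence`), and the
  -- default 0 is never reached when X has no zeros.
  if h : ∃ f : Fin m → C^∞⟮IH m, H; ℝ⟯, bracket X f x ≠ 0 then
    - lieDerivBracket X Y h.choose x / bracket X h.choose x
  else 0

/-! ### The divergence attached to a nowhere vanishing X, and the dual volume form. -/

section Divergence

variable [T2Space H] {X : MultivectorField (IH m) H m}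

/-- L_Y X is again of top degree at each point, hence a multiple of X. A coordinate frame compares
the functions chosen in the definition with arbitrary ones. -/
lemma lieDerivBracket_eq_divergence (hX : ∀ x, X.1 x ≠ 0) (Y : VField (IH m) H)
    (f : Fin m → C^∞⟮IH m, H; ℝ⟯) (x : H) :
    lieDerivBracket X Y f x = - divergence X Y x * bracket X f x := by
  obtain ⟨F, rfl, -⟩ := exists_chartFrame hX x Filter.univ_mem
  have hc := F.center_mem_domain
  have hex : ∃ f : Fin m → C^∞⟮IH m, H; ℝ⟯, bracket X f F.center ≠ 0 :=
    ⟨F.coord, F.bracket_ne_zero hc⟩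
  rw [divergence, dif_pos hex]
  have h0 := hex.choose_spec
  set h := hex.choose
  have hn : Module.finrank ℝ (Euc m) = m := finrank_euclideanSpace_fin
  have e1 := frameDet_eq_one (F.act_field_coord hc)
  have a1 : bracket X f F.center = bracket X F.coord F.center * frameDet F.field f F.center := by
    have : bracket X f F.center * frameDet F.field F.coord F.center = _ :=
      DFunLike.congr_fun (bracket_mul_frameDet hn X F.field f F.coord) F.center
    rwa [e1, mul_one] at this
  have a2 : bracket X h F.center = bracket X F.coord F.center * frameDet F.field h F.center := by
    have : bracket X h F.center * frameDet F.field F.coord F.center = _ :=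
      DFunLike.congr_fun (bracket_mul_frameDet hn X F.field h F.coord) F.center
    rwa [e1, mul_one] at this
  have a3 := lieDerivBracket_mul_frameDet hn X Y F.field f F.coord F.center
  have a4 := lieDerivBracket_mul_frameDet hn X Y F.field h F.coord F.center
  rw [e1, mul_one] at a3 a4
  rw [a2] at h0
  rw [a1, a2, a3, a4]
  have b1 := left_ne_zero_of_mul h0
  have b2 := right_ne_zero_of_mul h0
  field_simp

/-- The classical formula: for X = b ∂₁ ∧ ⋯ ∧ ∂_m the dual density is b⁻¹ dy, and div Y = b ∑
∂ᵢ(Yⁱ/b) = ∑ ∂ᵢYⁱ - Y(b)/b. -/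
lemma divergence_frame (hX : ∀ x, X.1 x ≠ 0) (F : ChartFrame X) (Y : VField (IH m) H) {x : H}
    (hx : x ∈ F.domain) : divergence X Y x = (∑ i, act (F.field i) (act Y (F.coord i)) x) -
      act Y (bracket X F.coord) x / bracket X F.coord x := by
  have h1 := lieDerivBracket_eq_divergence hX Y F.coord x
  rw [lieDerivBracket_frame finrank_euclideanSpace_fin X Y (F.act_field_coord hx)] at h1
  have h2 := F.bracket_ne_zero hx
  field_simp
  linarith

/-- The divergence, as a smooth function. -/
def smoothDivergence (hX : ∀ x, X.1 x ≠ 0) (Y : VField (IH m) H) : C^∞⟮IH m, H; ℝ⟯ :=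
  ⟨divergence X Y, fun x => by
    obtain ⟨F, rfl, -⟩ := exists_chartFrame hX x Filter.univ_mem
    have h : divergence X Y =ᶠ[nhds F.center] fun x =>
        (∑ i, act (F.field i) (act Y (F.coord i)) : C^∞⟮IH m, H; ℝ⟯) x -
        act Y (bracket X F.coord) x / bracket X F.coord x := by
      filter_upwards [F.domain_mem_nhds] with x hx
      rw [divergence_frame hX F Y hx]
      rw [sum_apply]
    refine ContMDiffAt.congr_of_eventuallyEq ?_ h
    refine ContMDiffAt.sub (ContMDiffMap.contMDiff _ _) ?_
    exact ContMDiffAt.div₀ (ContMDiffMap.contMDiff _ _) (ContMDiffMap.contMDiff _ _)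
      (F.bracket_ne_zero F.center_mem_domain)⟩

/-- The divergence with respect to the dual volume form is the divergence defined by
`L_Y X = - div(Y) X`. -/
lemma isDivergence_iff {Ω : Π x : H, TangentSpace (IH m) x [⋀^Fin m]→ₗ[ℝ] ℝ} (hΩ : IsDualForm X Ω)
    (hX : ∀ x, X.1 x ≠ 0) (Y : VField (IH m) H) (ψ : H → ℝ) :
    IsDivergence Ω Y ψ ↔ ∀ x, ψ x = divergence X Y x := by
  -- Differentiating this pairing along Y relates L_Y Ω to L_Y X; the brackets [Y, Z_j] enter
  -- through `act_frameDet`.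
  have hval : ∀ (Z : Fin m → VField (IH m) H) (f : Fin m → C^∞⟮IH m, H; ℝ⟯) (x : H),
      (Ω x fun i => Z i x) * bracket X f x = frameDet Z f x := fun Z f x => by
    rw [frameDet_apply]
    exact hΩ x _ _
  have hdiv : ∀ (Z : Fin m → VField (IH m) H) (p : H),
      differential (IH m) (fun q => Ω q fun i => Z i q) p (Y p)
        - ∑ i, Ω p (Function.update (fun j => Z j p) i
          (VectorField.mlieBracket (IH m) Y (Z i) p))
      = divergence X Y p * Ω p fun i => Z i p := by
    intro Z p
    obtain ⟨F, rfl, -⟩ := exists_chartFrame hX p Filter.univ_mem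
    have hc := F.center_mem_domain
    have hb := F.bracket_ne_zero hc
    -- Ω is not assumed smooth. Its smoothness on smooth fields follows from duality, as a quotient
    -- of smooth functions.
    have hsm : ContMDiffAt (IH m) 𝓘(ℝ, ℝ) ∞ (fun q => Ω q fun i => Z i q) F.center := by
      have h : (fun q => Ω q fun i => Z i q) =ᶠ[nhds F.center]
          fun q => frameDet Z F.coord q / bracket X F.coord q := by
        filter_upwards [F.domain_mem_nhds] with x hx
        rw [← hval Z F.coord x, mul_div_assoc, div_self (F.bracket_ne_zero hx), mul_one]
      refine ContMDiffAt.congr_of_eventuallyEq ?_ h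
      exact ContMDiffAt.div₀ (ContMDiffMap.contMDiff _ _) (ContMDiffMap.contMDiff _ _) hb
    have hmul := ((hsm.mdifferentiableAt (by simp)).hasMFDerivAt.mul
      (mdifferentiableAt_smooth (bracket X F.coord) F.center).hasMFDerivAt).mfderiv
    have hprod : ((fun q => Ω q fun i => Z i q) * bracket X F.coord : H → ℝ) =
        frameDet Z F.coord := funext fun x => hval Z F.coord x
    have hE := DFunLike.congr_fun hmul (Y F.center)
    have hE' : act Y (frameDet Z F.coord) F.center =
        (Ω F.center fun i => Z i F.center) * act Y (bracket X F.coord) F.center +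
        bracket X F.coord F.center *
          differential (IH m) (fun q => Ω q fun i => Z i q) F.center (Y F.center) := by
      rw [hprod] at hE
      exact hE
    rw [act_frameDet] at hE'
    have h1 : ∀ i, frameDet Z (Function.update F.coord i (act Y (F.coord i))) F.center =
        (Ω F.center fun i => Z i F.center) *
          bracket X (Function.update F.coord i (act Y (F.coord i))) F.center :=
      fun i => (hval _ _ _).symm
    have h2 : ∀ j, decomposable (Function.update
          (fun j => (Z j F.center : TangentSpace (IH m) F.center)) j
          (VectorField.mlieBracket (IH m) Y (Z j) F.center))
          (fun i => differential (IH m) (F.coord i) F.center) =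
        Ω F.center (Function.update (fun j => Z j F.center) j
          (VectorField.mlieBracket (IH m) Y (Z j) F.center)) * bracket X F.coord F.center :=
      fun j => (hΩ F.center _ _).symm
    simp only [h1, h2] at hE'
    rw [← Finset.mul_sum, ← Finset.sum_mul] at hE'
    have h3 := lieDerivBracket_eq_divergence hX Y F.coord F.center
    rw [lieDerivBracket_apply] at h3
    refine mul_right_cancel₀ hb ?_
    linear_combination (-1) * hE' - (Ω F.center fun i => Z i F.center) * h3
  constructor
  · intro h x
    obtain ⟨F, rfl, -⟩ := exists_chartFrame hX x Filter.univ_mem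
    have h1 := (h F.field F.center).symm.trans (hdiv F.field F.center)
    have h2 := hval F.field F.coord F.center
    rw [frameDet_eq_one (F.act_field_coord F.center_mem_domain)] at h2
    exact mul_right_cancel₀ (left_ne_zero_of_mul_eq_one h2) h1
  · intro h Z p
    rw [hdiv, h]

end Divergence

end Frames

/-! ### Smooth dependence of integrals on parameters. -/

section ParametricIntegral

open MeasureTheory Set

/-- Differentiation under the integral sign; the dominating constant is a bound for the derivative
on the compact product of a small closed ball with [0, 1]. -/
lemma hasFDerivAt_integral_param {E F : Type} [NormedAddCommGroup E] [NormedSpace ℝ E]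
    [FiniteDimensional ℝ E] [NormedAddCommGroup F] [NormedSpace ℝ F]
    {f : E × ℝ → F} {s : Set E} {t : Set ℝ} (hs : IsOpen s) (ht : IsOpen t)
    (h01 : Icc 0 1 ⊆ t) (hf : ContDiffOn ℝ 1 f (s ×ˢ t)) {y : E} (hy : y ∈ s) :
    HasFDerivAt (fun y => ∫ r in (0 : ℝ)..1, f (y, r))
      (∫ r in (0 : ℝ)..1, (fderiv ℝ f (y, r)).comp (ContinuousLinearMap.inl ℝ E ℝ)) y := by
  have hst : IsOpen (s ×ˢ t) := hs.prod ht
  have hcont : ContinuousOn (fun p => (fderiv ℝ f p).comp (ContinuousLinearMap.inl ℝ E ℝ))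
      (s ×ˢ t) :=
    (hf.continuousOn_fderiv_of_isOpen hst le_rfl).clm_comp continuousOn_const
  obtain ⟨ε, hε, hball⟩ := Metric.nhds_basis_closedBall.mem_iff.1 (hs.mem_nhds hy)
  have hproper : ProperSpace E := FiniteDimensional.proper ℝ E
  have hK : IsCompact (Metric.closedBall y ε ×ˢ Icc (0 : ℝ) 1) :=
    (isCompact_closedBall y ε).prod isCompact_Icc
  obtain ⟨C, hC⟩ := hK.exists_bound_of_continuousOn
    (hcont.mono (prod_mono hball h01))
  have hI : uIoc (0 : ℝ) 1 ⊆ Icc 0 1 := by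
    rw [uIoc_of_le zero_le_one]
    exact Ioc_subset_Icc_self
  have hslice : ∀ {G : Type} [NormedAddCommGroup G] {g : E × ℝ → G},
      ContinuousOn g (s ×ˢ t) → ∀ z ∈ s, ContinuousOn (fun r => g (z, r)) (Icc 0 1) := by
    intro G _ g hg z hz
    exact hg.comp (by fun_prop) fun r hr => ⟨hz, h01 hr⟩
  refine intervalIntegral.hasFDerivAt_integral_of_dominated_of_fderiv_le
    (F := fun y r => f (y, r))
    (F' := fun y r => (fderiv ℝ f (y, r)).comp (ContinuousLinearMap.inl ℝ E ℝ))
    (bound := fun _ => C) (Metric.closedBall_mem_nhds y hε) ?_ ?_ ?_ ?_ ?_ ?_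
  · filter_upwards [hs.mem_nhds hy] with z hz
    exact ((hslice hf.continuousOn z hz).mono hI).aestronglyMeasurable measurableSet_uIoc
  · refine ContinuousOn.intervalIntegrable ?_
    rw [uIcc_of_le zero_le_one]
    exact hslice hf.continuousOn y hy
  · exact ((hslice hcont y hy).mono hI).aestronglyMeasurable measurableSet_uIoc
  · exact Filter.Eventually.of_forall fun r hr z hz => hC (z, r) ⟨hz, hI hr⟩
  · exact intervalIntegrable_const
  · refine Filter.Eventually.of_forall fun r hr z hz => ?_
    have h1 : HasFDerivAt f (fderiv ℝ f (z, r)) (z, r) :=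
      ((hf.contDiffAt (hst.mem_nhds ⟨hball hz, h01 (hI hr)⟩)).differentiableAt
        (by simp)).hasFDerivAt
    exact h1.comp z (hasFDerivAt_prodMk_left z r)

/-- Induction on the order. The target space must vary in the induction, since the derivative takes
values in E →L[ℝ] F. -/
lemma contDiffOn_integral_param_nat {E : Type} [NormedAddCommGroup E] [NormedSpace ℝ E]
    [FiniteDimensional ℝ E] {s : Set E} {t : Set ℝ} (hs : IsOpen s) (ht : IsOpen t)
    (h01 : Icc 0 1 ⊆ t) (n : ℕ) : ∀ {F : Type} [NormedAddCommGroup F] [NormedSpace ℝ F]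
    {f : E × ℝ → F}, ContDiffOn ℝ ∞ f (s ×ˢ t) →
    ContDiffOn ℝ n (fun y => ∫ r in (0 : ℝ)..1, f (y, r)) s := by
  induction n with
  | zero =>
    intro F _ _ f hf
    refine contDiffOn_zero.2 fun y hy => ?_
    exact (hasFDerivAt_integral_param hs ht h01 (hf.of_le (by simp)) hy).continuousAt.continuousWithinAt
  | succ n ih =>
    intro F _ _ f hf
    have hder := fun y (hy : y ∈ s) =>
      hasFDerivAt_integral_param hs ht h01 (hf.of_le (by simp)) hy
    rw [Nat.cast_add, Nat.cast_one, contDiffOn_succ_iff_fderiv_of_isOpen hs]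
    refine ⟨fun y hy => (hder y hy).differentiableAt.differentiableWithinAt, by simp, ?_⟩
    have h1 : ContDiffOn ℝ ∞ (fun p => (fderiv ℝ f p).comp (ContinuousLinearMap.inl ℝ E ℝ))
        (s ×ˢ t) :=
      (hf.fderiv_of_isOpen (hs.prod ht) (by simp)).clm_comp contDiffOn_const
    exact (ih h1).congr fun y hy => (hder y hy).fderiv

/-- An integral depending smoothly on a parameter is a smooth function of the parameter. -/
lemma contDiffOn_integral_param {E F : Type} [NormedAddCommGroup E] [NormedSpace ℝ E]
    [FiniteDimensional ℝ E] [NormedAddCommGroup F] [NormedSpace ℝ F]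
    {f : E × ℝ → F} {s : Set E} {t : Set ℝ} (hs : IsOpen s) (ht : IsOpen t)
    (h01 : Icc 0 1 ⊆ t) (hf : ContDiffOn ℝ ∞ f (s ×ˢ t)) :
    ContDiffOn ℝ ∞ (fun y => ∫ r in (0 : ℝ)..1, f (y, r)) s :=
  contDiffOn_infty.2 fun n => contDiffOn_integral_param_nat hs ht h01 n hf

end ParametricIntegral

/-! ### The Poincaré lemma in top degree with supports in a cube. -/

section Poincare

open MeasureTheory Set

variable {m : ℕ}

/-- The coordinate vectors of the Euclidean space. -/
abbrev coordVec (i : Fin m) : Euc m := EuclideanSpace.single i 1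

/-- The antiderivative of `g` in the `i`-th variable which vanishes for `yᵢ = a`. -/
def antideriv (a : ℝ) (i : Fin m) (g : Euc m → ℝ) (y : Euc m) : ℝ :=
  ∫ t in a..(y i), g (y + (t - y i) • coordVec i)

/-- The substitution t = (yᵢ - a) r + a makes the limits of integration constant, so that
`contDiffOn_integral_param` applies. -/
lemma contDiff_antideriv (a : ℝ) (i : Fin m) {g : Euc m → ℝ} (hg : ContDiff ℝ ∞ g) :
    ContDiff ℝ ∞ (antideriv a i g) := by
  have h1 : antideriv a i g = fun y => (y i - a) *
      ∫ r in (0 : ℝ)..1, g (y + ((y i - a) * r + a - y i) • coordVec i) := by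
    funext y
    have := intervalIntegral.smul_integral_comp_mul_add (a := 0) (b := 1)
      (fun t => g (y + (t - y i) • coordVec i)) (y i - a) a
    rw [smul_eq_mul] at this
    rw [this, antideriv]
    simp
  rw [h1]
  have hc : ContDiff ℝ ∞ fun y : Euc m => y i :=
    (EuclideanSpace.proj i : Euc m →L[ℝ] ℝ).contDiff
  refine (hc.sub contDiff_const).mul ?_
  rw [← contDiffOn_univ]
  refine contDiffOn_integral_param (f := fun p : Euc m × ℝ =>
    g (p.1 + ((p.1 i - a) * p.2 + a - p.1 i) • coordVec i)) isOpen_univ isOpen_univ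
    (subset_univ _) (ContDiff.contDiffOn ?_)
  have hc' : ContDiff ℝ ∞ fun p : Euc m × ℝ => p.1 i := hc.comp contDiff_fst
  exact hg.comp (contDiff_fst.add
    (((((hc'.sub contDiff_const).mul contDiff_snd).add contDiff_const).sub hc').smul
      contDiff_const))

lemma antideriv_add_smul (a : ℝ) (i : Fin m) (g : Euc m → ℝ) (y : Euc m) (s : ℝ) :
    antideriv a i g (y + s • coordVec i) =
      ∫ t in a..(y i + s), g (y + (t - y i) • coordVec i) := by
  rw [antideriv]
  have h1 : (y + s • coordVec i) i = y i + s := by simp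
  rw [h1]
  refine intervalIntegral.integral_congr fun t _ => ?_
  simp only
  congr 1
  module

lemma fderiv_antideriv (a : ℝ) (i : Fin m) {g : Euc m → ℝ} (hg : ContDiff ℝ ∞ g) (y : Euc m) :
    fderiv ℝ (antideriv a i g) y (coordVec i) = g y := by
  have hd : DifferentiableAt ℝ (antideriv a i g) y :=
    (contDiff_antideriv a i hg).contDiffAt.differentiableAt (by simp)
  rw [← hd.lineDeriv_eq_fderiv, lineDeriv]
  simp only [antideriv_add_smul]
  have hc : Continuous fun t : ℝ => g (y + (t - y i) • coordVec i) :=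
    hg.continuous.comp (by fun_prop)
  have h1 := (hc.integral_hasStrictDerivAt a (y i)).hasDerivAt
  have h2 : HasDerivAt (fun s : ℝ => y i + s) 1 0 := (hasDerivAt_id (0:ℝ)).const_add _
  have h3 := HasDerivAt.comp (h₂ := fun u => ∫ t in a..u, g (y + (t - y i) • coordVec i)) (0 : ℝ)
    (by rw [add_zero]; exact h1) h2
  rw [mul_one, sub_self, zero_smul, add_zero] at h3
  exact h3.deriv

/-- Smooth functions supported in the cube of centre `a` and radius `δ`. -/
structure CubeSmooth (a : Euc m) (δ : ℝ) (f : Euc m → ℝ) : Prop where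
  contDiff : ContDiff ℝ ∞ f
  eq_zero : ∀ y i, δ ≤ |y i - a i| → f y = 0

/-- The derivatives `∂ᵢ u` of smooth functions `u` supported in a cube, and their sums. -/
def cubeDerivatives (a : Euc m) (δ : ℝ) : Submodule ℝ (Euc m → ℝ) :=
  Submodule.span ℝ {g | ∃ u i, CubeSmooth a δ u ∧ g = fun y => fderiv ℝ u y (coordVec i)}

/-- A bump function of integral one in one variable. -/
def lineBump (a : ℝ) {δ : ℝ} (hδ : 0 < δ) (t : ℝ) : ℝ :=
  ContDiffBump.normed (c := a) ⟨δ / 2, δ, half_pos hδ, half_lt_self hδ⟩ volume t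

variable {a : Euc m} {δ : ℝ}

lemma contDiff_lineBump (a : ℝ) {δ : ℝ} (hδ : 0 < δ) : ContDiff ℝ ∞ (lineBump a hδ) :=
  ContDiffBump.contDiff_normed _

lemma lineBump_eq_zero (a : ℝ) {δ : ℝ} (hδ : 0 < δ) {t : ℝ} (ht : δ ≤ |t - a|) :
    lineBump a hδ t = 0 := by
  have h := ContDiffBump.support_normed_eq (c := a)
    ⟨δ / 2, δ, half_pos hδ, half_lt_self hδ⟩ (μ := (volume : Measure ℝ))
  by_contra hne
  have : t ∈ Metric.ball a δ := h ▸ (Function.mem_support.2 hne)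
  rw [Metric.mem_ball, Real.dist_eq] at this
  linarith

lemma integral_lineBump (a : ℝ) {δ : ℝ} (hδ : 0 < δ) :
    ∫ t in (a - δ)..(a + δ), lineBump a hδ t = 1 := by
  have h := ContDiffBump.integral_normed (c := a)
    ⟨δ / 2, δ, half_pos hδ, half_lt_self hδ⟩ (μ := (volume : Measure ℝ))
  rw [← h]
  refine intervalIntegral.integral_eq_integral_of_support_subset ?_
  refine (ContDiffBump.support_normed_eq (c := a)
    ⟨δ / 2, δ, half_pos hδ, half_lt_self hδ⟩ (μ := (volume : Measure ℝ))).trans_subset ?_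
  rw [Real.ball_eq_Ioo]
  exact Ioo_subset_Ioc_self

/-- The integral of `f` over a side of the cube, in the `i`-th variable. -/
def sideIntegral (a : Euc m) (δ : ℝ) (i : Fin m) (f : Euc m → ℝ) (y : Euc m) : ℝ :=
  ∫ t in (a i - δ)..(a i + δ), f (y + (t - y i) • coordVec i)

lemma sideIntegral_eq_antideriv (i : Fin m) (f : Euc m → ℝ) (y : Euc m) :
    sideIntegral a δ i f y = antideriv (a i - δ) i f (y + (a i + δ - y i) • coordVec i) := by
  rw [antideriv_add_smul, add_sub_cancel, sideIntegral]

lemma contDiff_sideIntegral (i : Fin m) {f : Euc m → ℝ} (hf : ContDiff ℝ ∞ f) :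
    ContDiff ℝ ∞ (sideIntegral a δ i f) := by
  have h : sideIntegral a δ i f =
      fun y => antideriv (a i - δ) i f (y + (a i + δ - y i) • coordVec i) :=
    funext fun y => sideIntegral_eq_antideriv i f y
  rw [h]
  have hc : ContDiff ℝ ∞ fun y : Euc m => y i :=
    (EuclideanSpace.proj i : Euc m →L[ℝ] ℝ).contDiff
  exact (contDiff_antideriv _ i hf).comp
    (contDiff_id.add ((contDiff_const.sub hc).smul contDiff_const))

lemma sideIntegral_add_smul (i : Fin m) (f : Euc m → ℝ) (y : Euc m) (s : ℝ) :
    sideIntegral a δ i f (y + s • coordVec i) = sideIntegral a δ i f y := by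
  rw [sideIntegral, sideIntegral]
  refine intervalIntegral.integral_congr fun t _ => ?_
  have h1 : (y + s • coordVec i) i = y i + s := by simp
  simp only [h1]
  congr 1
  module

lemma add_smul_coordVec_apply_ne {i j : Fin m} (hij : j ≠ i) (y : Euc m) (s : ℝ) :
    (y + s • coordVec i) j = y j := by
  simp [hij]

lemma sideIntegral_eq_zero {i j : Fin m} (hij : j ≠ i) {f : Euc m → ℝ}
    (hf : ∀ y, δ ≤ |y j - a j| → f y = 0) {y : Euc m} (hy : δ ≤ |y j - a j|) :
    sideIntegral a δ i f y = 0 := by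
  rw [sideIntegral, ← intervalIntegral.integral_zero (a := a i - δ) (b := a i + δ)]
  refine intervalIntegral.integral_congr fun t _ => ?_
  refine hf _ ?_
  rwa [add_smul_coordVec_apply_ne hij]

/-- Before the near face and outside the cube in the other variables the integrand vanishes. Past
the far face the primitive equals the integral over a whole side, which is zero by assumption. -/
lemma CubeSmooth.antideriv {i : Fin m} {f : Euc m → ℝ} (hf : CubeSmooth a δ f)
    (h0 : ∀ y, sideIntegral a δ i f y = 0) :
    CubeSmooth a δ (antideriv (a i - δ) i f) where
  contDiff := contDiff_antideriv _ i hf.contDiff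
  eq_zero y j hy := by
    have hc : Continuous fun t : ℝ => f (y + (t - y i) • coordVec i) :=
      hf.contDiff.continuous.comp (by fun_prop)
    have hii : ∀ t, (y + (t - y i) • coordVec i) i = t := fun t => by simp
    have hout : ∀ b c : ℝ, (∀ t ∈ uIcc b c, δ ≤ |t - a i|) →
        ∫ t in b..c, f (y + (t - y i) • coordVec i) = 0 := by
      intro b c hbc
      rw [← intervalIntegral.integral_zero (a := b) (b := c)]
      refine intervalIntegral.integral_congr fun t ht => ?_
      exact hf.eq_zero _ i (by rw [hii]; exact hbc t ht)
    rcases eq_or_ne j i with rfl | hij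
    · rw [NambuCollar.antideriv]
      rcases le_abs.1 hy with h | h
      · have h1 := h0 y
        rw [sideIntegral] at h1
        rw [← intervalIntegral.integral_add_adjacent_intervals
          (hc.intervalIntegrable _ (a j + δ)) (hc.intervalIntegrable _ _), h1, zero_add]
        refine hout _ _ fun t ht => ?_
        rw [uIcc_of_le (by linarith)] at ht
        exact le_abs.2 (Or.inl (by linarith [ht.1]))
      · refine hout _ _ fun t ht => ?_
        rw [uIcc_of_ge (by linarith)] at ht
        exact le_abs.2 (Or.inr (by linarith [ht.2]))
    · rw [NambuCollar.antideriv, ← intervalIntegral.integral_zero (a := a i - δ) (b := y i)]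
      refine intervalIntegral.integral_congr fun t _ => ?_
      exact hf.eq_zero _ j (by rwa [add_smul_coordVec_apply_ne hij])

/-- Subtracting the side integral, spread out by a bump of integral one, makes all side integrals
vanish; the primitive in direction i then stays supported in the cube. -/
lemma sub_lineBump_mul_sideIntegral_mem (hδ : 0 < δ) (i : Fin m) {f : Euc m → ℝ}
    (hf : CubeSmooth a δ f) :
    (f - fun y => lineBump (a i) hδ (y i) * sideIntegral a δ i f y) ∈ cubeDerivatives a δ := by
  have hc : ContDiff ℝ ∞ fun y : Euc m => y i :=
    (EuclideanSpace.proj i : Euc m →L[ℝ] ℝ).contDiff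
  set g : Euc m → ℝ := f - fun y => lineBump (a i) hδ (y i) * sideIntegral a δ i f y with hg
  have hgs : CubeSmooth a δ g := by
    refine ⟨hf.contDiff.sub (((contDiff_lineBump (a i) hδ).comp hc).mul
      (contDiff_sideIntegral i hf.contDiff)), fun y j hy => ?_⟩
    rw [hg, Pi.sub_apply, hf.eq_zero y j hy, zero_sub, neg_eq_zero]
    rcases eq_or_ne j i with rfl | hij
    · rw [lineBump_eq_zero _ hδ hy, zero_mul]
    · rw [sideIntegral_eq_zero hij (fun z hz => hf.eq_zero z j hz) hy, mul_zero]
  have h0 : ∀ y, sideIntegral a δ i g y = 0 := by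
    intro y
    have hcf : Continuous fun t : ℝ => f (y + (t - y i) • coordVec i) :=
      hf.contDiff.continuous.comp (by fun_prop)
    have h1 : sideIntegral a δ i g y = ∫ t in (a i - δ)..(a i + δ),
        (f (y + (t - y i) • coordVec i) - lineBump (a i) hδ t * sideIntegral a δ i f y) := by
      rw [sideIntegral]
      refine intervalIntegral.integral_congr fun t _ => ?_
      simp only [hg, Pi.sub_apply, sideIntegral_add_smul]
      simp
    have hcl : Continuous fun t : ℝ => lineBump (a i) hδ t * sideIntegral a δ i f y :=
      (contDiff_lineBump (a i) hδ).continuous.mul continuous_const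
    rw [h1, intervalIntegral.integral_sub (hcf.intervalIntegrable _ _)
      (hcl.intervalIntegrable _ _),
      intervalIntegral.integral_mul_const, integral_lineBump, one_mul]
    exact sub_self _
  refine Submodule.subset_span ⟨_, i, hgs.antideriv h0, ?_⟩
  funext y
  exact (fderiv_antideriv (a i - δ) i hgs.contDiff y).symm

/-- The product of bump functions in the coordinates. -/
def cubeBump (a : Euc m) {δ : ℝ} (hδ : 0 < δ) (y : Euc m) : ℝ :=
  ∏ i, lineBump (a i) hδ (y i)

/-- The variables are integrated out one at a time. The remainder is a product of bumps in the
variables already treated and a function of the others, which keeps its support condition in those.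
-/
lemma exists_sub_prod_lineBump_mul_mem (hδ : 0 < δ) (s : Finset (Fin m)) {f : Euc m → ℝ}
    (hf : CubeSmooth a δ f) : ∃ g : Euc m → ℝ, ContDiff ℝ ∞ g ∧
      (∀ i ∈ s, ∀ (y : Euc m) (t : ℝ), g (y + t • coordVec i) = g y) ∧
      (∀ j ∉ s, ∀ y : Euc m, δ ≤ |y j - a j| → g y = 0) ∧
      (f - fun y => (∏ i ∈ s, lineBump (a i) hδ (y i)) * g y) ∈ cubeDerivatives a δ := by
  induction s using Finset.induction_on with
  | empty =>
    refine ⟨f, hf.contDiff, by simp, fun j _ y hy => hf.eq_zero y j hy, ?_⟩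
    simp only [Finset.prod_empty, one_mul]
    convert Submodule.zero_mem _
    simp
  | insert k s hk ih =>
    obtain ⟨g, hg, hinv, hzero, hmem⟩ := ih
    have hprod : ContDiff ℝ ∞ fun y : Euc m => ∏ i ∈ s, lineBump (a i) hδ (y i) :=
      contDiff_prod fun i _ => (contDiff_lineBump (a i) hδ).comp
        (EuclideanSpace.proj i : Euc m →L[ℝ] ℝ).contDiff
    have hF : CubeSmooth a δ fun y => (∏ i ∈ s, lineBump (a i) hδ (y i)) * g y := by
      refine ⟨hprod.mul hg, fun y j hy => ?_⟩
      by_cases hj : j ∈ s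
      · rw [Finset.prod_eq_zero hj (lineBump_eq_zero _ hδ hy), zero_mul]
      · rw [hzero j hj y hy, mul_zero]
    refine ⟨sideIntegral a δ k g, contDiff_sideIntegral k hg, ?_, ?_, ?_⟩
    · intro i hi y t
      rcases Finset.mem_insert.1 hi with rfl | hi
      · exact sideIntegral_add_smul i g y t
      · have hki : k ≠ i := fun h => hk (h ▸ hi)
        rw [sideIntegral, sideIntegral]
        refine intervalIntegral.integral_congr fun r _ => ?_
        simp only [add_smul_coordVec_apply_ne hki]
        rw [add_right_comm, hinv i hi]
    · intro j hj y hy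
      rw [Finset.mem_insert, not_or] at hj
      exact sideIntegral_eq_zero hj.1 (hzero j hj.2) hy
    · have h1 := sub_lineBump_mul_sideIntegral_mem hδ k hF
      have h2 := Submodule.add_mem _ hmem h1
      convert h2 using 1
      funext y
      have h3 : sideIntegral a δ k (fun y => (∏ i ∈ s, lineBump (a i) hδ (y i)) * g y) y =
          (∏ i ∈ s, lineBump (a i) hδ (y i)) * sideIntegral a δ k g y := by
        rw [sideIntegral, sideIntegral, ← intervalIntegral.integral_const_mul]
        refine intervalIntegral.integral_congr fun r _ => ?_
        simp only
        congr 1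
        refine Finset.prod_congr rfl fun i hi => ?_
        rw [add_smul_coordVec_apply_ne (fun h : i = k => hk (h ▸ hi))]
      simp only [Pi.sub_apply, Pi.add_apply, h3, Finset.prod_insert hk]
      ring

/-- The Poincaré lemma in top degree with supports in a cube. -/
lemma exists_sub_smul_cubeBump_mem (hδ : 0 < δ) {f : Euc m → ℝ} (hf : CubeSmooth a δ f) :
    ∃ c : ℝ, (f - c • cubeBump a hδ) ∈ cubeDerivatives a δ := by
  obtain ⟨g, hg, hinv, -, hmem⟩ := exists_sub_prod_lineBump_mul_mem hδ Finset.univ hf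
  -- With every variable integrated out, g is invariant under all coordinate translations, hence
  -- constant.
  have hd : ∀ y, fderiv ℝ g y = 0 := by
    intro y
    have h0 : ∀ i, fderiv ℝ g y (coordVec i) = 0 := by
      intro i
      have hdy : DifferentiableAt ℝ g y := hg.contDiffAt.differentiableAt (by simp)
      rw [← hdy.lineDeriv_eq_fderiv, lineDeriv]
      simp only [hinv i (Finset.mem_univ i), deriv_const]
    refine ContinuousLinearMap.ext fun v => ?_
    have hv : v = ∑ i, v i • coordVec i := by
      have := (EuclideanSpace.basisFun (Fin m) ℝ).sum_repr v
      simpa using this.symm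
    rw [hv, map_sum]
    simp [h0]
  have hconst : ∀ y, g y = g a := fun y =>
    is_const_of_fderiv_eq_zero (hg.differentiable (by simp)) hd y a
  refine ⟨g a, ?_⟩
  convert hmem using 2
  funext y
  simp only [Pi.smul_apply, smul_eq_mul, cubeBump, hconst y]
  ring

lemma cubeSmooth_cubeBump (hδ : 0 < δ) : CubeSmooth a δ (cubeBump a hδ) where
  contDiff := contDiff_prod fun i _ => (contDiff_lineBump (a i) hδ).comp
    (EuclideanSpace.proj i : Euc m →L[ℝ] ℝ).contDiff
  eq_zero _ i hy := Finset.prod_eq_zero (Finset.mem_univ i) (lineBump_eq_zero _ hδ hy)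

lemma cubeBump_nonneg {a : Euc m} {δ : ℝ} (hδ : 0 < δ) (y : Euc m) : 0 ≤ cubeBump a hδ y :=
  Finset.prod_nonneg fun _ _ => ContDiffBump.nonneg_normed _ _

lemma cubeBump_center_pos (hδ : 0 < δ) : 0 < cubeBump a hδ a := by
  refine Finset.prod_pos fun i _ => ?_
  have h : a i ∈ Function.support (lineBump (a i) hδ) := by
    have := (ContDiffBump.support_normed_eq (c := a i)
      ⟨δ / 2, δ, half_pos hδ, half_lt_self hδ⟩ (μ := (volume : Measure ℝ)))
    exact this.symm ▸ Metric.mem_ball_self hδ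
  exact lt_of_le_of_ne (ContDiffBump.nonneg_normed _ _) (Ne.symm h)

end Poincare

/-! ### Integration over a coordinate ball and independence of the chart. -/

section Local

open MeasureTheory Set

variable {m : ℕ} {H : Type*} [TopologicalSpace H] [ChartedSpace (Euc m) H]
  [IsManifold (IH m) ∞ H] {X : MultivectorField (IH m) H m}

namespace ChartFrame

variable (F : ChartFrame X)

/-- The chart of a frame. -/
abbrev chart : PartialEquiv H (Euc m) := extChartAt (IH m) F.center

lemma isOpen_ball : IsOpen F.ball := Metric.isOpen_ball

lemma abs_bracket {x : H} (hx : x ∈ F.domain) :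
    |bracket X F.coord x| = F.sgn * bracket X F.coord x := by
  have h := F.sgn_mul_bracket_pos hx
  rcases F.sgn_eq with h1 | h1
  · rw [h1, one_mul] at h ⊢
    exact abs_of_pos h
  · rw [h1, neg_one_mul] at h ⊢
    exact abs_of_neg (neg_pos.1 h)

/-- A function on `H` read in the chart, on the coordinate ball, and extended by zero. -/
def localRep (f : H → ℝ) : Euc m → ℝ := indicator F.ball (f ∘ F.chart.symm)

lemma localRep_of_mem (f : H → ℝ) {y : Euc m} (hy : y ∈ F.ball) :
    F.localRep f y = f (F.chart.symm y) := indicator_of_mem hy _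

/-- The part of the chart image of a set which lies in the ball. -/
lemma localRep_eq_zero {f : H → ℝ} {y : Euc m} (hy : y ∉ F.chart '' tsupport f) :
    F.localRep f y = 0 := by
  by_cases hb : y ∈ F.ball
  · rw [F.localRep_of_mem f hb]
    by_contra hne
    exact hy ⟨F.chart.symm y, subset_tsupport f hne,
      F.chart.right_inv (F.ball_subset_target hb)⟩
  · exact indicator_of_notMem hb _

lemma isCompact_chart_image [CompactSpace H] {K : Set H} (hK : IsClosed K) (hKF : K ⊆ F.domain) :
    IsCompact (F.chart '' K) :=
  hK.isCompact.image_of_continuousOn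
    ((continuousOn_extChartAt F.center).mono fun _ hx => (hKF hx).1)

lemma chart_image_subset_ball {K : Set H} (hKF : K ⊆ F.domain) : F.chart '' K ⊆ F.ball := by
  rintro _ ⟨x, hx, rfl⟩
  exact (hKF hx).2

lemma hasCompactSupport_localRep [CompactSpace H] {f : H → ℝ} (hf : tsupport f ⊆ F.domain) :
    HasCompactSupport (F.localRep f) :=
  HasCompactSupport.intro (F.isCompact_chart_image (isClosed_tsupport f) hf)
    fun _ hy => F.localRep_eq_zero hy

lemma contDiff_localRep [CompactSpace H] (f : C^∞⟮IH m, H; ℝ⟯) (hf : tsupport f ⊆ F.domain) :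
    ContDiff ℝ ∞ (F.localRep f) := by
  have hK := F.isCompact_chart_image (isClosed_tsupport f) hf
  rw [contDiff_iff_contDiffAt]
  intro y
  by_cases hy : y ∈ F.ball
  · have h1 : F.localRep f =ᶠ[nhds y] f ∘ F.chart.symm := by
      filter_upwards [F.isOpen_ball.mem_nhds hy] with z hz using F.localRep_of_mem f hz
    refine ContDiffAt.congr_of_eventuallyEq ?_ h1
    exact (contDiffOn_comp_extChartAt_symm f F.center).contDiffAt
      (Filter.mem_of_superset (F.isOpen_ball.mem_nhds hy) F.ball_subset_target)
  · have hy' : y ∉ F.chart '' tsupport f := fun h => hy (F.chart_image_subset_ball hf h)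
    have h1 : F.localRep f =ᶠ[nhds y] fun _ => 0 := by
      filter_upwards [hK.isClosed.isOpen_compl.mem_nhds hy'] with z hz
      exact F.localRep_eq_zero hz
    exact contDiffAt_const.congr_of_eventuallyEq h1

/-- The quotient of a function supported in the coordinate ball by the coefficient of `X`. -/
def divCoeff (f : C^∞⟮IH m, H; ℝ⟯) (hf : tsupport f ⊆ F.domain) : C^∞⟮IH m, H; ℝ⟯ :=
  ⟨fun x => f x / bracket X F.coord x, fun x => by
    by_cases hx : x ∈ tsupport f
    · exact (f.contMDiff x).div₀ ((bracket X F.coord).contMDiff x) (F.bracket_ne_zero (hf hx))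
    · have h1 : (fun x => f x / bracket X F.coord x) =ᶠ[nhds x] fun _ => 0 := by
        filter_upwards [notMem_tsupport_iff_eventuallyEq.1 hx] with z hz
        rw [hz]
        exact zero_div _
      exact contMDiffAt_const.congr_of_eventuallyEq h1⟩

lemma divCoeff_apply (f : C^∞⟮IH m, H; ℝ⟯) (hf : tsupport f ⊆ F.domain) (x : H) :
    F.divCoeff f hf x = f x / bracket X F.coord x := rfl

lemma tsupport_divCoeff_subset (f : C^∞⟮IH m, H; ℝ⟯) (hf : tsupport f ⊆ F.domain) :
    tsupport (F.divCoeff f hf) ⊆ tsupport f := by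
  refine closure_mono fun x hx => ?_
  intro h0
  exact hx (by rw [divCoeff_apply, h0, zero_div])

/-- The integral over the coordinate ball with respect to the density dual to `X`. -/
def integral (f : H → ℝ) : ℝ := ∫ y, F.localRep (fun x => f x / |bracket X F.coord x|) y

/-- The coefficient of X has constant sign on the ball, so the absolute value in the density does
not spoil smoothness. -/
lemma localRep_density (f : C^∞⟮IH m, H; ℝ⟯) (hf : tsupport f ⊆ F.domain) :
    F.localRep (fun x => f x / |bracket X F.coord x|) =
      fun y => F.sgn * F.localRep (F.divCoeff f hf) y := by
  funext y
  by_cases hy : y ∈ F.ball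
  · rw [F.localRep_of_mem _ hy, F.localRep_of_mem _ hy, divCoeff_apply,
      F.abs_bracket (F.symm_mem_domain hy)]
    have h1 := F.bracket_ne_zero (F.symm_mem_domain hy)
    rcases F.sgn_eq with h | h <;> rw [h] <;> simp [div_neg]
  · rw [localRep, localRep, indicator_of_notMem hy, indicator_of_notMem hy, mul_zero]

lemma integrable_localRep_density [CompactSpace H] (f : C^∞⟮IH m, H; ℝ⟯)
    (hf : tsupport f ⊆ F.domain) :
    Integrable (F.localRep (fun x => f x / |bracket X F.coord x|)) := by
  rw [F.localRep_density f hf]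
  have h := (F.tsupport_divCoeff_subset f hf).trans hf
  exact ((F.contDiff_localRep _ h).continuous.integrable_of_hasCompactSupport
    (F.hasCompactSupport_localRep h)).const_mul _

lemma integral_nonneg {f : H → ℝ} (hf : ∀ x, 0 ≤ f x) : 0 ≤ F.integral f :=
  MeasureTheory.integral_nonneg fun y =>
    indicator_nonneg (fun _ _ => div_nonneg (hf _) (abs_nonneg _)) y

lemma integral_pos [CompactSpace H] (f : C^∞⟮IH m, H; ℝ⟯) (hf : tsupport f ⊆ F.domain)
    (h0 : ∀ x, 0 ≤ f x) {x : H} (hx : x ∈ F.domain) (hfx : f x ≠ 0) : 0 < F.integral f := by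
  have h := (F.tsupport_divCoeff_subset f hf).trans hf
  rw [integral]
  refine Continuous.integral_pos_of_hasCompactSupport_nonneg_nonzero (x := F.chart x) ?_ ?_ ?_ ?_
  · rw [F.localRep_density f hf]
    exact continuous_const.mul (F.contDiff_localRep _ h).continuous
  · rw [F.localRep_density f hf]
    exact (F.hasCompactSupport_localRep h).mul_left
  · exact fun y => indicator_nonneg (fun _ _ => div_nonneg (h0 _) (abs_nonneg _)) y
  · rw [F.localRep_of_mem _ hx.2, F.chart.left_inv hx.1]
    exact div_ne_zero hfx (abs_ne_zero.2 (F.bracket_ne_zero hx))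

lemma integral_add [CompactSpace H] (f g : C^∞⟮IH m, H; ℝ⟯) (hf : tsupport f ⊆ F.domain)
    (hg : tsupport g ⊆ F.domain) : F.integral (f + g : C^∞⟮IH m, H; ℝ⟯) =
      F.integral f + F.integral g := by
  rw [integral, integral, integral, ← MeasureTheory.integral_add
    (F.integrable_localRep_density f hf) (F.integrable_localRep_density g hg)]
  congr 1
  funext y
  by_cases hy : y ∈ F.ball
  · simp only [F.localRep_of_mem _ hy]
    exact add_div _ _ _
  · simp [localRep, hy]

lemma integral_smul (c : ℝ) (f : C^∞⟮IH m, H; ℝ⟯) :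
    F.integral (c • f : C^∞⟮IH m, H; ℝ⟯) = c * F.integral f := by
  rw [integral, integral, ← MeasureTheory.integral_const_mul]
  congr 1
  funext y
  by_cases hy : y ∈ F.ball
  · simp only [F.localRep_of_mem _ hy]
    exact mul_div_assoc _ _ _
  · simp [localRep, hy]

/-- The chart integral does not depend on the chart. -/
lemma integral_eq_integral (G : ChartFrame X) {f : H → ℝ} (hfF : ∀ x ∉ F.domain, f x = 0)
    (hfG : ∀ x ∉ G.domain, f x = 0) : G.integral f = F.integral f := by
  -- The transition map of the two charts, considered on the overlap S; writing it with the global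
  -- coordinate functions of G makes its smoothness immediate.
  set τ : Euc m → Euc m := fun y => WithLp.toLp 2 fun i => G.coord i (F.chart.symm y) with hτ
  set S : Set (Euc m) := F.ball ∩ F.chart.symm ⁻¹' G.domain with hS
  have hSo : IsOpen S :=
    ((continuousOn_extChartAt_symm F.center).mono F.ball_subset_target).isOpen_inter_preimage
      F.isOpen_ball G.isOpen_domain
  have hτS : ∀ y ∈ S, τ y = G.chart (F.chart.symm y) := by
    intro y hy
    have h1 : F.chart.symm y ∈ G.domain := hy.2
    ext i
    have h2 := G.coord_symm _ h1.2 i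
    have h3 : G.chart.symm (G.chart (F.chart.symm y)) = F.chart.symm y := G.chart.left_inv h1.1
    rw [h3] at h2
    exact h2
  have hτd : ∀ y ∈ S, DifferentiableAt ℝ τ y := by
    intro y hy
    have h1 : ContDiffOn ℝ ∞ τ F.chart.target := by
      rw [contDiffOn_euclidean]
      exact fun i => contDiffOn_comp_extChartAt_symm (G.coord i) F.center
    exact (h1.contDiffAt (Filter.mem_of_superset (F.isOpen_ball.mem_nhds hy.1)
      F.ball_subset_target)).differentiableAt (by simp)
  have hinj : InjOn τ S := by
    intro y hy z hz h
    rw [hτS y hy, hτS z hz] at h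
    have h1 := G.chart.injOn hy.2.1 hz.2.1 h
    exact F.chart.symm.injOn (F.ball_subset_target hy.1) (F.ball_subset_target hz.1) h1
  have himage : τ '' S ⊆ G.ball := by
    rintro _ ⟨y, hy, rfl⟩
    rw [hτS y hy]
    exact hy.2.2
  have hdet : ∀ y ∈ S, (fderiv ℝ τ y).det = frameDet F.field G.coord (F.chart.symm y) := by
    intro y hy
    rw [frameDet, coe_det, ContinuousLinearMap.det,
      ← LinearMap.det_toMatrix (EuclideanSpace.basisFun (Fin m) ℝ).toBasis]
    congr 1
    ext i j
    rw [LinearMap.toMatrix_apply]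
    have h1 : act (F.field j) (G.coord i) (F.chart.symm y) = _ :=
      F.act_field_symm y hy.1 j (G.coord i)
    rw [Matrix.of_apply, Matrix.of_apply, h1]
    have h2 : (G.coord i ∘ F.chart.symm) = (EuclideanSpace.proj i : Euc m →L[ℝ] ℝ) ∘ τ := rfl
    rw [h2, fderiv_comp y (ContinuousLinearMap.differentiableAt _) (hτd y hy),
      ContinuousLinearMap.fderiv]
    simp
  -- The coefficients of X differ by the Jacobian determinant of τ, so the densities dy/|b| agree
  -- under the change of variables.
  have hbr : ∀ y ∈ S, bracket X G.coord (F.chart.symm y) =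
      bracket X F.coord (F.chart.symm y) * (fderiv ℝ τ y).det := by
    intro y hy
    rw [hdet y hy]
    have h1 : bracket X G.coord (F.chart.symm y) * frameDet F.field F.coord (F.chart.symm y) = _ :=
      DFunLike.congr_fun
        (bracket_mul_frameDet finrank_euclideanSpace_fin X F.field G.coord F.coord) (F.chart.symm y)
    rw [frameDet_eq_one (F.act_field_coord (F.symm_mem_domain hy.1)), mul_one] at h1
    exact h1
  have e1 : G.integral f = ∫ z in τ '' S, f (G.chart.symm z) /
      |bracket X G.coord (G.chart.symm z)| := by
    rw [integral, localRep, MeasureTheory.integral_indicator G.isOpen_ball.measurableSet]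
    refine setIntegral_eq_of_subset_of_forall_sdiff_eq_zero G.isOpen_ball.measurableSet himage ?_
    rintro z ⟨hz, hzS⟩
    have h0 : f (G.chart.symm z) = 0 := by
      refine hfF _ fun hF => hzS ⟨F.chart (G.chart.symm z), ⟨hF.2, ?_⟩, ?_⟩
      · rw [mem_preimage, F.chart.left_inv hF.1]
        exact G.symm_mem_domain hz
      · rw [hτS, F.chart.left_inv hF.1, G.chart.right_inv (G.ball_subset_target hz)]
        refine ⟨hF.2, ?_⟩
        rw [mem_preimage, F.chart.left_inv hF.1]
        exact G.symm_mem_domain hz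
    exact (congrArg (fun a : ℝ => a / |bracket X G.coord (G.chart.symm z)|) h0).trans (zero_div _)
  have e2 : F.integral f = ∫ y in S, f (F.chart.symm y) /
      |bracket X F.coord (F.chart.symm y)| := by
    rw [integral, localRep, MeasureTheory.integral_indicator F.isOpen_ball.measurableSet]
    refine setIntegral_eq_of_subset_of_forall_sdiff_eq_zero F.isOpen_ball.measurableSet
      inter_subset_left ?_
    rintro y ⟨hy, hyS⟩
    have h0 : f (F.chart.symm y) = 0 := hfG _ fun hG => hyS ⟨hy, hG⟩
    exact (congrArg (fun a : ℝ => a / |bracket X F.coord (F.chart.symm y)|) h0).trans (zero_div _)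
  rw [e1, e2, integral_image_eq_integral_abs_det_fderiv_smul volume hSo.measurableSet
    (fun y hy => (hτd y hy).hasFDerivAt.hasFDerivWithinAt) hinj]
  refine setIntegral_congr_fun hSo.measurableSet fun y hy => ?_
  have h3 : G.chart.symm (τ y) = F.chart.symm y := by
    rw [hτS y hy]
    exact G.chart.left_inv hy.2.1
  simp only [h3, smul_eq_mul]
  rw [hbr y hy, abs_mul]
  have h4 : |(fderiv ℝ τ y).det| ≠ 0 := by
    intro h0
    refine G.bracket_ne_zero hy.2 ?_
    rw [hbr y hy, abs_eq_zero.1 h0, mul_zero]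
  field_simp

end ChartFrame

end Local

/-! ### Rules for the divergence, and its integral in a chart. -/

section Divergence

open MeasureTheory Set

variable {m : ℕ} {H : Type*} [TopologicalSpace H] [ChartedSpace (Euc m) H]
  [IsManifold (IH m) ∞ H] [T2Space H] {X : MultivectorField (IH m) H m}

/-- The divergence as a linear map. -/
def divMap (hX : ∀ x, X.1 x ≠ 0) : VField (IH m) H →ₗ[ℝ] C^∞⟮IH m, H; ℝ⟯ where
  toFun := smoothDivergence hX
  map_add' Y Z := by
    ext x
    obtain ⟨F, rfl, -⟩ := exists_chartFrame hX x Filter.univ_mem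
    have hb := F.bracket_ne_zero F.center_mem_domain
    have h1 := lieDerivBracket_eq_divergence hX (Y + Z) F.coord F.center
    rw [map_add] at h1
    have h2 : lieDerivBracket X Y F.coord F.center + lieDerivBracket X Z F.coord F.center =
      -divergence X (Y + Z) F.center * bracket X F.coord F.center := h1
    rw [lieDerivBracket_eq_divergence hX, lieDerivBracket_eq_divergence hX] at h2
    change divergence X (Y + Z) F.center = divergence X Y F.center + divergence X Z F.center
    refine mul_right_cancel₀ hb ?_
    linear_combination h2
  map_smul' c Y := by
    ext x
    obtain ⟨F, rfl, -⟩ := exists_chartFrame hX x Filter.univ_mem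
    have hb := F.bracket_ne_zero F.center_mem_domain
    have h1 := lieDerivBracket_eq_divergence hX (c • Y) F.coord F.center
    rw [map_smul] at h1
    have h2 : c * lieDerivBracket X Y F.coord F.center =
      -divergence X (c • Y) F.center * bracket X F.coord F.center := h1
    rw [lieDerivBracket_eq_divergence hX] at h2
    change divergence X (c • Y) F.center = c * divergence X Y F.center
    refine mul_right_cancel₀ hb ?_
    linear_combination h2

lemma divMap_apply (hX : ∀ x, X.1 x ≠ 0) (Y : VField (IH m) H) (x : H) :
    divMap hX Y x = divergence X Y x := rfl

omit [T2Space H] in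
lemma act_eq_sum (F : ChartFrame X) {x : H} (hx : x ∈ F.domain) (Y : VField (IH m) H)
    (u : C^∞⟮IH m, H; ℝ⟯) :
    act Y u x = ∑ i, act Y (F.coord i) x * act (F.field i) u x := by
  rw [act_apply, F.vector_expand hx (Y x), map_sum]
  refine Finset.sum_congr rfl fun i _ => ?_
  exact map_smul (differential (IH m) u x) _ _

lemma act_mul {E : Type*} [NormedAddCommGroup E] [NormedSpace ℝ E]
    {B : Type*} [TopologicalSpace B] {I : ModelWithCorners ℝ E B}
    {M : Type*} [TopologicalSpace M] [ChartedSpace B M] [IsManifold I ∞ M] (Y : VField I M)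
    (f g : C^∞⟮I, M; ℝ⟯) (p : M) : act Y (f * g) p = f p * act Y g p + g p * act Y f p :=
  DFunLike.congr_fun ((actDerivation Y).leibniz f g) p

lemma act_congr {E : Type*} [NormedAddCommGroup E] [NormedSpace ℝ E]
    {B : Type*} [TopologicalSpace B] {I : ModelWithCorners ℝ E B}
    {M : Type*} [TopologicalSpace M] [ChartedSpace B M] [IsManifold I ∞ M] (Y : VField I M)
    {f g : C^∞⟮I, M; ℝ⟯} {p : M} (h : (f : M → ℝ) =ᶠ[nhds p] g) : act Y f p = act Y g p := by
  rw [act_apply, act_apply]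
  have h1 : differential I f p = differential I g p := h.mfderiv_eq
  rw [h1]

/-- The Leibniz rule for the divergence. -/
lemma divergence_smulField (hX : ∀ x, X.1 x ≠ 0) (u : C^∞⟮IH m, H; ℝ⟯) (Y : VField (IH m) H)
    (x : H) : divergence X (smulField u Y) x = act Y u x + u x * divergence X Y x := by
  obtain ⟨F, rfl, -⟩ := exists_chartFrame hX x Filter.univ_mem
  have hc := F.center_mem_domain
  rw [divergence_frame hX F _ hc, divergence_frame hX F _ hc, act_eq_sum F hc Y u]
  simp only [act_smulField, act_mul]
  rw [Finset.sum_add_distrib, ← Finset.mul_sum]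
  change _ - u F.center * act Y (bracket X F.coord) F.center / bracket X F.coord F.center = _
  ring

lemma divergence_field (hX : ∀ x, X.1 x ≠ 0) (F : ChartFrame X) (j : Fin m) {x : H}
    (hx : x ∈ F.domain) : divergence X (F.field j) x =
      - act (F.field j) (bracket X F.coord) x / bracket X F.coord x := by
  rw [divergence_frame hX F _ hx, neg_div, sub_eq_neg_self]
  refine Finset.sum_eq_zero fun i _ => ?_
  have h1 : (act (F.field j) (F.coord i) : H → ℝ) =ᶠ[nhds x]
      ((if i = j then (1 : C^∞⟮IH m, H; ℝ⟯) else 0 : C^∞⟮IH m, H; ℝ⟯) : H → ℝ) := by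
    filter_upwards [F.isOpen_domain.mem_nhds hx] with z hz
    rw [F.act_field_coord hz]
    split_ifs <;> rfl
  rw [act_congr _ h1]
  split_ifs
  · exact DFunLike.congr_fun (actDerivation (F.field i)).map_one_eq_zero x
  · exact DFunLike.congr_fun (actDerivation (F.field i)).map_zero x

/-- For b the coefficient of X, the field b E_j has divergence zero, so only the derivative of u
survives. This reduces divergences to plain partial derivatives. -/
lemma divergence_smulField_field (hX : ∀ x, X.1 x ≠ 0) (F : ChartFrame X) (j : Fin m)
    (u : C^∞⟮IH m, H; ℝ⟯) {x : H} (hx : x ∈ F.domain) :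
    divergence X (smulField (bracket X F.coord * u) (F.field j)) x =
      bracket X F.coord x * act (F.field j) u x := by
  rw [divergence_smulField hX, divergence_field hX F j hx, act_mul]
  change _ + bracket X F.coord x * u x * _ = _
  have := F.bracket_ne_zero hx
  field_simp
  ring

lemma divergence_eq_zero_of_notMem (hX : ∀ x, X.1 x ≠ 0) (u : C^∞⟮IH m, H; ℝ⟯)
    (Y : VField (IH m) H) {x : H} (hx : x ∉ tsupport u) : divergence X (smulField u Y) x = 0 := by
  have h1 : (u : H → ℝ) =ᶠ[nhds x] ((0 : C^∞⟮IH m, H; ℝ⟯) : H → ℝ) :=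
    notMem_tsupport_iff_eventuallyEq.1 hx
  have h2 : act Y (0 : C^∞⟮IH m, H; ℝ⟯) x = 0 :=
    DFunLike.congr_fun (actDerivation Y).map_zero x
  rw [divergence_smulField hX, act_congr _ h1, h2, h1.self_of_nhds]
  change 0 + 0 * _ = (0 : ℝ)
  ring

/-- Integration by parts against the constant function 1. -/
lemma integral_fderiv_eq_zero {u : Euc m → ℝ} (hu : ContDiff ℝ ∞ u) (hc : HasCompactSupport u)
    (v : Euc m) : ∫ y, fderiv ℝ u y v = 0 := by
  have h1 : Integrable fun y => fderiv ℝ u y v :=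
    ((hu.continuous_fderiv (by simp)).clm_apply continuous_const).integrable_of_hasCompactSupport
      (hc.fderiv_apply ℝ v)
  have h := integral_mul_fderiv_eq_neg_fderiv_mul_of_integrable (μ := volume)
    (f := fun _ : Euc m => (1 : ℝ)) (g := u) (v := v) (by simp) (by simpa using h1)
    (by simpa using hu.continuous.integrable_of_hasCompactSupport hc)
    (fun _ _ => differentiableAt_const _)
    (fun y _ => (hu.differentiable (by simp)) y)
  simpa using h

/-- With u = b w the divergence is b E_j w. The density 1/|b| cancels b up to a constant sign and
leaves the integral of a partial derivative of a compactly supported function. -/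
lemma ChartFrame.integral_divergence [CompactSpace H] (hX : ∀ x, X.1 x ≠ 0) (F : ChartFrame X)
    (j : Fin m) (u : C^∞⟮IH m, H; ℝ⟯) (hu : tsupport u ⊆ F.domain) :
    F.integral (divMap hX (smulField u (F.field j))) = 0 := by
  set w := F.divCoeff u hu with hw
  have hwu := F.tsupport_divCoeff_subset u hu
  have hwF := hwu.trans hu
  have huw : u = bracket X F.coord * w := by
    ext x
    by_cases hx : x ∈ F.domain
    · change u x = bracket X F.coord x * (u x / bracket X F.coord x)
      have := F.bracket_ne_zero hx
      field_simp
    · have h0 : u x = 0 := image_eq_zero_of_notMem_tsupport fun h => hx (hu h)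
      change u x = bracket X F.coord x * (u x / bracket X F.coord x)
      rw [h0, zero_div, mul_zero]
  have hint : ∀ y, F.localRep (fun x => divMap hX (smulField u (F.field j)) x /
      |bracket X F.coord x|) y = F.sgn * fderiv ℝ (F.localRep w) y (coordVec j) := by
    intro y
    by_cases hy : y ∈ F.ball
    · have hx := F.symm_mem_domain hy
      rw [F.localRep_of_mem _ hy, divMap_apply, huw, divergence_smulField_field hX F j w hx,
        F.abs_bracket hx]
      have h1 : act (F.field j) w (F.chart.symm y) = _ := F.act_field_symm y hy j w
      have h2 : F.localRep w =ᶠ[nhds y] w ∘ F.chart.symm := by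
        filter_upwards [F.isOpen_ball.mem_nhds hy] with z hz using F.localRep_of_mem w hz
      rw [h1, h2.fderiv_eq]
      have := F.bracket_ne_zero hx
      have h4 : F.chart.symm y = (extChartAt (IH m) F.center).symm y := rfl
      rcases F.sgn_eq with h | h <;> rw [h] <;> field_simp
    · have hy' : y ∉ F.chart '' tsupport w := fun h => hy (F.chart_image_subset_ball hwF h)
      have h1 : F.localRep w =ᶠ[nhds y] fun _ => 0 := by
        filter_upwards [(F.isCompact_chart_image (isClosed_tsupport w)
          hwF).isClosed.isOpen_compl.mem_nhds hy'] with z hz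
        exact F.localRep_eq_zero hz
      rw [h1.fderiv_eq, ChartFrame.localRep, indicator_of_notMem hy]
      simp
  rw [ChartFrame.integral]
  simp only [hint]
  rw [MeasureTheory.integral_const_mul, integral_fderiv_eq_zero (F.contDiff_localRep w hwF)
    (F.hasCompactSupport_localRep hwF), mul_zero]

end Divergence

/-! ### Finite smooth partitions of unity. -/

section Partition

open MeasureTheory Set

variable {m : ℕ} {H : Type*} [TopologicalSpace H] [ChartedSpace (Euc m) H]
  [IsManifold (IH m) ∞ H] [T2Space H] [CompactSpace H]

lemma exists_finite_partition (U : H → Set H) (hU : ∀ x, IsOpen (U x)) (hxU : ∀ x, x ∈ U x) :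
    ∃ (t : Finset H) (ρ : t → C^∞⟮IH m, H; ℝ⟯), (∀ i, tsupport (ρ i) ⊆ U i) ∧
      (∀ i x, 0 ≤ ρ i x) ∧ ∑ i, ρ i = 1 := by
  obtain ⟨t, ht⟩ := isCompact_univ.elim_finite_subcover U hU
    fun x _ => mem_iUnion.2 ⟨x, hxU x⟩
  obtain ⟨ρ, hρ⟩ := SmoothPartitionOfUnity.exists_isSubordinate (IH m) (ι := t)
    (isClosed_univ (X := H)) (fun i => U i) (fun i => hU i) (by
      intro x hx
      obtain ⟨i, hi, hxi⟩ := mem_iUnion₂.1 (ht hx)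
      exact mem_iUnion.2 ⟨⟨i, hi⟩, hxi⟩)
  refine ⟨t, fun i => ρ i, hρ, fun i x => ρ.nonneg i x, ?_⟩
  ext x
  rw [sum_apply]
  have h := ρ.sum_eq_one (mem_univ x)
  rwa [finsum_eq_sum_of_fintype] at h

end Partition

/-! ### The global integral and the divergence theorem. -/

section Integral

open MeasureTheory Set

variable {m : ℕ} {H : Type*} [TopologicalSpace H] [ChartedSpace (Euc m) H]
  [IsManifold (IH m) ∞ H] [T2Space H] [CompactSpace H] {X : MultivectorField (IH m) H m}

omit [IsManifold (IH m) ∞ H] [T2Space H] [CompactSpace H] in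
lemma tsupport_mul_subset_left' (f g : C^∞⟮IH m, H; ℝ⟯) :
    tsupport (f * g : C^∞⟮IH m, H; ℝ⟯) ⊆ tsupport f :=
  tsupport_mul_subset_left (f := (f : H → ℝ)) (g := (g : H → ℝ))

omit [IsManifold (IH m) ∞ H] [T2Space H] [CompactSpace H] in
lemma tsupport_mul_subset_right' (f g : C^∞⟮IH m, H; ℝ⟯) :
    tsupport (f * g : C^∞⟮IH m, H; ℝ⟯) ⊆ tsupport g :=
  tsupport_mul_subset_right (f := (f : H → ℝ)) (g := (g : H → ℝ))

omit [T2Space H] in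
lemma ChartFrame.integral_sum_mul (F : ChartFrame X) {ι : Type*} (s : Finset ι)
    (ρ : ι → C^∞⟮IH m, H; ℝ⟯) (f : C^∞⟮IH m, H; ℝ⟯) (hf : tsupport f ⊆ F.domain) :
    F.integral ((∑ i ∈ s, ρ i) * f : C^∞⟮IH m, H; ℝ⟯) =
      ∑ i ∈ s, F.integral (ρ i * f : C^∞⟮IH m, H; ℝ⟯) := by
  classical
  induction s using Finset.induction_on with
  | empty =>
    have h := F.integral_smul 0 (0 : C^∞⟮IH m, H; ℝ⟯)
    rw [zero_smul, zero_mul] at h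
    simpa using h
  | insert a s ha ih =>
    rw [Finset.sum_insert ha, Finset.sum_insert ha, add_mul, F.integral_add _ _
      ((tsupport_mul_subset_right' _ _).trans hf) ((tsupport_mul_subset_right' _ _).trans hf), ih]

/-- The integral of smooth functions on `H`, with respect to the density dual to `X`. -/
lemma exists_integral (hX : ∀ x, X.1 x ≠ 0) : ∃ J : C^∞⟮IH m, H; ℝ⟯ →ₗ[ℝ] ℝ,
    (∀ (F : ChartFrame X) (f : C^∞⟮IH m, H; ℝ⟯), tsupport f ⊆ F.domain → J f = F.integral f) ∧
    (∀ f : C^∞⟮IH m, H; ℝ⟯, (∀ x, 0 ≤ f x) → ∀ x, f x ≠ 0 → 0 < J f) := by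
  choose F hF _ using fun x => exists_chartFrame hX x Filter.univ_mem
  obtain ⟨t, ρ, hρ, hρ0, hρ1⟩ := exists_finite_partition (m := m) (fun x => (F x).domain)
    (fun x => (F x).isOpen_domain) fun x => by
      have h := (F x).center_mem_domain
      rwa [hF] at h
  have hsupp : ∀ (i : t) (f : C^∞⟮IH m, H; ℝ⟯), tsupport (ρ i * f : C^∞⟮IH m, H; ℝ⟯) ⊆ (F i).domain := fun i f =>
    (tsupport_mul_subset_left' _ _).trans (hρ i)
  refine ⟨{ toFun := fun f => ∑ i : t, (F i).integral (ρ i * f : C^∞⟮IH m, H; ℝ⟯)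
            map_add' := fun f g => ?_
            map_smul' := fun c f => ?_ }, fun G f hf => ?_, fun f hf x hx => ?_⟩
  · rw [← Finset.sum_add_distrib]
    refine Finset.sum_congr rfl fun i _ => ?_
    rw [mul_add, (F i).integral_add _ _ (hsupp i f) (hsupp i g)]
  · rw [smul_eq_mul, Finset.mul_sum]
    refine Finset.sum_congr rfl fun i _ => ?_
    rw [mul_smul_comm, (F i).integral_smul, RingHom.id_apply]
  · change ∑ i : t, (F i).integral (ρ i * f : C^∞⟮IH m, H; ℝ⟯) = G.integral f
    -- The function ρᵢ f is supported in both coordinate balls, so it may be integrated in the chart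
    -- G instead.
    have h1 : ∀ i : t, (F i).integral (ρ i * f : C^∞⟮IH m, H; ℝ⟯) =
        G.integral (ρ i * f : C^∞⟮IH m, H; ℝ⟯) := fun i =>
      G.integral_eq_integral (F i)
        (fun x hx => image_eq_zero_of_notMem_tsupport fun h =>
          hx (hf (tsupport_mul_subset_right' _ _ h)))
        (fun x hx => image_eq_zero_of_notMem_tsupport fun h => hx (hsupp i f h))
    rw [Finset.sum_congr rfl fun i _ => h1 i, ← G.integral_sum_mul _ ρ f hf, hρ1, one_mul]
  · change 0 < ∑ i : t, (F i).integral (ρ i * f : C^∞⟮IH m, H; ℝ⟯)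
    have hnn : ∀ (i : t) x, 0 ≤ (ρ i * f : C^∞⟮IH m, H; ℝ⟯) x := fun i x =>
      mul_nonneg (hρ0 i x) (hf x)
    obtain ⟨i, hi⟩ : ∃ i, ρ i x ≠ 0 := by
      by_contra! hall
      have h1 := DFunLike.congr_fun hρ1 x
      rw [sum_apply, Finset.sum_eq_zero fun i _ => hall i] at h1
      exact zero_ne_one h1
    refine Finset.sum_pos' (fun i _ => (F i).integral_nonneg (hnn i)) ⟨i, Finset.mem_univ i, ?_⟩
    exact (F i).integral_pos _ (hsupp i f) (hnn i)
      (hρ i (subset_tsupport _ hi)) (mul_ne_zero hi hx)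

omit [T2Space H] [CompactSpace H] in
lemma vectorField_sum_apply {ι : Type*} (s : Finset ι) (Z : ι → VField (IH m) H) (x : H) :
    (∑ i ∈ s, Z i) x = ∑ i ∈ s, Z i x := by
  have h1 := map_sum
    (ContMDiffSection.coeAddHom (IH m) (Euc m) ∞ (TangentSpace (IH m) : H → Type _)) Z s
  have h2 := congrFun h1 x
  rw [Finset.sum_apply] at h2
  exact h2

/-- The divergence theorem. -/
lemma integral_divMap (hX : ∀ x, X.1 x ≠ 0) {J : C^∞⟮IH m, H; ℝ⟯ →ₗ[ℝ] ℝ}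
    (hJ : ∀ (F : ChartFrame X) (f : C^∞⟮IH m, H; ℝ⟯), tsupport f ⊆ F.domain →
      J f = F.integral f) (Y : VField (IH m) H) : J (divMap hX Y) = 0 := by
  choose F hF _ using fun x => exists_chartFrame hX x Filter.univ_mem
  obtain ⟨t, ρ, hρ, hρ0, hρ1⟩ := exists_finite_partition (m := m) (fun x => (F x).domain)
    (fun x => (F x).isOpen_domain) fun x => by
      have h := (F x).center_mem_domain
      rwa [hF] at h
  -- Each ρᵢ Y is expanded in the frame of its own chart, so that every summand is a multiple of one
  -- coordinate field with support in one ball.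
  have hY : Y = ∑ i : t, ∑ j, smulField (ρ i * act Y ((F i).coord j)) ((F i).field j) := by
    ext x : 1
    rw [vectorField_sum_apply]
    have h1 : ∀ i : t, (∑ j, smulField (ρ i * act Y ((F i).coord j)) ((F i).field j)) x =
        ρ i x • Y x := by
      intro i
      rw [vectorField_sum_apply]
      by_cases hx : x ∈ (F i).domain
      · conv_rhs => rw [(F i).vector_expand hx (Y x), Finset.smul_sum]
        refine Finset.sum_congr rfl fun j _ => ?_
        exact mul_smul (ρ i x) _ _
      · have h0 : ρ i x = 0 := image_eq_zero_of_notMem_tsupport fun h => hx (hρ i h)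
        rw [h0, zero_smul]
        refine Finset.sum_eq_zero fun j _ => ?_
        change (ρ i x * act Y ((F i).coord j) x) • (F i).field j x = 0
        rw [h0, zero_mul, zero_smul]
    rw [Finset.sum_congr rfl fun i _ => h1 i, ← Finset.sum_smul]
    have h2 := DFunLike.congr_fun hρ1 x
    rw [sum_apply] at h2
    rw [h2]
    exact (one_smul ℝ _).symm
  rw [hY, map_sum, map_sum]
  refine Finset.sum_eq_zero fun i _ => ?_
  rw [map_sum, map_sum]
  refine Finset.sum_eq_zero fun j _ => ?_
  have hs : tsupport (ρ i * act Y ((F i).coord j) : C^∞⟮IH m, H; ℝ⟯) ⊆ (F i).domain :=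
    (tsupport_mul_subset_left' _ _).trans (hρ i)
  rw [hJ (F i)]
  · exact (F i).integral_divergence hX j _ hs
  · refine (closure_minimal ?_ (isClosed_tsupport _)).trans hs
    intro x hx
    by_contra h
    exact hx (divergence_eq_zero_of_notMem hX _ _ h)

end Integral

/-! ### Extension by zero from a coordinate ball. -/

section Extend

open MeasureTheory Set

variable {m : ℕ} {H : Type*} [TopologicalSpace H] [ChartedSpace (Euc m) H]
  [IsManifold (IH m) ∞ H] [T2Space H] [CompactSpace H] {X : MultivectorField (IH m) H m}

namespace ChartFrame

variable (F : ChartFrame X)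

open Classical in
/-- A function on the model space, transported to the coordinate ball in `H` and extended by
zero. -/
def extend (u : Euc m → ℝ) (x : H) : ℝ := if x ∈ F.domain then u (F.chart x) else 0

omit [T2Space H] [CompactSpace H] in
lemma extend_of_mem (u : Euc m → ℝ) {x : H} (hx : x ∈ F.domain) :
    F.extend u x = u (F.chart x) := if_pos hx

omit [T2Space H] [CompactSpace H] in
lemma support_extend_subset {u : Euc m → ℝ} {K : Set (Euc m)} (hu : ∀ y ∉ K, u y = 0) :
    Function.support (F.extend u) ⊆ F.chart.symm '' K := by
  intro x hx
  by_cases hxF : x ∈ F.domain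
  · rw [Function.mem_support, F.extend_of_mem u hxF] at hx
    exact ⟨F.chart x, by_contra fun h => hx (hu _ h), F.chart.left_inv hxF.1⟩
  · exact absurd (if_neg hxF) hx

omit [CompactSpace H] in
lemma isClosed_chart_symm_image {K : Set (Euc m)} (hK : IsCompact K) (hKF : K ⊆ F.ball) :
    IsClosed (F.chart.symm '' K) :=
  (hK.image_of_continuousOn
    ((continuousOn_extChartAt_symm F.center).mono (hKF.trans F.ball_subset_target))).isClosed

omit [CompactSpace H] in
lemma tsupport_extend_subset {u : Euc m → ℝ} {K : Set (Euc m)} (hK : IsCompact K)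
    (hKF : K ⊆ F.ball) (hu : ∀ y ∉ K, u y = 0) :
    tsupport (F.extend u) ⊆ F.domain := by
  refine (closure_minimal (F.support_extend_subset hu) (F.isClosed_chart_symm_image hK hKF)).trans ?_
  rintro _ ⟨y, hy, rfl⟩
  exact F.symm_mem_domain (hKF hy)

/-- The extension by zero of a smooth function with compact support in the ball. -/
def smoothExtend {u : Euc m → ℝ} (hu : ContDiff ℝ ∞ u) {K : Set (Euc m)} (hK : IsCompact K)
    (hKF : K ⊆ F.ball) (hu0 : ∀ y ∉ K, u y = 0) : C^∞⟮IH m, H; ℝ⟯ :=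
  ⟨F.extend u, by
    refine contMDiff_of_tsupport fun x hx => ?_
    have hxF := F.tsupport_extend_subset hK hKF hu0 hx
    have h1 : F.extend u =ᶠ[nhds x] u ∘ F.chart := by
      filter_upwards [F.isOpen_domain.mem_nhds hxF] with z hz using F.extend_of_mem u hz
    refine ContMDiffAt.congr_of_eventuallyEq ?_ h1
    have h2 : ContMDiffAt (IH m) 𝓘(ℝ, Euc m) ∞ F.chart x :=
      contMDiffOn_extChartAt.contMDiffAt
        ((isOpen_extChartAt_source (I := IH m) F.center).mem_nhds hxF.1 |> fun h => by
          rwa [extChartAt_source] at h)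
    exact hu.contMDiff.contMDiffAt.comp x h2⟩

end ChartFrame

end Extend

/-! ### Functions of integral zero are divergences. -/

section TopCohomology

open MeasureTheory Set

variable {m : ℕ}

/-- The closed cube with centre `a` and half side `δ`. -/
def closedCube (a : Euc m) (δ : ℝ) : Set (Euc m) := {y | ∀ i, |y i - a i| ≤ δ}

lemma closedCube_eq_image (a : Euc m) {δ : ℝ} (hδ : 0 ≤ δ) :
    closedCube a δ = WithLp.toLp 2 '' Metric.closedBall (fun i => a i) δ := by
  ext y
  constructor
  · intro hy
    refine ⟨fun i => y i, ?_, rfl⟩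
    rw [Metric.mem_closedBall, dist_pi_le_iff hδ]
    exact hy
  · rintro ⟨z, hz, rfl⟩ i
    rw [Metric.mem_closedBall, dist_pi_le_iff hδ] at hz
    exact hz i

lemma isCompact_closedCube (a : Euc m) {δ : ℝ} (hδ : 0 ≤ δ) : IsCompact (closedCube a δ) := by
  rw [closedCube_eq_image a hδ]
  exact (isCompact_closedBall _ _).image (PiLp.continuous_toLp 2 _)

lemma exists_closedCube_subset (a : Euc m) {U : Set (Euc m)} (hU : U ∈ nhds a) :
    ∃ δ, 0 < δ ∧ closedCube a δ ⊆ U := by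
  have h1 : WithLp.toLp 2 ⁻¹' U ∈ nhds (fun i => a i) :=
    (PiLp.continuous_toLp 2 fun _ : Fin m => ℝ).continuousAt hU
  obtain ⟨δ, hδ, h⟩ := Metric.nhds_basis_closedBall.mem_iff.1 h1
  refine ⟨δ, hδ, ?_⟩
  rw [closedCube_eq_image a hδ.le]
  exact image_subset_iff.2 h

lemma CubeSmooth.eq_zero_of_notMem {a : Euc m} {δ : ℝ} {u : Euc m → ℝ} (hu : CubeSmooth a δ u) :
    ∀ y ∉ closedCube a δ, u y = 0 := by
  intro y hy
  simp only [closedCube, Set.mem_ofPred_eq, not_forall, not_le] at hy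
  obtain ⟨i, hi⟩ := hy
  exact hu.eq_zero y i hi.le

variable {H : Type*} [TopologicalSpace H] [ChartedSpace (Euc m) H]
  [IsManifold (IH m) ∞ H] [T2Space H] [CompactSpace H] {X : MultivectorField (IH m) H m}

namespace ChartFrame

variable (F : ChartFrame X)

omit [T2Space H] [CompactSpace H] in
lemma extend_of_notMem (u : Euc m → ℝ) {x : H} (hx : x ∉ F.domain) : F.extend u x = 0 :=
  if_neg hx

omit [CompactSpace H] in
-- For g = ∂_j u the field b u E_j, extended by zero, has divergence b ∂_j u; sums and multiples
-- follow by linearity.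
lemma exists_divMap_eq_of_mem_cubeDerivatives (hX : ∀ x, X.1 x ≠ 0) {a : Euc m} {δ : ℝ}
    (hδ : 0 < δ) (hcube : closedCube a δ ⊆ F.ball) {g : Euc m → ℝ} (hg : g ∈ cubeDerivatives a δ) :
    ∃ Y : VField (IH m) H, ∀ x, divMap hX Y x = bracket X F.coord x * F.extend g x := by
  refine Submodule.span_induction (p := fun g _ => ∃ Y : VField (IH m) H, ∀ x,
    divMap hX Y x = bracket X F.coord x * F.extend g x) ?_ ?_ ?_ ?_ hg
  · rintro _ ⟨u, j, hu, rfl⟩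
    have hK := isCompact_closedCube a hδ.le
    set v := F.smoothExtend hu.contDiff hK hcube hu.eq_zero_of_notMem with hv
    refine ⟨smulField (bracket X F.coord * v) (F.field j), fun x => ?_⟩
    by_cases hx : x ∈ F.domain
    · rw [divMap_apply, divergence_smulField_field hX F j v hx, F.extend_of_mem _ hx]
      congr 1
      obtain ⟨y, hy, rfl⟩ := F.exists_symm_eq hx
      rw [F.act_field_symm y hy j v]
      have h1 : (v ∘ (extChartAt (IH m) F.center).symm) =ᶠ[nhds y] u := by
        filter_upwards [F.isOpen_ball.mem_nhds hy] with z hz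
        change F.extend u _ = _
        rw [F.extend_of_mem u (F.symm_mem_domain hz)]
        exact congrArg u ((extChartAt (IH m) F.center).right_inv (F.ball_subset_target hz))
      rw [h1.fderiv_eq]
      have h2 : F.chart ((extChartAt (IH m) F.center).symm y) = y :=
        (extChartAt (IH m) F.center).right_inv (F.ball_subset_target hy)
      rw [h2]
    · rw [F.extend_of_notMem _ hx, mul_zero]
      refine divergence_eq_zero_of_notMem hX _ _ fun h => hx ?_
      exact F.tsupport_extend_subset hK hcube hu.eq_zero_of_notMem
        (tsupport_mul_subset_right' _ _ h)
  · refine ⟨0, fun x => ?_⟩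
    have h0 : F.extend 0 x = 0 := by
      rw [extend]
      split_ifs <;> rfl
    rw [map_zero, h0, mul_zero]
    rfl
  · rintro g₁ g₂ - - ⟨Y₁, h₁⟩ ⟨Y₂, h₂⟩
    refine ⟨Y₁ + Y₂, fun x => ?_⟩
    have h0 : F.extend (g₁ + g₂) x = F.extend g₁ x + F.extend g₂ x := by
      rw [extend, extend, extend]
      split_ifs <;> simp
    rw [map_add, h0, mul_add, ← h₁, ← h₂]
    rfl
  · rintro c g - ⟨Y, h⟩
    refine ⟨c • Y, fun x => ?_⟩
    have h0 : F.extend (c • g) x = c * F.extend g x := by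
      rw [extend, extend]
      split_ifs <;> simp
    rw [map_smul, h0, mul_left_comm, ← h]
    rfl

end ChartFrame

/-- Locally, the functions with vanishing integral are divergences. -/
lemma exists_nhds_mem_range_divMap (hX : ∀ x, X.1 x ≠ 0) {J : C^∞⟮IH m, H; ℝ⟯ →ₗ[ℝ] ℝ}
    (hJdiv : ∀ Y, J (divMap hX Y) = 0)
    (hJpos : ∀ f : C^∞⟮IH m, H; ℝ⟯, (∀ x, 0 ≤ f x) → ∀ x, f x ≠ 0 → 0 < J f) (p : H) :
    ∃ B : Set H, IsOpen B ∧ p ∈ B ∧ ∀ f : C^∞⟮IH m, H; ℝ⟯, tsupport f ⊆ B → J f = 0 →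
      f ∈ LinearMap.range (divMap hX) := by
  obtain ⟨F, rfl, -⟩ := exists_chartFrame hX p Filter.univ_mem
  set a := F.chart F.center with ha
  obtain ⟨δ, hδ, hcube⟩ := exists_closedCube_subset a
    (F.isOpen_ball.mem_nhds F.center_mem_domain.2)
  have hK := isCompact_closedCube a hδ.le
  have hb := cubeSmooth_cubeBump (a := a) hδ
  -- β represents the one-dimensional remainder of the Poincaré lemma. Up to the sign of b it is
  -- nonnegative and nonzero, so its integral does not vanish.
  set β : C^∞⟮IH m, H; ℝ⟯ := bracket X F.coord *
    F.smoothExtend hb.contDiff hK hcube hb.eq_zero_of_notMem with hβ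
  have hβx : ∀ x, β x = bracket X F.coord x * F.extend (cubeBump a hδ) x := fun _ => rfl
  have hJβ : J β ≠ 0 := by
    have h1 : 0 < J (F.sgn • β) := by
      refine hJpos _ (fun x => ?_) F.center ?_
      · change 0 ≤ F.sgn * β x
        rw [hβx]
        by_cases hx : x ∈ F.domain
        · rw [F.extend_of_mem _ hx, ← mul_assoc]
          exact mul_nonneg (F.sgn_mul_bracket_pos hx).le (cubeBump_nonneg hδ _)
        · rw [F.extend_of_notMem _ hx, mul_zero, mul_zero]
      · change F.sgn * β F.center ≠ 0
        rw [hβx, F.extend_of_mem _ F.center_mem_domain, ← mul_assoc]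
        exact mul_ne_zero (F.sgn_mul_bracket_pos F.center_mem_domain).ne'
          (cubeBump_center_pos hδ).ne'
    rw [map_smul] at h1
    exact right_ne_zero_of_mul h1.ne'
  -- The inequalities are strict because `CubeSmooth` requires vanishing already at distance exactly
  -- δ.
  set S : Set (Euc m) := F.ball ∩ ⋂ i, {y | |y i - a i| < δ} with hS
  have hSo : IsOpen S := by
    refine F.isOpen_ball.inter (isOpen_iInter_of_finite fun i => ?_)
    refine isOpen_lt (Continuous.abs (Continuous.sub ?_ continuous_const)) continuous_const
    exact (EuclideanSpace.proj i : Euc m →L[ℝ] ℝ).continuous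
  refine ⟨F.chart.source ∩ F.chart ⁻¹' S, isOpen_extChartAt_preimage' F.center hSo,
    ⟨F.center_mem_domain.1, F.center_mem_domain.2, mem_iInter.2 fun i => ?_⟩, fun f hf hJf => ?_⟩
  · change |a i - a i| < δ
    simpa using hδ
  have hfF : tsupport f ⊆ F.domain := fun x hx => ⟨(hf hx).1, (hf hx).2.1⟩
  have hwf := F.tsupport_divCoeff_subset f hfF
  set w := F.divCoeff f hfF with hw
  have hcs : CubeSmooth a δ (F.localRep w) := by
    refine ⟨F.contDiff_localRep w (hwf.trans hfF), fun y i hy => F.localRep_eq_zero ?_⟩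
    rintro ⟨x, hx, rfl⟩
    exact absurd (mem_iInter.1 (hf (hwf hx)).2.2 i) (not_lt.2 hy)
  obtain ⟨c, hc⟩ := exists_sub_smul_cubeBump_mem hδ hcs
  obtain ⟨Y, hY⟩ := F.exists_divMap_eq_of_mem_cubeDerivatives hX hδ hcube hc
  -- The Poincaré lemma is applied to f/b, and its conclusion is multiplied by b.
  have hfY : f = c • β + divMap hX Y := by
    ext x
    change f x = c * β x + divMap hX Y x
    rw [hY, hβx]
    by_cases hx : x ∈ F.domain
    · rw [F.extend_of_mem _ hx, F.extend_of_mem _ hx]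
      have h1 : F.localRep w (F.chart x) = f x / bracket X F.coord x := by
        rw [F.localRep_of_mem _ hx.2, F.chart.left_inv hx.1]
        rfl
      have h2 := F.bracket_ne_zero hx
      rw [Pi.sub_apply, h1, Pi.smul_apply, smul_eq_mul]
      field_simp
      ring
    · rw [F.extend_of_notMem _ hx, F.extend_of_notMem _ hx,
        image_eq_zero_of_notMem_tsupport fun h => hx (hfF h)]
      ring
  have hc0 : c = 0 := by
    rw [hfY, map_add, map_smul, hJdiv, add_zero] at hJf
    exact (mul_eq_zero.1 hJf).resolve_right hJβ
  exact ⟨Y, by rw [hfY, hc0, zero_smul, zero_add]⟩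

omit [CompactSpace H] in
lemma exists_integral_eq_one {J : C^∞⟮IH m, H; ℝ⟯ →ₗ[ℝ] ℝ}
    (hJpos : ∀ f : C^∞⟮IH m, H; ℝ⟯, (∀ x, 0 ≤ f x) → ∀ x, f x ≠ 0 → 0 < J f) {B : Set H}
    (hB : IsOpen B) {p : H} (hp : p ∈ B) :
    ∃ f : C^∞⟮IH m, H; ℝ⟯, tsupport f ⊆ B ∧ J f = 1 := by
  obtain ⟨ρ, hρ⟩ := (SmoothBumpFunction.nhds_basis_tsupport (I := IH m) p).mem_iff.1 (hB.mem_nhds hp)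
  set f : C^∞⟮IH m, H; ℝ⟯ := ⟨ρ, ρ.contMDiff⟩ with hf
  have hpos : 0 < J f := hJpos f (fun x => ρ.nonneg) p (by
    change ρ p ≠ 0
    rw [ρ.eq_one]
    exact one_ne_zero)
  refine ⟨(J f)⁻¹ • f, (closure_mono ?_).trans hρ.2, ?_⟩
  · intro x hx h0
    apply hx
    change (J f)⁻¹ * ρ x = 0
    rw [show ρ x = 0 from h0, mul_zero]
  · rw [map_smul]
    exact inv_mul_cancel₀ hpos.ne'

/-- On a compact connected manifold, the functions with vanishing integral are the
divergences. -/
lemma exists_integral_eq_zero_iff [ConnectedSpace H] (hX : ∀ x, X.1 x ≠ 0) :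
    ∃ J : C^∞⟮IH m, H; ℝ⟯ →ₗ[ℝ] ℝ, J 1 ≠ 0 ∧
      ∀ f, J f = 0 ↔ f ∈ LinearMap.range (divMap hX) := by
  obtain ⟨J, hJF, hJpos⟩ := exists_integral hX
  have hJdiv := integral_divMap hX hJF
  obtain ⟨p₀⟩ : Nonempty H := inferInstance
  refine ⟨J, (hJpos 1 (fun _ => zero_le_one) p₀ one_ne_zero).ne', fun f => ⟨fun hf => ?_, ?_⟩⟩
  swap
  · rintro ⟨Y, rfl⟩
    exact hJdiv Y
  have hloc := exists_nhds_mem_range_divMap hX hJdiv hJpos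
  obtain ⟨B₀, hB₀, hp₀, hR₀⟩ := hloc p₀
  obtain ⟨f₀, hf₀, hJ₀⟩ := exists_integral_eq_one hJpos hB₀ hp₀
  have hsub : ∀ (f g : C^∞⟮IH m, H; ℝ⟯) (c : ℝ) (B : Set H), tsupport f ⊆ B → tsupport g ⊆ B →
      tsupport (f - c • g : C^∞⟮IH m, H; ℝ⟯) ⊆ B := by
    intro f g c B hf hg x hx
    by_contra hxB
    have h1 := notMem_tsupport_iff_eventuallyEq.1 fun h => hxB (hf h)
    have h2 := notMem_tsupport_iff_eventuallyEq.1 fun h => hxB (hg h)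
    refine notMem_tsupport_iff_eventuallyEq.2 ?_ hx
    filter_upwards [h1, h2] with z hz1 hz2
    change f z - c * g z = 0
    rw [hz1, hz2]
    simp
  -- The points near which every function agrees, modulo divergences, with its integral times the
  -- fixed f₀.
  set G : Set H := {p | ∃ B : Set H, IsOpen B ∧ p ∈ B ∧ ∀ f : C^∞⟮IH m, H; ℝ⟯,
    tsupport f ⊆ B → f - J f • f₀ ∈ LinearMap.range (divMap hX)} with hG
  have hGo : IsOpen G := by
    rw [isOpen_iff_mem_nhds]
    rintro p ⟨B, hB, hpB, h⟩
    exact Filter.mem_of_superset (hB.mem_nhds hpB) fun q hq => ⟨B, hB, hq, h⟩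
  have hGc : IsClosed G := by
    refine isClosed_of_closure_subset fun p hp => ?_
    obtain ⟨B, hB, hpB, hR⟩ := hloc p
    obtain ⟨q, hqB, C, hC, hqC, hqR⟩ := mem_closure_iff.1 hp B hB hpB
    -- A function g of integral one in the overlap transfers the property: f is compared with J(f) g
    -- inside B, and g with f₀ inside C.
    obtain ⟨g, hg, hJg⟩ := exists_integral_eq_one hJpos (hB.inter hC) ⟨hqB, hqC⟩
    refine ⟨B, hB, hpB, fun f hf => ?_⟩
    have h1 : f - J f • g ∈ LinearMap.range (divMap hX) := by
      refine hR _ (hsub _ _ _ _ hf (hg.trans inter_subset_left)) ?_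
      rw [map_sub, map_smul, hJg, smul_eq_mul, mul_one, sub_self]
    have h2 := hqR g (hg.trans inter_subset_right)
    rw [hJg, one_smul] at h2
    have h3 := Submodule.add_mem _ h1 (Submodule.smul_mem _ (J f) h2)
    rwa [smul_sub, sub_add_sub_cancel] at h3
  have hGu : G = univ := IsClopen.eq_univ ⟨hGc, hGo⟩ ⟨p₀, B₀, hB₀, hp₀, fun f hf => by
    refine hR₀ _ (hsub _ _ _ _ hf hf₀) ?_
    rw [map_sub, map_smul, hJ₀, smul_eq_mul, mul_one, sub_self]⟩
  have hGall : ∀ p, p ∈ G := fun p => hGu ▸ mem_univ p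
  choose B hB hpB hR using hGall
  obtain ⟨t, ρ, hρ, -, hρ1⟩ := exists_finite_partition (m := m) B hB hpB
  -- Summing the local statements over a partition of unity gives f - J(f) f₀, which is f itself.
  have h1 : ∑ i : t, (ρ i * f - J (ρ i * f) • f₀) ∈ LinearMap.range (divMap hX) :=
    Submodule.sum_mem _ fun i _ =>
      hR i _ ((tsupport_mul_subset_left' _ _).trans (hρ i))
  rwa [Finset.sum_sub_distrib, ← Finset.sum_smul, ← map_sum, ← Finset.sum_mul, hρ1, one_mul, hf,
    zero_smul, sub_zero] at h1

end TopCohomology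

/-! ### The chart of the interval. -/

section IntervalChart

/-- The inverse of the inclusion of the interval in `ℝ`, extended to all of `ℝ`. -/
def toInterval : ℝ → Interval := (extChartAt 𝓘(ℝ, ℝ) zeroPt).symm

lemma extChartAt_interval_target (r : Interval) :
    (extChartAt 𝓘(ℝ, ℝ) r).target = Set.Ioo (-1) 1 := by
  have h1 : (extChartAt 𝓘(ℝ, ℝ) r).source = Set.univ := by
    rw [extChartAt_source, TopologicalSpace.Opens.chartAt_eq,
      OpenPartialHomeomorph.subtypeRestr_source]
    rfl
  rw [← PartialEquiv.image_source_eq_target, h1, Set.image_univ]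
  exact Subtype.range_val

lemma toInterval_coe (r : Interval) : toInterval r = r := by
  have h1 : r ∈ (extChartAt 𝓘(ℝ, ℝ) zeroPt).source := by
    rw [extChartAt_source, TopologicalSpace.Opens.chartAt_eq,
      OpenPartialHomeomorph.subtypeRestr_source]
    trivial
  exact (extChartAt 𝓘(ℝ, ℝ) zeroPt).left_inv h1

lemma coe_toInterval {s : ℝ} (hs : s ∈ Set.Ioo (-1 : ℝ) 1) : (toInterval s : ℝ) = s :=
  congrArg Subtype.val (toInterval_coe ⟨s, hs⟩)

lemma contMDiffOn_toInterval : ContMDiffOn 𝓘(ℝ, ℝ) 𝓘(ℝ, ℝ) ∞ toInterval (Set.Ioo (-1) 1) := by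
  rw [← extChartAt_interval_target zeroPt]
  exact contMDiffOn_extChartAt_symm _

lemma toInterval_zero : toInterval 0 = zeroPt := toInterval_coe zeroPt

lemma mfderiv_val_interval (r : Interval) :
    mfderiv 𝓘(ℝ, ℝ) 𝓘(ℝ, ℝ) (Subtype.val : Interval → ℝ) r = ContinuousLinearMap.id ℝ ℝ := by
  refine HasMFDerivAt.mfderiv ⟨continuous_subtype_val.continuousAt, ?_⟩
  have h2 : writtenInExtChartAt 𝓘(ℝ, ℝ) 𝓘(ℝ, ℝ) r (Subtype.val : Interval → ℝ)
      =ᶠ[nhds (r : ℝ)] id := by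
    filter_upwards [isOpen_Ioo.mem_nhds r.2] with s hs
    exact coe_toInterval hs
  exact ((hasFDerivAt_id (𝕜 := ℝ) (r : ℝ)).congr_of_eventuallyEq h2).hasFDerivWithinAt

end IntervalChart

/-! ### Functions and vector fields on the collar. -/

section Collar

variable {m : ℕ} {H : Type*} [TopologicalSpace H] [ChartedSpace (Euc m) H]

/-- A function on `H`, as a function on the collar. -/
def lift (f : C^∞⟮IH m, H; ℝ⟯) : C^∞⟮IU m, Collar H; ℝ⟯ :=
  ⟨fun p => f p.2, f.contMDiff.comp contMDiff_snd⟩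

lemma lift_apply (f : C^∞⟮IH m, H; ℝ⟯) (p : Collar H) : lift f p = f p.2 := rfl

/-- The coordinate `r` on the collar. -/
def coordR : C^∞⟮IU m, Collar H; ℝ⟯ :=
  ⟨fun p => p.1, contMDiff_subtype_val.comp contMDiff_fst⟩

lemma coordR_apply (p : Collar H) : (coordR : C^∞⟮IU m, Collar H; ℝ⟯) p = p.1 := rfl

/-- The restriction of a function on the collar to a level. -/
def slice (f : C^∞⟮IU m, Collar H; ℝ⟯) (r : Interval) : C^∞⟮IH m, H; ℝ⟯ :=
  ⟨fun x => f (r, x), f.contMDiff.comp (contMDiff_const.prodMk contMDiff_id)⟩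

lemma differential_lift (f : C^∞⟮IH m, H; ℝ⟯) (p : Collar H)
    (v : TangentSpace (IU m) p) :
    differential (IU m) (lift f) p v = differential (IH m) f p.2 (show ℝ × Euc m from v).2 := by
  have h1 := mfderiv_comp (I := IU m) (I' := IH m) (I'' := 𝓘(ℝ, ℝ)) p (g := f)
    (f := (Prod.snd : Collar H → H))
    (mdifferentiableAt_smooth f p.2) mdifferentiableAt_snd
  rw [mfderiv_snd] at h1
  exact DFunLike.congr_fun h1 v

lemma differential_coordR (p : Collar H) (v : TangentSpace (IU m) p) :
    differential (IU m) (coordR : C^∞⟮IU m, Collar H; ℝ⟯) p v = (show ℝ × Euc m from v).1 := by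
  have h1 := mfderiv_comp (I := IU m) (I' := 𝓘(ℝ, ℝ)) (I'' := 𝓘(ℝ, ℝ)) p
    (g := (Subtype.val : Interval → ℝ)) (f := (Prod.fst : Collar H → Interval))
    ((contMDiff_subtype_val (n := ∞) p.1).mdifferentiableAt (by simp)) mdifferentiableAt_fst
  rw [mfderiv_fst, mfderiv_val_interval] at h1
  exact DFunLike.congr_fun h1 v

lemma differential_slice (f : C^∞⟮IU m, Collar H; ℝ⟯) (r : Interval) (x : H)
    (v : TangentSpace (IH m) x) :
    differential (IH m) (slice f r) x v =
      differential (IU m) f (r, x) (levelIncl r x v) := by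
  have h0 : MDifferentiableAt (IH m) (IU m) (fun y : H => ((r, y) : Collar H)) x :=
    mdifferentiableAt_const.prodMk mdifferentiableAt_id
  have h1 := mfderiv_comp (I := IH m) (I' := IU m) (I'' := 𝓘(ℝ, ℝ)) x
    (g := f) (f := fun y : H => ((r, y) : Collar H)) (mdifferentiableAt_smooth f (r, x)) h0
  have h2 : mfderiv (IH m) (IU m) (fun y : H => ((r, y) : Collar H)) x = levelIncl r x :=
    mfderiv_prod_right
  rw [h2] at h1
  exact DFunLike.congr_fun h1 v

variable [IsManifold (IH m) ∞ H]

/-- The coordinate field `∂/∂r` as a vector field. -/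
def fieldR : VField (IU m) (Collar H) :=
  ⟨partialR, by
    have : IsManifold (IH m) 1 H := IsManifold.of_le (n := ∞) (by simp)
    -- On the interval, ∂/∂r is the pullback of the constant field 1 by the inclusion in ℝ, whose
    -- derivative is the identity.
    have h1 : ContMDiff 𝓘(ℝ, ℝ) (𝓘(ℝ, ℝ)).tangent ∞
        (fun r : Interval => (⟨r, (1 : ℝ)⟩ : TangentBundle 𝓘(ℝ, ℝ) Interval)) := by
      have hinv : ∀ r : Interval, (mfderiv 𝓘(ℝ, ℝ) 𝓘(ℝ, ℝ) (Subtype.val : Interval → ℝ) r).IsInvertible :=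
        fun r => by
          rw [mfderiv_val_interval]
          exact ⟨ContinuousLinearEquiv.refl ℝ ℝ, rfl⟩
      have h := ContMDiff.mpullback_vectorField (I := 𝓘(ℝ, ℝ)) (I' := 𝓘(ℝ, ℝ)) (m := ∞) (n := ∞)
        (f := (Subtype.val : Interval → ℝ)) (V := fun _ : ℝ => (1 : ℝ))
        ((contMDiff_vectorSpace_iff_contDiff (V := fun _ : ℝ => (1 : ℝ))).2 contDiff_const)
        contMDiff_subtype_val hinv (by simp)
      have hone : ∀ r, VectorField.mpullback 𝓘(ℝ, ℝ) 𝓘(ℝ, ℝ) (Subtype.val : Interval → ℝ)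
          (fun _ : ℝ => (1 : ℝ)) r = (1 : ℝ) := fun r =>
        (congrArg (fun L : ℝ →L[ℝ] ℝ => L.inverse (1 : ℝ)) (mfderiv_val_interval r)).trans
          (by simp)
      exact (funext fun r => congrArg (fun v : ℝ => (⟨r, v⟩ : TangentBundle 𝓘(ℝ, ℝ) Interval))
        (hone r)) ▸ h
    have h2 : ContMDiff (IU m) ((𝓘(ℝ, ℝ)).tangent.prod (IH m).tangent) ∞
        (fun p : Collar H => ((⟨p.1, (1 : ℝ)⟩ : TangentBundle 𝓘(ℝ, ℝ) Interval),
          (⟨p.2, (0 : Euc m)⟩ : TangentBundle (IH m) H))) :=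
      (h1.comp contMDiff_fst).prodMk
        ((Bundle.contMDiff_zeroSection (IB := IH m) (n := ∞) ℝ
          (TangentSpace (IH m) : H → Type _)).comp contMDiff_snd)
    exact contMDiff_equivTangentBundleProd_symm.comp h2⟩

/-- A vector field on `H`, as a vector field on the collar tangent to the levels. -/
def liftField (Y : VField (IH m) H) : VField (IU m) (Collar H) :=
  ⟨fun p => levelIncl p.1 p.2 (Y p.2), by
    have : IsManifold (IH m) 1 H := IsManifold.of_le (n := ∞) (by simp)
    have h2 : ContMDiff (IU m) ((𝓘(ℝ, ℝ)).tangent.prod (IH m).tangent) ∞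
        (fun p : Collar H => ((⟨p.1, (0 : ℝ)⟩ : TangentBundle 𝓘(ℝ, ℝ) Interval),
          (⟨p.2, Y p.2⟩ : TangentBundle (IH m) H))) :=
      ((Bundle.contMDiff_zeroSection (IB := 𝓘(ℝ, ℝ)) (n := ∞) ℝ
          (TangentSpace 𝓘(ℝ, ℝ) : Interval → Type _)).comp contMDiff_fst).prodMk
        (Y.contMDiff.comp contMDiff_snd)
    exact contMDiff_equivTangentBundleProd_symm.comp h2⟩

/-- The part of a vector field tangent to a level, as a vector field on `H`. -/
def horizontalField (V : VField (IU m) (Collar H)) (r : Interval) : VField (IH m) H :=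
  ⟨horizontal V r, by
    have : IsManifold (IH m) 1 H := IsManifold.of_le (n := ∞) (by simp)
    have h1 : ContMDiff (IH m) (IU m).tangent ∞ (fun x : H =>
        (⟨(r, x), V (r, x)⟩ : TangentBundle (IU m) (Collar H))) :=
      V.contMDiff.comp (contMDiff_const.prodMk contMDiff_id)
    exact contMDiff_snd.comp (contMDiff_equivTangentBundleProd.comp h1)⟩

/-- The radial coefficient of a vector field, as a smooth function. -/
def radialCoeff (V : VField (IU m) (Collar H)) : C^∞⟮IU m, Collar H; ℝ⟯ := act V coordR

lemma radialCoeff_apply (V : VField (IU m) (Collar H)) (p : Collar H) :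
    radialCoeff V p = radial V p := differential_coordR p (V p)

lemma act_lift (V : VField (IU m) (Collar H)) (f : C^∞⟮IH m, H; ℝ⟯) (r : Interval) (x : H) :
    act V (lift f) (r, x) = act (horizontalField V r) f x := differential_lift f (r, x) (V (r, x))

lemma act_fieldR_lift (f : C^∞⟮IH m, H; ℝ⟯) (p : Collar H) : act fieldR (lift f) p = 0 :=
  (differential_lift f p _).trans (map_zero (differential (IH m) f p.2))

lemma act_fieldR_coordR (p : Collar H) :
    act fieldR (coordR : C^∞⟮IU m, Collar H; ℝ⟯) p = 1 := differential_coordR p _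

lemma act_liftField_coordR (Y : VField (IH m) H) (p : Collar H) :
    act (liftField Y) coordR p = 0 := differential_coordR p _

lemma act_liftField (Y : VField (IH m) H) (f : C^∞⟮IU m, Collar H; ℝ⟯) (r : Interval) (x : H) :
    act (liftField Y) f (r, x) = act Y (slice f r) x := (differential_slice f r x (Y x)).symm

lemma act_liftField_lift (Y : VField (IH m) H) (f : C^∞⟮IH m, H; ℝ⟯) (p : Collar H) :
    act (liftField Y) (lift f) p = act Y f p.2 := differential_lift f p _

/-- Along `∂/∂r`, a function on the collar is differentiated in the variable `r`. -/
lemma hasDerivAt_comp_toInterval (f : C^∞⟮IU m, Collar H; ℝ⟯) (x : H) {s : ℝ}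
    (hs : s ∈ Set.Ioo (-1 : ℝ) 1) :
    HasDerivAt (fun s => f (toInterval s, x)) (act fieldR f (toInterval s, x)) s := by
  have hd : MDifferentiableAt 𝓘(ℝ, ℝ) 𝓘(ℝ, ℝ) toInterval s :=
    ((contMDiffOn_toInterval).contMDiffAt (isOpen_Ioo.mem_nhds hs)).mdifferentiableAt (by simp)
  have h1 : HasMFDerivAt 𝓘(ℝ, ℝ) 𝓘(ℝ, ℝ) (Subtype.val ∘ toInterval) s
      ((mfderiv 𝓘(ℝ, ℝ) 𝓘(ℝ, ℝ) (Subtype.val : Interval → ℝ) (toInterval s)).comp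
        (mfderiv 𝓘(ℝ, ℝ) 𝓘(ℝ, ℝ) toInterval s)) :=
    (((contMDiff_subtype_val (n := ∞) (toInterval s)).mdifferentiableAt
      (by simp)).hasMFDerivAt).comp s hd.hasMFDerivAt
  have h2 : (Subtype.val ∘ toInterval) =ᶠ[nhds s] id := by
    filter_upwards [isOpen_Ioo.mem_nhds hs] with t ht
    exact coe_toInterval ht
  set L : ℝ →L[ℝ] ℝ := mfderiv 𝓘(ℝ, ℝ) 𝓘(ℝ, ℝ) toInterval s with hL
  have h3 := h1.mfderiv
  rw [h2.mfderiv_eq, mfderiv_id, mfderiv_val_interval] at h3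
  have h3' : ContinuousLinearMap.id ℝ ℝ = (ContinuousLinearMap.id ℝ ℝ).comp L := h3
  have h4 : L 1 = 1 := (DFunLike.congr_fun h3' 1).symm
  have h5 : HasMFDerivAt 𝓘(ℝ, ℝ) (IU m) (fun s => ((toInterval s, x) : Collar H)) s
      ((mfderiv 𝓘(ℝ, ℝ) 𝓘(ℝ, ℝ) toInterval s).prod 0) :=
    hd.hasMFDerivAt.prodMk (hasMFDerivAt_const x s)
  have h6 := ((mdifferentiableAt_smooth f (toInterval s, x)).hasMFDerivAt.comp s h5)
  set D : ℝ × Euc m →L[ℝ] ℝ := differential (IU m) f (toInterval s, x) with hD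
  have h7 : HasFDerivAt (fun s => f (toInterval s, x)) (D.comp (L.prod (0 : ℝ →L[ℝ] Euc m))) s :=
    h6.hasFDerivAt
  have h8 : D.comp (L.prod (0 : ℝ →L[ℝ] Euc m)) 1 = D ((1 : ℝ), (0 : Euc m)) := by
    rw [ContinuousLinearMap.comp_apply, ContinuousLinearMap.prod_apply, h4]
    rfl
  have h9 := h7.hasDerivAt
  rw [h8] at h9
  exact h9

end Collar

/-! ### Hadamard's lemma and the equation A - r ∂A/∂r = g. -/

section RadialMean

open MeasureTheory Set

variable {m : ℕ} {H : Type*} [TopologicalSpace H] [ChartedSpace (Euc m) H]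
  [IsManifold (IH m) ∞ H]

/-- The mean of a function over the segments from `0` to `r` on the lines `(-1, 1) × {x}`. -/
def radialMean (f : C^∞⟮IU m, Collar H; ℝ⟯) : C^∞⟮IU m, Collar H; ℝ⟯ :=
  ⟨fun p => ∫ t in (0 : ℝ)..1, f (toInterval (t * p.1), p.2), fun p₀ => by
    set φ := extChartAt (IH m) p₀.2 with hφ
    -- For |r| < ρ the product t r stays in (-1, 1) for all t with |t| ρ < 1, an open neighbourhood
    -- of [0, 1]; this is the room that `contDiffOn_integral_param` needs.
    obtain ⟨ρ, hρ0, hρ1⟩ := exists_between (abs_lt.2 p₀.1.2)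
    have hρ : 0 < ρ := (abs_nonneg _).trans_lt hρ0
    have hF : ContDiffOn ℝ ∞ (fun q : ℝ × Euc m => f (toInterval q.1, φ.symm q.2))
        (Ioo (-1) 1 ×ˢ φ.target) := by
      have h := contDiffOn_comp_extChartAt_symm f p₀
      rw [extChartAt_prod, PartialEquiv.prod_target, extChartAt_interval_target] at h
      exact h
    have hint : ContDiffOn ℝ ∞ (fun q : ℝ × Euc m =>
        ∫ t in (0 : ℝ)..1, f (toInterval (t * q.1), φ.symm q.2)) (Ioo (-ρ) ρ ×ˢ φ.target) := by
      refine contDiffOn_integral_param (f := fun z : (ℝ × Euc m) × ℝ =>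
        f (toInterval (z.2 * z.1.1), φ.symm z.1.2)) (t := {t : ℝ | |t| * ρ < 1})
        (isOpen_Ioo.prod (isOpen_extChartAt_target p₀.2))
        (isOpen_lt (continuous_abs.mul continuous_const) continuous_const) ?_ ?_
      · intro t ht
        change |t| * ρ < 1
        rw [abs_of_nonneg ht.1]
        nlinarith [ht.1, ht.2]
      · refine hF.comp (t := Ioo (-1) 1 ×ˢ φ.target)
          (f := fun z : (ℝ × Euc m) × ℝ => (z.2 * z.1.1, z.1.2)) ?_ ?_
        · exact ((contDiff_snd.mul (contDiff_fst.comp contDiff_fst)).prodMk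
            (contDiff_snd.comp contDiff_fst)).contDiffOn
        · rintro ⟨⟨r, y⟩, t⟩ ⟨⟨hr, hy⟩, ht⟩
          refine ⟨?_, hy⟩
          have h1 : |t| * ρ < 1 := ht
          have h2 : |r| < ρ := abs_lt.2 hr
          refine abs_lt.1 ?_
          change |t * r| < 1
          rw [abs_mul]
          nlinarith [abs_nonneg t, abs_nonneg r]
    have hmem : extChartAt (IU m) p₀ p₀ ∈ Ioo (-ρ) ρ ×ˢ φ.target :=
      ⟨abs_lt.1 hρ0, mem_extChartAt_target (I := IH m) p₀.2⟩
    have h1 : (fun p : Collar H => ∫ t in (0 : ℝ)..1, f (toInterval (t * p.1), p.2)) =ᶠ[nhds p₀]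
        (fun q : ℝ × Euc m => ∫ t in (0 : ℝ)..1, f (toInterval (t * q.1), φ.symm q.2)) ∘
          extChartAt (IU m) p₀ := by
      filter_upwards [continuousAt_snd.preimage_mem_nhds
        (extChartAt_source_mem_nhds (I := IH m) p₀.2)] with p hp
      change _ = ∫ t in (0 : ℝ)..1, f (toInterval (t * p.1), φ.symm (φ p.2))
      rw [φ.left_inv hp]
    refine ContMDiffAt.congr_of_eventuallyEq ?_ h1
    have h2 : ContDiffAt ℝ ∞ (fun q : ℝ × Euc m =>
        ∫ t in (0 : ℝ)..1, f (toInterval (t * q.1), φ.symm q.2)) (extChartAt (IU m) p₀ p₀) :=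
      hint.contDiffAt ((isOpen_Ioo.prod (isOpen_extChartAt_target p₀.2)).mem_nhds hmem)
    exact h2.contMDiffAt.comp p₀ contMDiffAt_extChartAt⟩

lemma radialMean_apply (f : C^∞⟮IU m, Collar H; ℝ⟯) (p : Collar H) :
    radialMean f p = ∫ t in (0 : ℝ)..1, f (toInterval (t * p.1), p.2) := rfl

lemma mul_radialMean (f : C^∞⟮IU m, Collar H; ℝ⟯) {s : ℝ} (hs : s ∈ Ioo (-1 : ℝ) 1) (x : H) :
    s * radialMean f (toInterval s, x) = ∫ u in (0 : ℝ)..s, f (toInterval u, x) := by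
  rw [radialMean_apply]
  change s * ∫ t in (0 : ℝ)..1, f (toInterval (t * (toInterval s : ℝ)), x) = _
  rw [coe_toInterval hs]
  have h := intervalIntegral.smul_integral_comp_mul_right (a := 0) (b := 1)
    (fun u => f (toInterval u, x)) s
  rw [zero_mul, one_mul] at h
  exact h

lemma continuousOn_comp_toInterval (f : C^∞⟮IU m, Collar H; ℝ⟯) (x : H) :
    ContinuousOn (fun u => f (toInterval u, x)) (Ioo (-1) 1) :=
  fun _ hu => (hasDerivAt_comp_toInterval f x hu).continuousAt.continuousWithinAt

lemma uIcc_zero_subset {s : ℝ} (hs : s ∈ Ioo (-1 : ℝ) 1) : uIcc 0 s ⊆ Ioo (-1 : ℝ) 1 :=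
  ordConnected_Ioo.uIcc_subset ⟨by norm_num, by norm_num⟩ hs

/-- Hadamard's lemma in the variable `r`. -/
lemma eq_add_mul_radialMean (f : C^∞⟮IU m, Collar H; ℝ⟯) (r : Interval) (x : H) :
    f (r, x) = f (zeroPt, x) + r * radialMean (act fieldR f) (r, x) := by
  have h := mul_radialMean (act fieldR f) r.2 x
  rw [intervalIntegral.integral_eq_sub_of_hasDerivAt
    (f := fun u => f (toInterval u, x))
    (fun u hu => hasDerivAt_comp_toInterval f x (uIcc_zero_subset r.2 hu))
    (((continuousOn_comp_toInterval (act fieldR f) x).mono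
      (uIcc_zero_subset r.2)).intervalIntegrable), toInterval_coe, toInterval_zero] at h
  rw [h]
  ring

lemma act_fieldR_coordR_mul (f : C^∞⟮IU m, Collar H; ℝ⟯) (p : Collar H) :
    act fieldR (coordR * f) p = p.1 * act fieldR f p + f p := by
  rw [act_mul, act_fieldR_coordR, mul_one]
  rfl

/-- The derivative of the antiderivative in the variable `r`. -/
lemma act_fieldR_coordR_mul_radialMean (f : C^∞⟮IU m, Collar H; ℝ⟯) (p : Collar H) :
    act fieldR (coordR * radialMean f) p = f p := by
  obtain ⟨r, x⟩ := p
  have h1 := hasDerivAt_comp_toInterval (coordR * radialMean f) x r.2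
  have h2 : HasDerivAt (fun s => ∫ u in (0 : ℝ)..s, f (toInterval u, x)) (f (toInterval r, x)) r :=
    intervalIntegral.integral_hasDerivAt_right
      ((continuousOn_comp_toInterval f x).mono (uIcc_zero_subset r.2)).intervalIntegrable
      ((continuousOn_comp_toInterval f x).stronglyMeasurableAtFilter isOpen_Ioo _ r.2)
      (hasDerivAt_comp_toInterval f x r.2).continuousAt
  have h3 : (fun s => (coordR * radialMean f : C^∞⟮IU m, Collar H; ℝ⟯) (toInterval s, x))
      =ᶠ[nhds (r : ℝ)] fun s => ∫ u in (0 : ℝ)..s, f (toInterval u, x) := by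
    filter_upwards [isOpen_Ioo.mem_nhds r.2] with s hs
    rw [← mul_radialMean f hs]
    change (toInterval s : ℝ) * _ = _
    rw [coe_toInterval hs]
  have h4 := h1.unique (h2.congr_of_eventuallyEq h3)
  rwa [toInterval_coe] at h4

/-- Where r ≠ 0 one divides; at r = 0 one differentiates r f = 0 in r. -/
lemma eq_zero_of_coordR_mul_eq_zero {f : C^∞⟮IU m, Collar H; ℝ⟯} (h : coordR * f = 0) : f = 0 := by
  ext p
  have h1 : p.1 * f p = 0 := DFunLike.congr_fun h p
  rcases mul_eq_zero.1 h1 with h2 | h2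
  · have h3 := act_fieldR_coordR_mul f p
    have h4 : act fieldR (0 : C^∞⟮IU m, Collar H; ℝ⟯) p = 0 :=
      DFunLike.congr_fun (actDerivation fieldR).map_zero p
    rw [h, h4, h2, zero_mul, zero_add] at h3
    exact h3.symm
  · exact h2

/-- The equation `A - r ∂A/∂r = g` is solvable when `∂g/∂r` vanishes for `r = 0`. -/
lemma exists_sub_mul_act_fieldR_eq (g : C^∞⟮IU m, Collar H; ℝ⟯)
    (hg : ∀ x, act fieldR g (zeroPt, x) = 0) :
    ∃ A : C^∞⟮IU m, Collar H; ℝ⟯, ∀ p, A p - p.1 * act fieldR A p = g p := by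
  set K := radialMean (act fieldR g) with hK
  set L := radialMean (act fieldR K) with hL
  have hK0 : ∀ x, K (zeroPt, x) = 0 := by
    intro x
    rw [hK, radialMean_apply]
    change ∫ t in (0 : ℝ)..1, act fieldR g (toInterval (t * 0), x) = 0
    simp only [mul_zero, toInterval_zero, hg, intervalIntegral.integral_zero]
  -- Hadamard's lemma, applied twice, gives g = g|₀ + r² L, as the linear term is zero by
  -- hypothesis. The witness is g|₀ - r ∫₀^r L, the integral being r times the mean of L.
  refine ⟨lift (slice g zeroPt) - coordR * (coordR * radialMean L), ?_⟩
  rintro ⟨r, x⟩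
  have h1 : act fieldR (lift (slice g zeroPt) - coordR * (coordR * radialMean L)) (r, x) =
      act fieldR (lift (slice g zeroPt)) (r, x) -
        act fieldR (coordR * (coordR * radialMean L)) (r, x) :=
    DFunLike.congr_fun ((actDerivation fieldR).map_sub _ _) (r, x)
  rw [h1, act_fieldR_lift, act_fieldR_coordR_mul, act_fieldR_coordR_mul_radialMean,
    eq_add_mul_radialMean g r x, ← hK, eq_add_mul_radialMean K r x, hK0, ← hL]
  change g (zeroPt, x) - r * (r * radialMean L (r, x)) -
    r * (0 - (r * L (r, x) + r * radialMean L (r, x))) = _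
  ring

/-- The solutions of `A - r ∂A/∂r = 0` are the functions `r k` with `k` a function on `H`. -/
lemma sub_mul_act_fieldR_eq_zero_iff (A : C^∞⟮IU m, Collar H; ℝ⟯) :
    (∀ p, A p - p.1 * act fieldR A p = 0) ↔
      ∃ k : C^∞⟮IH m, H; ℝ⟯, ∀ (r : Interval) (x : H), A (r, x) = r * k x := by
  constructor
  · intro h
    set B := radialMean (act fieldR A) with hB
    have hA : A = coordR * B := by
      ext ⟨r, x⟩
      have h0 : A (zeroPt, x) = 0 := by
        have h1 : A (zeroPt, x) - 0 * _ = 0 := h (zeroPt, x)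
        rwa [zero_mul, sub_zero] at h1
      rw [eq_add_mul_radialMean A r x, h0, zero_add]
      rfl
    -- With A = r B the equation reads r² ∂B/∂r = 0.
    have hB0 : act fieldR B = 0 := by
      refine eq_zero_of_coordR_mul_eq_zero (eq_zero_of_coordR_mul_eq_zero ?_)
      ext p
      have h1 := h p
      have h2 : A p = p.1 * B p := DFunLike.congr_fun hA p
      rw [h2, hA, act_fieldR_coordR_mul] at h1
      change p.1 * (p.1 * act fieldR B p) = 0
      linarith
    refine ⟨slice B zeroPt, fun r x => ?_⟩
    have h1 : A (r, x) = r * B (r, x) := DFunLike.congr_fun hA (r, x)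
    have h2 : radialMean (act fieldR B) (r, x) = 0 := by
      rw [hB0, radialMean_apply]
      exact intervalIntegral.integral_zero
    rw [h1, eq_add_mul_radialMean B r x, h2, mul_zero, add_zero]
    rfl
  · rintro ⟨k, hk⟩ ⟨r, x⟩
    have hA : A = coordR * lift k := by
      ext ⟨r, x⟩
      exact hk r x
    rw [hk, hA, act_fieldR_coordR_mul, act_fieldR_lift, lift_apply]
    ring

end RadialMean

/-! ### The function A - r ∂A/∂r - r div V_H and its range. -/

section ModularCoeff

variable {m : ℕ} {H : Type*} [TopologicalSpace H] [ChartedSpace (Euc m) H]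
  [IsManifold (IH m) ∞ H] [T2Space H] {X : MultivectorField (IH m) H m}

/-- Expressing the divergence on the levels by derivations of the collar makes it jointly smooth in
r and x. -/
lemma divergence_horizontalField (hX : ∀ x, X.1 x ≠ 0) (F : ChartFrame X)
    (V : VField (IU m) (Collar H)) {p : Collar H} (hp : p.2 ∈ F.domain) :
    divergence X (horizontalField V p.1) p.2 =
      (∑ i, act (liftField (F.field i)) (act V (lift (F.coord i))) p) -
        act V (lift (bracket X F.coord)) p / bracket X F.coord p.2 := by
  obtain ⟨r, x⟩ := p
  rw [divergence_frame hX F _ hp, act_lift]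
  congr 1
  refine Finset.sum_congr rfl fun i _ => ?_
  rw [act_liftField]
  congr 2
  ext y
  exact (act_lift V (F.coord i) r y).symm

/-- The divergence of the horizontal part of a vector field, on each level. -/
def levelDivergence (hX : ∀ x, X.1 x ≠ 0) (V : VField (IU m) (Collar H)) :
    C^∞⟮IU m, Collar H; ℝ⟯ :=
  ⟨fun p => divergence X (horizontalField V p.1) p.2, fun p => by
    obtain ⟨F, hF, -⟩ := exists_chartFrame hX p.2 Filter.univ_mem
    have hc := F.center_mem_domain
    rw [hF] at hc
    have h : (fun p : Collar H => divergence X (horizontalField V p.1) p.2) =ᶠ[nhds p] fun p =>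
        (∑ i, act (liftField (F.field i)) (act V (lift (F.coord i))) : C^∞⟮IU m, Collar H; ℝ⟯) p -
        act V (lift (bracket X F.coord)) p / lift (bracket X F.coord) p := by
      filter_upwards [continuousAt_snd.preimage_mem_nhds (F.isOpen_domain.mem_nhds hc)] with q hq
      rw [divergence_horizontalField hX F V hq]
      rw [sum_apply]
      rfl
    refine ContMDiffAt.congr_of_eventuallyEq ?_ h
    refine ContMDiffAt.sub (ContMDiffMap.contMDiff _ _) ?_
    exact ContMDiffAt.div₀ (ContMDiffMap.contMDiff _ _) (ContMDiffMap.contMDiff _ _)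
      (F.bracket_ne_zero hc)⟩

lemma levelDivergence_apply (hX : ∀ x, X.1 x ≠ 0) (V : VField (IU m) (Collar H)) (r : Interval)
    (x : H) : levelDivergence hX V (r, x) = divMap hX (horizontalField V r) x := rfl

/-- The function `A - r ∂A/∂r - r div(V_H)` attached to the vector field `V = A ∂/∂r + V_H`. -/
def modularCoeff (hX : ∀ x, X.1 x ≠ 0) (V : VField (IU m) (Collar H)) : C^∞⟮IU m, Collar H; ℝ⟯ :=
  radialCoeff V - coordR * act fieldR (radialCoeff V) - coordR * levelDivergence hX V

lemma modularCoeff_apply (hX : ∀ x, X.1 x ≠ 0) (V : VField (IU m) (Collar H)) (p : Collar H) :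
    modularCoeff hX V p = radialCoeff V p - p.1 * act fieldR (radialCoeff V) p -
      p.1 * levelDivergence hX V p := rfl

/-- The divergence on each level is unique, so the quantifier over ψ disappears. -/
lemma solvesE_iff {Ω : Π x : H, TangentSpace (IH m) x [⋀^Fin m]→ₗ[ℝ] ℝ} (hΩ : IsDualForm X Ω)
    (hX : ∀ x, X.1 x ≠ 0) (c : ℝ) (V : VField (IU m) (Collar H)) :
    SolvesE Ω c V ↔ ∀ p, modularCoeff hX V p = c * p.1 := by
  have hr : radial V = radialCoeff V := funext fun p => (radialCoeff_apply V p).symm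
  have hd : ∀ r (ψ : H → ℝ), IsDivergence Ω (horizontal V r) ψ ↔
      ∀ x, ψ x = levelDivergence hX V (r, x) := fun r ψ =>
    isDivergence_iff hΩ hX (horizontalField V r) ψ
  constructor
  · rintro ⟨ψ, h1, h2⟩ ⟨r, x⟩
    rw [modularCoeff_apply, ← (hd r (ψ r)).1 (h1 r) x]
    have h3 := h2 r x
    rw [hr] at h3
    exact h3
  · intro h
    refine ⟨fun r x => levelDivergence hX V (r, x), fun r => (hd r _).2 fun _ => rfl,
      fun r x => ?_⟩
    rw [hr]
    exact h (r, x)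

/-- At r = 0 the derivatives of A and of r ∂A/∂r cancel, so A leaves no trace and the divergence on
H remains as the obstruction. -/
lemma act_fieldR_modularCoeff (hX : ∀ x, X.1 x ≠ 0) (V : VField (IU m) (Collar H)) (x : H) :
    act fieldR (modularCoeff hX V) (zeroPt, x) = - levelDivergence hX V (zeroPt, x) := by
  have h1 : act fieldR (modularCoeff hX V) (zeroPt, x) =
      act fieldR (radialCoeff V) (zeroPt, x) -
        act fieldR (coordR * act fieldR (radialCoeff V)) (zeroPt, x) -
        act fieldR (coordR * levelDivergence hX V) (zeroPt, x) := by
    have e₁ := DFunLike.congr_fun ((actDerivation fieldR).map_sub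
      (radialCoeff V - coordR * act fieldR (radialCoeff V)) (coordR * levelDivergence hX V))
      (zeroPt, x)
    have e₂ := DFunLike.congr_fun ((actDerivation fieldR).map_sub
      (radialCoeff V) (coordR * act fieldR (radialCoeff V))) (zeroPt, x)
    exact e₁.trans (congrArg (· - act fieldR (coordR * levelDivergence hX V) (zeroPt, x)) e₂)
  rw [h1, act_fieldR_coordR_mul, act_fieldR_coordR_mul]
  change _ - (0 * _ + _) - (0 * _ + _) = _
  ring

omit [T2Space H] in
lemma radialCoeff_smulField_fieldR_add (A : C^∞⟮IU m, Collar H; ℝ⟯) (Y : VField (IU m) (Collar H))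
    : radialCoeff (smulField A fieldR + Y) = A + radialCoeff Y := by
  rw [radialCoeff, act_add, act_smulField]
  congr 1
  ext p
  change A p * act fieldR coordR p = A p
  rw [act_fieldR_coordR, mul_one]

omit [T2Space H] in
lemma horizontalField_smulField_fieldR_add (A : C^∞⟮IU m, Collar H; ℝ⟯)
    (Y : VField (IU m) (Collar H)) (r : Interval) :
    horizontalField (smulField A fieldR + Y) r = horizontalField Y r := by
  ext x : 1
  change A (r, x) • (0 : Euc m) + (show ℝ × Euc m from Y (r, x)).2 = _
  rw [smul_zero, zero_add]
  rfl

omit [T2Space H] in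
lemma radialCoeff_liftField (Y : VField (IH m) H) : radialCoeff (liftField Y) = 0 := by
  ext p
  exact act_liftField_coordR Y p

omit [T2Space H] in
lemma horizontalField_liftField (Y : VField (IH m) H) (r : Interval) :
    horizontalField (liftField Y) r = Y := rfl

lemma levelDivergence_congr (hX : ∀ x, X.1 x ≠ 0) {V W : VField (IU m) (Collar H)}
    (h : ∀ r, horizontalField V r = horizontalField W r) :
    levelDivergence hX V = levelDivergence hX W := by
  ext ⟨r, x⟩
  rw [levelDivergence_apply, levelDivergence_apply, h]

/-- Once the horizontal part is prescribed, A must solve A - r ∂A/∂r = g + r div Y. The hypothesis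
says exactly that the right-hand side has no term of first order in r. -/
lemma exists_modularCoeff_eq (hX : ∀ x, X.1 x ≠ 0) (Y : VField (IU m) (Collar H))
    (hY : radialCoeff Y = 0) (g : C^∞⟮IU m, Collar H; ℝ⟯)
    (hg : ∀ x, act fieldR g (zeroPt, x) + levelDivergence hX Y (zeroPt, x) = 0) :
    ∃ A : C^∞⟮IU m, Collar H; ℝ⟯, modularCoeff hX (smulField A fieldR + Y) = g := by
  obtain ⟨A, hA⟩ := exists_sub_mul_act_fieldR_eq (g + coordR * levelDivergence hX Y) fun x => by
    have h1 : act fieldR (g + coordR * levelDivergence hX Y) (zeroPt, x) =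
        act fieldR g (zeroPt, x) + act fieldR (coordR * levelDivergence hX Y) (zeroPt, x) :=
      DFunLike.congr_fun ((actDerivation fieldR).map_add _ _) (zeroPt, x)
    rw [h1, act_fieldR_coordR_mul, ← hg x]
    change _ + (0 * _ + _) = _
    ring
  refine ⟨A, ?_⟩
  ext p
  rw [modularCoeff_apply, radialCoeff_smulField_fieldR_add, hY, add_zero,
    levelDivergence_congr hX (horizontalField_smulField_fieldR_add A Y), hA]
  change g p + p.1 * _ - p.1 * _ = g p
  ring

/-- Necessity is the derivative at r = 0. For sufficiency, the horizontal part -Y, taken the same on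
all levels, removes the term of first order. -/
lemma exists_modularCoeff_eq_iff (hX : ∀ x, X.1 x ≠ 0) (g : C^∞⟮IU m, Collar H; ℝ⟯) :
    (∃ V, modularCoeff hX V = g) ↔
      slice (act fieldR g) zeroPt ∈ LinearMap.range (divMap hX) := by
  constructor
  · rintro ⟨V, rfl⟩
    refine ⟨-horizontalField V zeroPt, ?_⟩
    rw [map_neg]
    ext x
    exact (act_fieldR_modularCoeff hX V x).symm
  · rintro ⟨Y, hY⟩
    obtain ⟨A, hA⟩ := exists_modularCoeff_eq hX (liftField (-Y)) (radialCoeff_liftField _) g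
      fun x => by
        rw [levelDivergence_apply, horizontalField_liftField, map_neg, hY]
        exact add_neg_cancel _
    exact ⟨_, hA⟩

end ModularCoeff

/-! ### The Lie derivative of the linear field on the collar. -/

section LieDerivative

variable {m : ℕ} {H : Type*} [TopologicalSpace H] [ChartedSpace (Euc m) H]

/-- The functions `r, h₁, …, h_m` on the collar. -/
def collarFun (h : Fin m → C^∞⟮IH m, H; ℝ⟯) : Fin (m + 1) → C^∞⟮IU m, Collar H; ℝ⟯ :=
  Fin.cons coordR fun i => lift (h i)

/-- ∂/∂r kills the functions lifted from H, so only the first term in the expansion of the exterior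
product survives. -/
lemma bracket_collarFun_of_linearization {Λ : MultivectorField (IU m) (Collar H) (m + 1)}
    {X : MultivectorField (IH m) H m} (hlin : Λ.1 = linearization X)
    (h : Fin m → C^∞⟮IH m, H; ℝ⟯) :
    bracket Λ (collarFun h) = ((-1) ^ m : ℝ) • (coordR * lift (bracket X h)) := by
  ext p
  obtain ⟨r, x⟩ := p
  rw [bracket_apply, hlin]
  have h1 : wedge (partialR (r, x)) (toCollar r x (X.1 x))
      (fun i => differential (IU m) (collarFun h i) (r, x)) = bracket X h x := by
    rw [wedge, AlternatingMap.alternatizeUncurryFin_apply, Fin.sum_univ_succ,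
      Finset.sum_eq_zero]
    · simp only [Fin.val_zero, pow_zero, one_smul, add_zero]
      change differential (IU m) (coordR : C^∞⟮IU m, Collar H; ℝ⟯) (r, x) (partialR (r, x)) *
        X.1 x _ = _
      rw [differential_coordR]
      change 1 * _ = _
      rw [one_mul, bracket_apply]
      congr 1
      funext i
      exact ContinuousLinearMap.ext fun v => differential_lift (h i) (r, x) (levelIncl r x v)
    · intro i _
      have h2 : differential (IU m) (lift (h i)) (r, x) (partialR (r, x)) = 0 :=
        (differential_lift (h i) (r, x) _).trans (map_zero (differential (IH m) (h i) x))
      change (-1 : ℤ) ^ (i.succ : ℕ) • (differential (IU m) (lift (h i)) (r, x)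
        (partialR (r, x)) * _) = 0
      rw [h2, zero_mul, smul_zero]
  change ((-1) ^ m * (r : ℝ)) * wedge (partialR (r, x)) (toCollar r x (X.1 x))
      (fun i => differential (IU m) (collarFun h i) (r, x)) = (-1) ^ m * (r * bracket X h x)
  rw [h1, mul_assoc]

lemma wedge_zero {E : Type*} [TopologicalSpace E] [AddCommGroup E] [Module ℝ E] {k : ℕ} (v : E) :
    wedge v (0 : (E →L[ℝ] ℝ) [⋀^Fin k]→ₗ[ℝ] ℝ) = 0 := by
  ext α
  rw [wedge, AlternatingMap.alternatizeUncurryFin_apply, AlternatingMap.zero_apply]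
  refine Finset.sum_eq_zero fun i _ => ?_
  change (-1 : ℤ) ^ (i : ℕ) • (α i v * (0 : ℝ)) = 0
  rw [mul_zero, smul_zero]

/-- At a zero of X the intrinsic derivative v ↦ X ∧ v of Λ would vanish, against transversality. -/
lemma modularField_ne_zero {Λ : MultivectorField (IU m) (Collar H) (m + 1)} (hgen : IsGeneric Λ)
    {X : MultivectorField (IH m) H m} (hX : IsModularField Λ X) (x : H) : X.1 x ≠ 0 := by
  intro h0
  obtain ⟨f, v, hv⟩ := hgen (zeroPt, x) (hX x).1
  refine hv ?_
  rw [(hX x).2 f v, h0]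
  have h1 : wedge v (toCollar (k := m) zeroPt x 0) = 0 := wedge_zero v
  rw [h1, AlternatingMap.zero_apply, mul_zero]

/-- Contracting Θ with dr and evaluating on covectors pulled back from H gives an m-vector on H,
which is a multiple of X. -/
lemma exists_bracket_collarFun_eq {X : MultivectorField (IH m) H m} {p : Collar H}
    (hX : X.1 p.2 ≠ 0) (Θ : MultivectorField (IU m) (Collar H) (m + 1)) :
    ∃ c : ℝ, ∀ h, bracket Θ (collarFun h) p = c * bracket X h p.2 := by
  obtain ⟨α, hα⟩ : ∃ α, X.1 p.2 α ≠ 0 := by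
    by_contra! h
    exact hX (AlternatingMap.ext h)
  set D : MultivectorAt (IH m) m p.2 := ((Θ.1 p).curryLeft
    (differential (IU m) (coordR : C^∞⟮IU m, Collar H; ℝ⟯) p)).compLinearMap
    { toFun := fun α => α.comp (ContinuousLinearMap.snd ℝ ℝ (Euc m))
      map_add' := fun _ _ => rfl
      map_smul' := fun _ _ => rfl } with hD
  have hDb : ∀ h : Fin m → C^∞⟮IH m, H; ℝ⟯, bracket Θ (collarFun h) p =
      D fun i => differential (IH m) (h i) p.2 := by
    intro h
    rw [bracket_apply]
    change Θ.1 p _ = Θ.1 p _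
    congr 1
    funext i
    refine Fin.cases rfl (fun i => ?_) i
    exact ContinuousLinearMap.ext fun v => differential_lift (h i) p v
  refine ⟨D α / X.1 p.2 α, fun h => ?_⟩
  have h1 := top_degree_proportional (I := IH m) finrank_euclideanSpace_fin (X.1 p.2) D
    (fun i => differential (IH m) (h i) p.2) α
  rw [hDb, bracket_apply]
  field_simp
  linear_combination (-1) * h1

variable [IsManifold (IH m) ∞ H]

/-- The frame `∂/∂r, E₁, …, E_m` of the collar. -/
def collarField {X : MultivectorField (IH m) H m} (F : ChartFrame X) :
    Fin (m + 1) → VField (IU m) (Collar H) :=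
  Fin.cons fieldR fun i => liftField (F.field i)

lemma act_collarField_collarFun {X : MultivectorField (IH m) H m} (F : ChartFrame X)
    {p : Collar H} (hp : p.2 ∈ F.domain) (i j : Fin (m + 1)) :
    act (collarField F j) (collarFun F.coord i) p = if i = j then 1 else 0 := by
  refine Fin.cases ?_ (fun i => ?_) i <;> refine Fin.cases ?_ (fun j => ?_) j
  · exact act_fieldR_coordR p
  · exact act_liftField_coordR (F.field j) p
  · exact act_fieldR_lift (F.coord i) p
  · simp only [Fin.succ_inj]
    exact (act_liftField_lift (F.field j) (F.coord i) p).trans (F.act_field_coord hp i j)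

lemma finrank_collar : Module.finrank ℝ (ℝ × Euc m) = m + 1 := by
  rw [Module.finrank_prod, finrank_euclideanSpace_fin, Module.finrank_self, add_comm]

lemma bracket_eq_mul_frameDet {X : MultivectorField (IH m) H m} (F : ChartFrame X)
    {p : Collar H} (hp : p.2 ∈ F.domain) (Θ : MultivectorField (IU m) (Collar H) (m + 1))
    (f : Fin (m + 1) → C^∞⟮IU m, Collar H; ℝ⟯) :
    bracket Θ f p = bracket Θ (collarFun F.coord) p * frameDet (collarField F) f p := by
  have h1 : bracket Θ f p * frameDet (collarField F) (collarFun F.coord) p = _ :=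
    DFunLike.congr_fun (bracket_mul_frameDet finrank_collar Θ (collarField F) f
      (collarFun F.coord)) p
  rwa [frameDet_eq_one (act_collarField_collarFun F hp), mul_one] at h1

variable [T2Space H]

/-- The Lie derivative of the linear `n`-vector field on the collar. -/
lemma lieDerivBracket_eq_modularCoeff {Λ : MultivectorField (IU m) (Collar H) (m + 1)}
    {X : MultivectorField (IH m) H m} (hlin : Λ.1 = linearization X) (hX : ∀ x, X.1 x ≠ 0)
    (F : ChartFrame X) {p : Collar H} (hp : p.2 ∈ F.domain) (V : VField (IU m) (Collar H))
    (f : Fin (m + 1) → C^∞⟮IU m, Collar H; ℝ⟯) :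
    lieDerivBracket Λ V f p = (-1) ^ m * (modularCoeff hX V p * bracket X F.coord p.2) *
      frameDet (collarField F) f p := by
  have h1 := lieDerivBracket_mul_frameDet finrank_collar Λ V (collarField F) f
    (collarFun F.coord) p
  rw [frameDet_eq_one (act_collarField_collarFun F hp), mul_one] at h1
  rw [h1]
  congr 1
  -- In the frame ∂/∂r, E₁, …, E_m the coefficient of Λ is (-1)^m r b. The first field contributes
  -- ∂A/∂r, the others combine with V(b)/b to div V_H, and V(r) = A.
  rw [lieDerivBracket_frame finrank_collar Λ V (act_collarField_collarFun F hp),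
    bracket_collarFun_of_linearization hlin, Fin.sum_univ_succ]
  have h2 : act V (((-1) ^ m : ℝ) • (coordR * lift (bracket X F.coord))) p =
      (-1) ^ m * (p.1 * act V (lift (bracket X F.coord)) p +
        bracket X F.coord p.2 * radialCoeff V p) := by
    have h3 := DFunLike.congr_fun ((actDerivation V).map_smul ((-1) ^ m : ℝ)
      (coordR * lift (bracket X F.coord))) p
    refine h3.trans ?_
    change (-1) ^ m * act V (coordR * lift (bracket X F.coord)) p = _
    rw [act_mul]
    rfl
  rw [h2, modularCoeff_apply]
  have h4 : levelDivergence hX V p = _ := divergence_horizontalField hX F V hp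
  rw [h4]
  change _ - (act fieldR (radialCoeff V) p +
    ∑ i, act (liftField (F.field i)) (act V (lift (F.coord i))) p) *
    ((-1) ^ m * (p.1 * bracket X F.coord p.2)) = _
  have h5 := F.bracket_ne_zero hp
  field_simp
  ring

/-- Fields of top degree are determined by their values on r and local coordinates of H, so only
their coefficients along (-1)^m ∂/∂r ∧ X need be compared. -/
lemma lieDerivBracket_eq_iff {Λ : MultivectorField (IU m) (Collar H) (m + 1)}
    {X : MultivectorField (IH m) H m} (hlin : Λ.1 = linearization X) (hX : ∀ x, X.1 x ≠ 0)
    (V : VField (IU m) (Collar H)) {Θ : MultivectorField (IU m) (Collar H) (m + 1)}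
    {g : C^∞⟮IU m, Collar H; ℝ⟯}
    (hg : ∀ h p, bracket Θ (collarFun h) p = (-1) ^ m * (g p * bracket X h p.2)) :
    lieDerivBracket Λ V = bracketMap (m + 1) Θ ↔ modularCoeff hX V = g := by
  constructor
  · intro h
    ext p
    obtain ⟨F, hF, -⟩ := exists_chartFrame hX p.2 Filter.univ_mem
    have hp := F.center_mem_domain
    rw [hF] at hp
    have h1 : lieDerivBracket Λ V (collarFun F.coord) p = bracket Θ (collarFun F.coord) p := by
      rw [h]
      rfl
    rw [lieDerivBracket_eq_modularCoeff hlin hX F hp, hg,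
      frameDet_eq_one (act_collarField_collarFun F hp), mul_one] at h1
    exact mul_right_cancel₀ (F.bracket_ne_zero hp)
      (mul_left_cancel₀ (pow_ne_zero m (by norm_num)) h1)
  · rintro rfl
    funext f
    ext p
    obtain ⟨F, hF, -⟩ := exists_chartFrame hX p.2 Filter.univ_mem
    have hp := F.center_mem_domain
    rw [hF] at hp
    rw [lieDerivBracket_eq_modularCoeff hlin hX F hp, ← hg, ← bracket_eq_mul_frameDet F hp]
    rfl

/-- The coefficient of an `n`-vector field on the collar with respect to `∂/∂r ∧ X`. -/
lemma exists_collarCoeff {X : MultivectorField (IH m) H m} (hX : ∀ x, X.1 x ≠ 0) :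
    ∃ c : MultivectorField (IU m) (Collar H) (m + 1) →ₗ[ℝ] C^∞⟮IU m, Collar H; ℝ⟯,
      ∀ Θ h p, bracket Θ (collarFun h) p = (-1) ^ m * (c Θ p * bracket X h p.2) := by
  have hsign : ((-1 : ℝ) ^ m) * (-1) ^ m = 1 := by
    rw [← mul_pow]
    norm_num
  have hex : ∀ Θ : MultivectorField (IU m) (Collar H) (m + 1), ∃ g : C^∞⟮IU m, Collar H; ℝ⟯,
      ∀ h p, bracket Θ (collarFun h) p = (-1) ^ m * (g p * bracket X h p.2) := by
    intro Θ
    choose c hc using fun p : Collar H => exists_bracket_collarFun_eq (hX p.2) Θ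
    refine ⟨⟨fun p => (-1) ^ m * c p, fun p => ?_⟩, fun h p => ?_⟩
    · obtain ⟨F, hF, -⟩ := exists_chartFrame hX p.2 Filter.univ_mem
      have hp := F.center_mem_domain
      rw [hF] at hp
      have h1 : (fun p => (-1) ^ m * c p) =ᶠ[nhds p] fun p =>
          (-1) ^ m * (bracket Θ (collarFun F.coord) p / lift (bracket X F.coord) p) := by
        filter_upwards [continuousAt_snd.preimage_mem_nhds (F.isOpen_domain.mem_nhds hp)] with q hq
        rw [hc, lift_apply, mul_div_assoc, div_self (F.bracket_ne_zero hq), mul_one]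
      refine ContMDiffAt.congr_of_eventuallyEq ?_ h1
      exact contMDiffAt_const.mul (ContMDiffAt.div₀ (ContMDiffMap.contMDiff _ _)
        (ContMDiffMap.contMDiff _ _) (F.bracket_ne_zero hp))
    · change _ = (-1) ^ m * ((-1) ^ m * c p * _)
      rw [hc, ← mul_assoc, ← mul_assoc, hsign, one_mul]
  choose c hc using hex
  -- Uniqueness makes the chosen coefficients depend linearly on Θ.
  have huniq : ∀ Θ (g : C^∞⟮IU m, Collar H; ℝ⟯), (∀ h p, bracket Θ (collarFun h) p =
      (-1) ^ m * (g p * bracket X h p.2)) → c Θ = g := by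
    intro Θ g hg
    ext p
    obtain ⟨F, hF, -⟩ := exists_chartFrame hX p.2 Filter.univ_mem
    have hp := F.center_mem_domain
    rw [hF] at hp
    exact mul_right_cancel₀ (F.bracket_ne_zero hp)
      (mul_left_cancel₀ (pow_ne_zero m (by norm_num)) ((hc Θ F.coord p).symm.trans (hg F.coord p)))
  refine ⟨{ toFun := c, map_add' := fun Θ₁ Θ₂ => ?_, map_smul' := fun a Θ => ?_ }, hc⟩
  · refine huniq _ _ fun h p => ?_
    change bracket Θ₁ (collarFun h) p + bracket Θ₂ (collarFun h) p =
      (-1) ^ m * ((c Θ₁ p + c Θ₂ p) * _)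
    rw [hc, hc]
    ring
  · refine huniq _ _ fun h p => ?_
    change a * bracket Θ (collarFun h) p = (-1) ^ m * ((a * c Θ p) * _)
    rw [hc]
    ring

end LieDerivative

/-! ### Cocycles, coboundaries and the cohomology. -/

section Main

variable {m : ℕ} {H : Type*} [TopologicalSpace H] [ChartedSpace (Euc m) H]
  [IsManifold (IH m) ∞ H] [T2Space H] {Λ : MultivectorField (IU m) (Collar H) (m + 1)}
  {X : MultivectorField (IH m) H m}

lemma mem_cocycles1_iff (hlin : Λ.1 = linearization X) (hX : ∀ x, X.1 x ≠ 0)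
    (V : VField (IU m) (Collar H)) : V ∈ cocycles1 Λ ↔ modularCoeff hX V = 0 := by
  rw [cocycles1, LinearMap.mem_ker, ← lieDerivBracket_eq_iff hlin hX V (Θ := 0), map_zero]
  intro h p
  change (0 : ℝ) = (-1) ^ m * (0 * _)
  ring

lemma mem_coboundaries2_iff (hlin : Λ.1 = linearization X) (hX : ∀ x, X.1 x ≠ 0)
    {Θ : MultivectorField (IU m) (Collar H) (m + 1)} {g : C^∞⟮IU m, Collar H; ℝ⟯}
    (hg : ∀ h p, bracket Θ (collarFun h) p = (-1) ^ m * (g p * bracket X h p.2)) :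
    Θ ∈ coboundaries2 Λ ↔ slice (act fieldR g) zeroPt ∈ LinearMap.range (divMap hX) := by
  rw [← exists_modularCoeff_eq_iff hX]
  exact exists_congr fun V => lieDerivBracket_eq_iff hlin hX V hg

omit [T2Space H] in
lemma slice_act_fieldR_coordR :
    slice (act fieldR (coordR : C^∞⟮IU m, Collar H; ℝ⟯)) zeroPt = 1 := by
  ext x
  exact act_fieldR_coordR (zeroPt, x)

/-- Φ integrates over H the derivative ∂g/∂r at r = 0 of the coefficient g. For Λ this coefficient
is r, and Φ(Λ) is the integral of 1. -/
lemma exists_functional [CompactSpace H] [ConnectedSpace H] (hlin : Λ.1 = linearization X)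
    (hX : ∀ x, X.1 x ≠ 0) : ∃ Φ : MultivectorField (IU m) (Collar H) (m + 1) →ₗ[ℝ] ℝ,
      LinearMap.ker Φ = coboundaries2 Λ ∧ Φ Λ ≠ 0 := by
  obtain ⟨J, hJ1, hJ⟩ := exists_integral_eq_zero_iff hX
  obtain ⟨c, hc⟩ := exists_collarCoeff hX
  let σ : C^∞⟮IU m, Collar H; ℝ⟯ →ₗ[ℝ] C^∞⟮IH m, H; ℝ⟯ :=
    { toFun := fun f => slice f zeroPt, map_add' := fun _ _ => rfl, map_smul' := fun _ _ => rfl }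
  refine ⟨J ∘ₗ σ ∘ₗ (actDerivation fieldR).toLinearMap ∘ₗ c, ?_, ?_⟩
  · ext Θ
    rw [LinearMap.mem_ker, mem_coboundaries2_iff hlin hX (hc Θ), ← hJ]
    rfl
  · have h1 : c Λ = coordR := by
      ext p
      obtain ⟨F, hF, -⟩ := exists_chartFrame hX p.2 Filter.univ_mem
      have hp := F.center_mem_domain
      rw [hF] at hp
      have h2 := hc Λ F.coord p
      rw [bracket_collarFun_of_linearization hlin] at h2
      exact (mul_right_cancel₀ (F.bracket_ne_zero hp)
        (mul_left_cancel₀ (pow_ne_zero m (by norm_num)) h2)).symm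
    change J (slice (act fieldR (c Λ)) zeroPt) ≠ 0
    rwa [h1, slice_act_fieldR_coordR]

lemma cohomology_eq_span [CompactSpace H] [ConnectedSpace H] (hlin : Λ.1 = linearization X)
    (hX : ∀ x, X.1 x ≠ 0) : Nonempty (NambuH2 Λ ≃ₗ[ℝ] ℝ) ∧
      Submodule.span ℝ {NambuH2.mk Λ Λ} = ⊤ := by
  obtain ⟨Φ, hker, hΛ⟩ := exists_functional hlin hX
  refine ⟨⟨(Submodule.quotEquivOfEq _ _ hker.symm).trans
    (Φ.quotKerEquivOfSurjective (LinearMap.surjective fun h => hΛ (by rw [h]; rfl)))⟩, ?_⟩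
  refine Submodule.eq_top_iff'.2 fun y => ?_
  obtain ⟨Θ, rfl⟩ := Submodule.mkQ_surjective _ y
  refine Submodule.mem_span_singleton.2 ⟨Φ Θ / Φ Λ, ?_⟩
  rw [← map_smul]
  refine (Submodule.Quotient.eq _).2 ?_
  rw [← hker, LinearMap.mem_ker, map_sub, map_smul, smul_eq_mul, div_mul_cancel₀ _ hΛ, sub_self]

/-- A solution would make ∂r/∂r = 1 a divergence on H, although its integral is not zero. -/
lemma not_modularCoeff_eq_coordR [CompactSpace H] [ConnectedSpace H] (hX : ∀ x, X.1 x ≠ 0)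
    (V : VField (IU m) (Collar H)) : modularCoeff hX V ≠ coordR := by
  intro h
  obtain ⟨J, hJ1, hJ⟩ := exists_integral_eq_zero_iff hX
  have h1 := (exists_modularCoeff_eq_iff hX coordR).1 ⟨V, h⟩
  rw [slice_act_fieldR_coordR] at h1
  exact hJ1 ((hJ 1).2 h1)

lemma modularCoeff_eq_of_horizontal_eq_zero (hX : ∀ x, X.1 x ≠ 0) {V : VField (IU m) (Collar H)}
    (hV : ∀ r x, horizontal V r x = 0) (p : Collar H) :
    modularCoeff hX V p = radialCoeff V p - p.1 * act fieldR (radialCoeff V) p := by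
  have h1 : ∀ r, horizontalField V r = 0 := fun r => by
    ext x : 1
    exact hV r x
  have h2 : levelDivergence hX V p = 0 := by
    obtain ⟨r, x⟩ := p
    rw [levelDivergence_apply, h1, map_zero]
    rfl
  rw [modularCoeff_apply, h2, mul_zero, sub_zero]

end Main
end NambuCollar
end

open NambuCollar Manifold ContDiff in
theorem proposition4 {m : ℕ} {H : Type*} [TopologicalSpace H] [ChartedSpace (Euc m) H]
    [IsManifold (IH m) ∞ H] [T2Space H] [CompactSpace H] [ConnectedSpace H]
    (Λ : MultivectorField (IU m) (Collar H) (m + 1)) (hgen : IsGeneric Λ)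
    (X : MultivectorField (IH m) H m) (hX : IsModularField Λ X)
    (hlin : Λ.1 = linearization X) :
    -- the cohomology is one-dimensional and generated by the linearization
    (Nonempty (NambuH2 Λ ≃ₗ[ℝ] ℝ) ∧
      ∃ L : MultivectorField (IU m) (Collar H) (m + 1), L.1 = linearization X ∧
        Submodule.span ℝ {NambuH2.mk Λ L} = ⊤) ∧
    -- the equation E_1, and the infinitesimal automorphisms as solutions of E_0
    ∀ Ω : Π x : H, TangentSpace (IH m) x [⋀^Fin m]→ₗ[ℝ] ℝ, IsDualForm X Ω →
      (∀ V : VField (IU m) (Collar H), ¬ SolvesE Ω 1 V) ∧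
      (∀ V : VField (IU m) (Collar H), V ∈ cocycles1 Λ ↔ SolvesE Ω 0 V) ∧
      (∀ V ∈ cocycles1 Λ, IsDivergence Ω (horizontal V zeroPt) 0) ∧
      (∀ Y : VField (IU m) (Collar H), (∀ p, radial Y p = 0) →
        IsDivergence Ω (horizontal Y zeroPt) 0 →
        ∃ V ∈ cocycles1 Λ, ∀ r, horizontal V r = horizontal Y r) ∧
      (∀ V : VField (IU m) (Collar H),
        (V ∈ cocycles1 Λ ∧ ∀ r x, horizontal V r x = 0) ↔
          ∃ k : C^∞⟮IH m, H; ℝ⟯, ∀ (r : Interval) (x : H),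
            V (r, x) = ((r : ℝ) * k x) • partialR (r, x)) := by
  have hX0 := modularField_ne_zero hgen hX
  obtain ⟨hiso, hspan⟩ := cohomology_eq_span hlin hX0
  -- Λ coincides with its linearization, so it serves as the generator itself.
  refine ⟨⟨hiso, Λ, hlin, hspan⟩, fun Ω hΩ => ⟨fun V hV => ?_, fun V => ?_, fun V hV => ?_,
    fun Y hY hdiv => ?_, fun V => ⟨?_, ?_⟩⟩⟩
  · refine not_modularCoeff_eq_coordR hX0 V ?_
    ext p
    rw [(solvesE_iff hΩ hX0 1 V).1 hV p, one_mul, coordR_apply]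
  · rw [mem_cocycles1_iff hlin hX0, solvesE_iff hΩ hX0]
    constructor
    · intro h p
      rw [h, zero_mul]
      rfl
    · intro h
      ext p
      rw [h p, zero_mul]
      rfl
  · refine (isDivergence_iff hΩ hX0 (horizontalField V zeroPt) 0).2 fun x => ?_
    have h1 := act_fieldR_modularCoeff hX0 V x
    rw [(mem_cocycles1_iff hlin hX0 V).1 hV] at h1
    have h2 : act fieldR (0 : C^∞⟮IU m, Collar H; ℝ⟯) (zeroPt, x) = 0 :=
      DFunLike.congr_fun (actDerivation fieldR).map_zero (zeroPt, x)
    rw [h2] at h1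
    exact (neg_eq_zero.1 h1.symm).symm
  · have hY0 : radialCoeff Y = 0 := by
      ext p
      exact (radialCoeff_apply Y p).trans (hY p)
    have hd := (isDivergence_iff hΩ hX0 (horizontalField Y zeroPt) 0).1 hdiv
    -- Keep the horizontal part of Y and solve A - r ∂A/∂r = r div Y, which is possible because div
    -- Y vanishes at r = 0.
    obtain ⟨A, hA⟩ := exists_modularCoeff_eq hX0 Y hY0 0 fun x => by
      have h2 : act fieldR (0 : C^∞⟮IU m, Collar H; ℝ⟯) (zeroPt, x) = 0 :=
        DFunLike.congr_fun (actDerivation fieldR).map_zero (zeroPt, x)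
      rw [h2, zero_add]
      exact (hd x).symm
    exact ⟨_, (mem_cocycles1_iff hlin hX0 _).2 hA, fun r => funext fun x =>
      DFunLike.congr_fun (horizontalField_smulField_fieldR_add A Y r) x⟩
  · rintro ⟨hV, hV0⟩
    -- Without horizontal part the cocycle condition is A - r ∂A/∂r = 0.
    obtain ⟨k, hk⟩ := (sub_mul_act_fieldR_eq_zero_iff (radialCoeff V)).1 fun p => by
      rw [← modularCoeff_eq_of_horizontal_eq_zero hX0 hV0, (mem_cocycles1_iff hlin hX0 V).1 hV]
      rfl
    refine ⟨k, fun r x => ?_⟩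
    have h1 : (show ℝ × Euc m from V (r, x)).1 = r * k x :=
      (radialCoeff_apply V (r, x)).symm.trans (hk r x)
    have h2 : (show ℝ × Euc m from V (r, x)) = ((r * k x : ℝ) * 1, (r * k x : ℝ) • (0 : Euc m)) := by
      rw [mul_one, smul_zero]
      exact Prod.ext h1 (hV0 r x)
    exact h2
  · rintro ⟨k, hk⟩
    have hV0 : ∀ r x, horizontal V r x = 0 := fun r x => by
      change (show ℝ × Euc m from V (r, x)).2 = 0
      rw [hk]
      exact smul_zero _
    refine ⟨(mem_cocycles1_iff hlin hX0 V).2 ?_, hV0⟩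
    ext p
    rw [modularCoeff_eq_of_horizontal_eq_zero hX0 hV0]
    refine (sub_mul_act_fieldR_eq_zero_iff (radialCoeff V)).2 ⟨k, fun r x => ?_⟩ p
    rw [radialCoeff_apply]
    change (show ℝ × Euc m from V (r, x)).1 = _
    rw [hk]
    exact mul_one _
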